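/- **Conventions.** On $\mathbb C^3$ let $g=\sum_j|dz_j|^2$, $\omega=\frac i2\sum_j dz_j\wedge d\bar z_j$, $\Omega=dz_1\wedge dz_2\wedge dz_3$, and let $\mathcal S^5$ be the unit sphere. Define the anti-bilinear cross product $$u\times v=(\bar u_2\bar v_3-\bar u_3\bar v_2,\ \bar u_3\bar v_1-\bar u_1\bar v_3,\ \bar u_1\bar v_2-\bar u_2\bar v_1).$$ Submanifolds are immersed and may be singular: a *singular immersed 3-fold* in $\mathbb C^3$ is a smooth 3-manifold $N$ with a smooth map $\iota:N\to\mathbb C^3$ that is an immersion on a dense subset of $N$. It is *special Lagrangian (SL)* if at every point where $\iota$ is an immersion the tangent plane, suitably oriented, is calibrated by $\operatorname{Re}\Omega$ (that is, $\operatorname{Re}\Omega$ restricts to its volume form). It is *ruled*, with ruling $(\Sigma,\pi)$, if $\Sigma$ is a smooth surface and $\pi:N\to\Sigma$ is a smooth submersion such that $\iota$ maps each fibre $\pi^{-1}(\sigma)$ bijectively and immersively onto a real affine line. An *r-orientation* is a choice of orientation of each line $\pi^{-1}(\sigma)$ depending continuously on $\sigma$; equivalently, it is the continuous map $\phi:\Sigma\to\mathcal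 S^5$ for which $\phi(\sigma)$ is the positive unit vector parallel to that line. An *r-oriented two-sided SL cone* is an r-oriented ruled SL 3-fold $N_0$ whose lines all pass through $0$ and whose map $\iota_0$ is an immersion away from $\iota_0^{-1}(0)$. Given such an $N_0$, with ruling $(\Sigma,\pi_0)$ and r-orientation $\phi:\Sigma\to\mathcal S^5$, smooth local coordinates $(s,t)$ on an open subset of $\Sigma$ are *oriented conformal coordinates* if $|\phi_s|=|\phi_t|$, $g(\phi_s,\phi_t)=0$ and $\operatorname{Re}\Omega(\phi,\phi_s,\phi_t)>0$. **Theorem.** Let $N_0$ be an r-oriented two-sided special Lagrangian cone in $\mathbb C^3$, with ruling $(\Sigma,\pi_0)$ and r-orientation $\phi:\Sigma\to\mathcal S^5$. Then (the image of) $N_0$ is $$\{r\,\phi(\sigma):\sigma\in\Sigma,\ r\in\mathbb R\}.$$ The surface $\Sigma$ is a Riemann surface, whose holomorphic local coordinates are exactly the maps $s+it$ for $(s,t)$ oriented conformal coordinates, and $\phi$ is real analytic. In all oriented conformal coordinates $(s,t)$ on any open set $U\subset\Sigma$ we have $$\omega\Bigl(\phi,\frac{\partial\phi}{\partial s}\Bigr)\equiv0\qquad\text{and}\qquad\frac{\partial\phi}{\partial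 t}=\phi\times\frac{\partial\phi}{\partial s}.$$ Let $w$ be any holomorphic vector field on $\Sigma$, regarded as a real vector field ($w=u\,\partial/\partial s+v\,\partial/\partial t$ with $u+iv$ a holomorphic function of $s+it$), and let $\psi=\mathcal L_w\phi=d\phi(w):\Sigma\to\mathbb C^3$. Then $$N=\{r\,\phi(\sigma)+\psi(\sigma):\sigma\in\Sigma,\ r\in\mathbb R\},$$ that is, $\Sigma\times\mathbb R$ with the map $(\sigma,r)\mapsto r\,\phi(\sigma)+\psi(\sigma)$, the projection $(\sigma,r)\mapsto\sigma$ and the r-orientation $\phi$, is an r-oriented ruled special Lagrangian 3-fold in $\mathbb C^3$. -/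

import Mathlib

open scoped Manifold ContDiff

noncomputable section

/-- The space `ℂ³` with its Euclidean norm. The metric `g = |dz₁|² + |dz₂|² + |dz₃|²` is the
real inner product `inner ℝ`. -/
abbrev C3 : Type := EuclideanSpace ℂ (Fin 3)

/-- The Kähler form `ω = (i/2) (dz₁ ∧ dz̄₁ + dz₂ ∧ dz̄₂ + dz₃ ∧ dz̄₃)` on a pair of vectors,
that is `(i/2) ∑ (uⱼ v̄ⱼ - vⱼ ūⱼ) = ∑ Im (ūⱼ vⱼ)`. -/
def kahlerForm (u v : C3) : ℝ :=
  ∑ j, ((starRingEnd ℂ) (u j) * v j).im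

/-- `Re Ω`, where `Ω = dz₁ ∧ dz₂ ∧ dz₃` is the complex determinant. -/
def reOmega (u v w : C3) : ℝ :=
  (Matrix.det !![u 0, u 1, u 2; v 0, v 1, v 2; w 0, w 1, w 2]).re

/-- The anti-bilinear cross product on `ℂ³`: the componentwise complex conjugate of the usual
cross product. -/
def crossC (u v : C3) : C3 :=
  WithLp.toLp 2 ![
    (starRingEnd ℂ) (u 1 * v 2 - u 2 * v 1),
    (starRingEnd ℂ) (u 2 * v 0 - u 0 * v 2),
    (starRingEnd ℂ) (u 0 * v 1 - u 1 * v 0)]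

/-- A real 3-plane `V` in `ℂ³` is a special Lagrangian plane (of phase 1) if it can be oriented
so that `Re Ω` restricts to the volume form of `V`: `Re Ω` takes the value `1` on an orthonormal
basis of `V` (which then is an oriented one). -/
def IsSpecialLagrangianPlane (V : Submodule ℝ C3) : Prop :=
  ∃ b : Fin 3 → C3, Orthonormal ℝ b ∧ Submodule.span ℝ (Set.range b) = V ∧
    reOmega (b 0) (b 1) (b 2) = 1

section Ruled

variable {EN HN N ES HS S : Type*}
  [NormedAddCommGroup EN] [NormedSpace ℝ EN] [TopologicalSpace HN]
  [TopologicalSpace N] [ChartedSpace HN N]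
  [NormedAddCommGroup ES] [NormedSpace ℝ ES] [TopologicalSpace HS]
  [TopologicalSpace S] [ChartedSpace HS S]

/-- The differential `T_p N → ℂ³` of the map `ι : N → ℂ³` at `p`. -/
def differential (I : ModelWithCorners ℝ EN HN) (ι : N → C3) (p : N) :
    TangentSpace I p →L[ℝ] C3 :=
  mfderiv I 𝓘(ℝ, C3) ι p

/-- The map `ι` is an immersion at the point `p`. -/
def IsImmersedAt (I : ModelWithCorners ℝ EN HN) (ι : N → C3) (p : N) : Prop :=
  Function.Injective (differential I ι p)

/-- The (possibly singular) immersed submanifold `ι : N → ℂ³` is special Lagrangian: its tangent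
plane at every point where it is nonsingular is a special Lagrangian 3-plane. The orientation of
a special Lagrangian plane is unique, it is the one with `Re Ω > 0`, and so the orientations of
the tangent planes vary continuously. -/
def IsSpecialLagrangian (I : ModelWithCorners ℝ EN HN) (ι : N → C3) : Prop :=
  ∀ p : N, IsImmersedAt I ι p →
    IsSpecialLagrangianPlane (differential I ι p : TangentSpace I p →ₗ[ℝ] C3).range

/-- `(N, S, π)` is a ruled (possibly singular) immersed submanifold of `ℂ³`, with immersion `ι`:
a smooth map `ι : N → ℂ³` which is an immersion on a dense set of points, and a smooth
submersion `π : N → S` each of whose fibres is mapped by `ι` bijectively and immersively onto a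
real affine straight line. -/
structure IsRuled (IN : ModelWithCorners ℝ EN HN) (IS : ModelWithCorners ℝ ES HS)
    (ι : N → C3) (π : N → S) : Prop where
  smooth_map : ContMDiff IN 𝓘(ℝ, C3) ∞ ι
  smooth_proj : ContMDiff IN IS ∞ π
  dense_immersed : Dense {p : N | IsImmersedAt IN ι p}
  submersion : ∀ p : N, Function.Surjective (mfderiv IN IS π p)
  fibre_injOn : ∀ σ : S, Set.InjOn ι (π ⁻¹' {σ})
  fibre_immersed : ∀ (p : N) (v : TangentSpace IN p),
    mfderiv IN IS π p v = 0 → differential IN ι p v = 0 → v = 0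
  fibre_line : ∀ σ : S, ∃ a d : C3, d ≠ 0 ∧
    ι '' (π ⁻¹' {σ}) = {x : C3 | ∃ r : ℝ, x = a + r • d}

/-- An r-orientation of a ruling: an orientation of each of the real lines `π⁻¹(σ)` that varies
continuously with `σ`. It is given by the unit vector `φ σ` that is parallel to the line and
points in the positive direction. -/
structure IsROrientation (ι : N → C3) (π : N → S) (φ : S → C3) : Prop where
  continuous : Continuous φ
  norm_eq_one : ∀ σ : S, ‖φ σ‖ = 1
  parallel : ∀ p q : N, π p = π q → ∃ r : ℝ, ι q - ι p = r • φ (π p)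

/-- `(N, S, π)` is an r-oriented ruled special Lagrangian submanifold of `ℂ³`, with immersion
`ι` (possibly with singularities) and r-orientation `φ`. -/
structure IsROrientedRuledSL (IN : ModelWithCorners ℝ EN HN) (IS : ModelWithCorners ℝ ES HS)
    (ι : N → C3) (π : N → S) (φ : S → C3) : Prop where
  ruled : IsRuled IN IS ι π
  rOrientation : IsROrientation ι π φ
  specialLagrangian : IsSpecialLagrangian IN ι

/-- An r-oriented two-sided special Lagrangian cone with vertex `0`, regarded as a ruled
submanifold: the lines of the ruling pass through `0` (so the image is invariant under
multiplication by all real numbers), and `ι` is an immersion away from the vertex. -/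
structure IsROrientedTwoSidedSLCone
    (IN : ModelWithCorners ℝ EN HN) (IS : ModelWithCorners ℝ ES HS)
    (ι : N → C3) (π : N → S) (φ : S → C3) : Prop
    extends IsROrientedRuledSL IN IS ι π φ where
  through_zero : ∀ σ : S, ∃ p : N, π p = σ ∧ ι p = 0
  immersed : ∀ p : N, ι p ≠ 0 → IsImmersedAt IN ι p

end Ruled

section Coordinates

variable {ES HS S : Type*}
  [NormedAddCommGroup ES] [NormedSpace ℝ ES] [TopologicalSpace HS]
  [TopologicalSpace S] [ChartedSpace HS S]

/-- The partial derivative `∂φ/∂s` at the point with coordinate `z`, in local coordinates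
`e = s + i t` on the surface `S`. -/
def partialS (φ : S → C3) (e : OpenPartialHomeomorph S ℂ) (z : ℂ) : C3 :=
  fderiv ℝ (fun y : ℂ => φ (e.symm y)) z 1

/-- The partial derivative `∂φ/∂t` at the point with coordinate `z`, in local coordinates
`e = s + i t` on the surface `S`. -/
def partialT (φ : S → C3) (e : OpenPartialHomeomorph S ℂ) (z : ℂ) : C3 :=
  fderiv ℝ (fun y : ℂ => φ (e.symm y)) z Complex.I

/-- `e = s + i t` gives oriented conformal coordinates `(s, t)` on the open set `e.source` of the
surface `S`: smooth local coordinates that are conformal for the metric `φ^* g`, and oriented for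
the orientation of `S` in which `(s, t)` is oriented if `Re Ω (φ, ∂φ/∂s, ∂φ/∂t) > 0`. In other
words `J (∂/∂s) = ∂/∂t`, for the complex structure `J` of this metric and this orientation. -/
structure IsOrientedConformal (IS : ModelWithCorners ℝ ES HS) (φ : S → C3)
    (e : OpenPartialHomeomorph S ℂ) : Prop where
  smooth : ContMDiffOn IS 𝓘(ℝ, ℂ) ∞ e e.source
  smooth_symm : ContMDiffOn 𝓘(ℝ, ℂ) IS ∞ e.symm e.target
  norm_eq : ∀ z ∈ e.target, ‖partialS φ e z‖ = ‖partialT φ e z‖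
  orthogonal : ∀ z ∈ e.target, inner ℝ (partialS φ e z) (partialT φ e z) = 0
  oriented : ∀ z ∈ e.target, 0 < reOmega (φ (e.symm z)) (partialS φ e z) (partialT φ e z)

end Coordinates

section VectorFields

variable {S : Type*} [TopologicalSpace S] [ChartedSpace ℂ S]

/-- A holomorphic vector field on a Riemann surface: a holomorphic section of its holomorphic
tangent bundle. In a holomorphic coordinate `s + i t` the section `(u + i v) ∂/∂z` is identified
with the real vector field `u ∂/∂s + v ∂/∂t`. -/
def IsHolomorphicVectorField [IsManifold 𝓘(ℂ) ω S]
    (w : ∀ σ : S, TangentSpace 𝓘(ℂ) σ) : Prop :=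
  ContMDiff 𝓘(ℂ) 𝓘(ℂ).tangent ω (fun σ : S => (⟨σ, w σ⟩ : TangentBundle 𝓘(ℂ) S))

/-- The Lie derivative `L_w φ = dφ(w)` of the vector-valued function `φ` along the real vector
field `w`. -/
def lieDerivative (w : ∀ σ : S, TangentSpace 𝓘(ℝ, ℂ) σ) (φ : S → C3) (σ : S) : C3 :=
  differential 𝓘(ℝ, ℂ) φ σ (w σ)

/-- The real vector field on a Riemann surface underlying a section of the holomorphic tangent
bundle. Both tangent spaces at `σ` are `ℂ`, through the preferred chart at `σ`. -/
def toRealVectorField (w : ∀ σ : S, TangentSpace 𝓘(ℂ) σ) :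
    ∀ σ : S, TangentSpace 𝓘(ℝ, ℂ) σ :=
  fun σ => w σ

end VectorFields

end

/-! Geometry. Over each `σ` there is a point of the cone mapped to `φ(σ)`, and `ι₀` is an immersion
there. Following it along a local section of the ruling shows that `φ` is smooth, and the tangent
plane at that point is a special Lagrangian plane spanned by `φ` and the image of `dφ`. If `u, v, w`
is an orthonormal basis of such a plane with `Re Ω(u,v,w) = 1`, then `‖u × v - w‖² = -ω(u,v)²`, so
`w = u × v` and `ω(u,v) = 0`. Hence `φ ×` preserves the image of `dφ`, is isometric on it and
squares to `-1`: it is the complex structure of the induced metric and orientation. So coordinates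
are oriented conformal exactly when `φ_t = φ × φ_s`, the changes between them satisfy the
Cauchy-Riemann equations, and they form a holomorphic atlas as soon as they exist near every point.

Analysis. Existence and analyticity are both proved in the algebra of absolutely convergent double
Fourier series, where `∂ ∂̄⁻¹` and the inverse of `∂̄` modulo means are bounded Fourier multipliers.
Conformal coordinates solve a Beltrami equation `∂̄f = μ ∂f`. A linear change of coordinates gives
`μ(0) = 0`, a dilation then makes `μ` small, and a Neumann series gives a smooth solution
(`exists_beltrami`). For analyticity, differentiating `φ_t = φ × φ_s` gives `φ_ss + φ_tt = 2 φ_t ×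
φ_s`. As the product is anti-bilinear, the functions `∂φ`, `conj (∂̄φ)`, `φ` and `1` form a solution
`W` of a system `∂̄W = Q(conj W, W)` with `Q` bilinear. Take a real bump function `η` with `η = 1`
near `0`. The deformed functions `W(z + a η(z))` solve an equation in the Wiener algebra that is
analytic in the parameter `a`; when `W` is small, which a dilation achieves, the implicit function
theorem shows that they depend analytically on `a`. Their value at `z = 0` is `W(a)`, so `W` is
analytic (`analyticAt_of_dbar_eq`).

Ruled 3-folds. For a holomorphic field with coefficient `a`, let `Ψ = r φ + dφ(a)`. Differentiating
`φ_t = φ × φ_s` along `a` gives `Ψ_t = φ × Ψ_s` up to a multiple of `φ`, and `ω(φ, Ψ_s) = 0`; a span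
of `φ`, `Ψ_s`, `Ψ_t` of dimension 3 is then special Lagrangian (`isSpecialLagrangianPlane_span`).
Immersion fails at no more than one `r` on each line, which gives density. -/

noncomputable section

/-! ### Characters of the torus and the Wiener algebra. -/

open Complex in
/-- The character `z ↦ exp (2 π i (m x + n y))` of the plane. -/
def planeChar (n : ℤ × ℤ) (z : ℂ) : ℂ :=
  exp ((2 * Real.pi * (n.1 * z.re + n.2 * z.im) : ℝ) * I)

lemma norm_planeChar (n : ℤ × ℤ) (z : ℂ) : ‖planeChar n z‖ = 1 :=
  Complex.norm_exp_ofReal_mul_I _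

lemma planeChar_zero (z : ℂ) : planeChar 0 z = 1 := by simp [planeChar]

lemma planeChar_zero_right (n : ℤ × ℤ) : planeChar n 0 = 1 := by simp [planeChar]

lemma planeChar_add (m n : ℤ × ℤ) (z : ℂ) :
    planeChar (m + n) z = planeChar m z * planeChar n z := by
  rw [planeChar, planeChar, planeChar, ← Complex.exp_add]
  congr 1
  push_cast [Prod.fst_add, Prod.snd_add]
  ring

lemma planeChar_add_right (n : ℤ × ℤ) (z w : ℂ) :
    planeChar n (z + w) = planeChar n z * planeChar n w := by
  rw [planeChar, planeChar, planeChar, ← Complex.exp_add]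
  congr 1
  simp only [Complex.add_re, Complex.add_im]
  push_cast
  ring

lemma planeChar_neg (n : ℤ × ℤ) (z : ℂ) :
    planeChar (-n) z = (starRingEnd ℂ) (planeChar n z) := by
  rw [planeChar, planeChar, ← Complex.exp_conj]
  congr 1
  simp only [map_mul, Complex.conj_ofReal, Complex.conj_I, Prod.fst_neg, Prod.snd_neg]
  push_cast
  ring

/-- The Wiener algebra of absolutely convergent double Fourier series, as the space of families of
Fourier coefficients. -/
abbrev Wiener : Type := lp (fun _ : ℤ × ℤ => ℂ) 1

namespace Wiener

lemma summable_norm (a : Wiener) : Summable fun n => ‖a n‖ := by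
  simpa using (lp.memℓp a).summable (by simp)

lemma norm_eq (a : Wiener) : ‖a‖ = ∑' n, ‖a n‖ := by
  simp [lp.norm_eq_tsum_rpow (p := 1) (by simp) a]

/-- The element of the Wiener algebra with given coefficients. -/
def mk (f : ℤ × ℤ → ℂ) (hf : Summable fun n => ‖f n‖) : Wiener :=
  ⟨f, memℓp_gen (by simpa using hf)⟩

@[simp] lemma mk_apply (f : ℤ × ℤ → ℂ) (hf) (n : ℤ × ℤ) : mk f hf n = f n := rfl

lemma ext_apply {a b : Wiener} (h : ∀ n, a n = b n) : a = b := lp.ext (funext h)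

lemma norm_le_of_le {a : Wiener} {b : ℤ × ℤ → ℝ} (hb : Summable b) (h : ∀ n, ‖a n‖ ≤ b n) :
    ‖a‖ ≤ ∑' n, b n := by
  rw [norm_eq]
  exact (summable_norm a).tsum_le_tsum h hb

/-- The Fourier multiplier with a bounded symbol. -/
def multiplier (m : ℤ × ℤ → ℂ) (C : ℝ) (hm : ∀ n, ‖m n‖ ≤ C) : Wiener →L[ℂ] Wiener :=
  LinearMap.mkContinuous
    { toFun := fun a => mk (fun n => m n * a n) (by
        refine Summable.of_nonneg_of_le (fun n => norm_nonneg _) (fun n => ?_)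
          ((summable_norm a).mul_left C)
        rw [norm_mul]
        exact mul_le_mul_of_nonneg_right (hm n) (norm_nonneg _))
      map_add' := fun a b => ext_apply fun n => by
        simp [mul_add]
      map_smul' := fun c a => ext_apply fun n => by
        simp [lp.coeFn_smul]; ring }
    C (fun a => by
      refine (norm_le_of_le ((summable_norm a).mul_left C) fun n => ?_).trans ?_
      · simp only [LinearMap.coe_mk, AddHom.coe_mk, mk_apply, norm_mul]
        exact mul_le_mul_of_nonneg_right (hm n) (norm_nonneg _)
      · rw [tsum_mul_left, norm_eq])

@[simp] lemma multiplier_apply (m : ℤ × ℤ → ℂ) (C : ℝ) (hm) (a : Wiener) (n : ℤ × ℤ) :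
    multiplier m C hm a n = m n * a n := rfl

lemma norm_multiplier_le (m : ℤ × ℤ → ℂ) (C : ℝ) (hm : ∀ n, ‖m n‖ ≤ C) :
    ‖multiplier m C hm‖ ≤ C := by
  have hC : 0 ≤ C := (norm_nonneg _).trans (hm 0)
  exact LinearMap.mkContinuous_norm_le _ hC _

/-- The value at a point of an absolutely convergent double Fourier series. -/
def eval (z : ℂ) : Wiener →L[ℂ] ℂ :=
  (lp.tsumCLM ℂ (ℤ × ℤ) ℂ).comp
    (multiplier (fun n => planeChar n z) 1 fun n => (norm_planeChar n z).le)

lemma eval_apply (z : ℂ) (a : Wiener) : eval z a = ∑' n, planeChar n z * a n := rfl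

lemma norm_eval_le (z : ℂ) (a : Wiener) : ‖eval z a‖ ≤ ‖a‖ := by
  rw [eval_apply, norm_eq]
  refine (norm_tsum_le_tsum_norm ?_).trans_eq ?_ <;> simp only [norm_mul, norm_planeChar, one_mul]
  exact summable_norm a

/-- The translation of frequencies, that is multiplication by a character. -/
def shift (k : ℤ × ℤ) : Wiener →L[ℂ] Wiener :=
  LinearMap.mkContinuous
    { toFun := fun a => mk (fun n => a (n - k))
        (by simpa [Function.comp_def] using (Equiv.subRight k).summable_iff.2 (summable_norm a))
      map_add' := fun a b => ext_apply fun n => by simp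
      map_smul' := fun c a => ext_apply fun n => by simp }
    1 (fun a => by
      rw [one_mul, norm_eq, norm_eq]
      exact ((Equiv.subRight k).tsum_eq fun n => ‖a n‖).le)

@[simp] lemma shift_apply (k : ℤ × ℤ) (a : Wiener) (n : ℤ × ℤ) : shift k a n = a (n - k) := rfl

lemma norm_shift_le (k : ℤ × ℤ) : ‖shift k‖ ≤ 1 :=
  LinearMap.mkContinuous_norm_le _ zero_le_one _

lemma eval_shift (z : ℂ) (k : ℤ × ℤ) (a : Wiener) :
    eval z (shift k a) = planeChar k z * eval z a := by
  rw [eval_apply, eval_apply, ← tsum_mul_left, ← (Equiv.addRight k).tsum_eq]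
  refine tsum_congr fun n => ?_
  simp only [Equiv.coe_addRight, shift_apply, add_sub_cancel_right, planeChar_add]
  ring

lemma norm_smul_shift_le (a : Wiener) (k : ℤ × ℤ) : ‖a k • shift k‖ ≤ ‖a k‖ := by
  rw [norm_smul]
  exact mul_le_of_le_one_right (norm_nonneg _) (norm_shift_le k)

lemma summable_norm_smul_shift (a : Wiener) : Summable fun k => ‖a k • shift k‖ :=
  Summable.of_nonneg_of_le (fun _ => norm_nonneg _) (norm_smul_shift_le a) (summable_norm a)

lemma summable_smul_shift (a : Wiener) : Summable fun k => a k • shift k :=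
  (summable_norm_smul_shift a).of_norm

/-- The product of absolutely convergent double Fourier series. -/
def mul : Wiener →L[ℂ] Wiener →L[ℂ] Wiener :=
  LinearMap.mkContinuous
    -- Convolution is written as a sum of frequency translations, which converges absolutely in
    -- operator norm because each translation has norm at most `1`.
    { toFun := fun a => ∑' k, a k • shift k
      map_add' := fun a b => by
        rw [← (summable_smul_shift a).tsum_add (summable_smul_shift b)]
        refine tsum_congr fun k => ?_
        rw [lp.coeFn_add, Pi.add_apply, add_smul]
      map_smul' := fun c a => by
        rw [RingHom.id_apply, ← (summable_smul_shift a).tsum_const_smul]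
        refine tsum_congr fun k => ?_
        rw [lp.coeFn_smul, Pi.smul_apply, smul_assoc] }
    1 (fun a => by
      rw [one_mul, norm_eq]
      exact (norm_tsum_le_tsum_norm (summable_norm_smul_shift a)).trans
        ((summable_norm_smul_shift a).tsum_le_tsum (norm_smul_shift_le a) (summable_norm a)))

lemma mul_eq (a : Wiener) : mul a = ∑' k, a k • shift k := rfl

lemma norm_mul_le : ‖mul‖ ≤ 1 := LinearMap.mkContinuous_norm_le _ zero_le_one _

lemma norm_mul_apply_le (a : Wiener) : ‖mul a‖ ≤ ‖a‖ := by
  simpa using mul.le_of_opNorm_le norm_mul_le a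

lemma eval_mul (z : ℂ) (a b : Wiener) : eval z (mul a b) = eval z a * eval z b := by
  have h := ((summable_smul_shift a).hasSum.mapL
    ((ContinuousLinearMap.apply ℂ Wiener b))).mapL (eval z)
  rw [mul_eq, eval_apply z a, ← tsum_mul_right]
  refine h.tsum_eq.symm.trans (tsum_congr fun k => ?_)
  simp [eval_shift]
  ring

/-- The complex conjugate of an absolutely convergent double Fourier series. -/
def conj : Wiener →L[ℝ] Wiener :=
  LinearMap.mkContinuous
    { toFun := fun a => mk (fun n => (starRingEnd ℂ) (a (-n))) (by
        simpa [Function.comp_def] using (Equiv.neg (ℤ × ℤ)).summable_iff.2 (summable_norm a))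
      map_add' := fun a b => ext_apply fun n => by simp
      map_smul' := fun c a => ext_apply fun n => by simp [lp.coeFn_smul] }
    1 (fun a => by
      rw [one_mul, norm_eq, norm_eq, ← (Equiv.neg (ℤ × ℤ)).tsum_eq fun n => ‖a n‖]
      simp)

lemma norm_conj_le : ‖conj‖ ≤ 1 := LinearMap.mkContinuous_norm_le _ zero_le_one _

lemma eval_conj (z : ℂ) (a : Wiener) : eval z (conj a) = (starRingEnd ℂ) (eval z a) := by
  rw [eval_apply, eval_apply, Complex.conj_tsum, ← (Equiv.neg (ℤ × ℤ)).tsum_eq]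
  refine tsum_congr fun n => ?_
  rw [map_mul, ← planeChar_neg]
  simp [conj]

end Wiener

end

/-! ### Fourier inversion and uniqueness of coefficients. -/

noncomputable section

section FourierSeries

open MeasureTheory AddCircle

/-- A continuous function on a period which vanishes at the ends is the sum of its Fourier series,
if this converges absolutely. -/
lemma hasSum_fourier_of_vanishing_ends {f : ℝ → ℂ} (hf : Continuous f)
    (h0 : f (-1 / 2) = 0) (h1 : f (1 / 2) = 0)
    (hs : Summable fun m : ℤ =>
      ‖∫ x in (-1 / 2 : ℝ)..(1 / 2), f x * planeChar (-m, 0) x‖)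
    {x : ℝ} (hx : x ∈ Set.Icc (-1 / 2 : ℝ) (1 / 2)) :
    HasSum (fun m : ℤ => planeChar (m, 0) x *
      ∫ x in (-1 / 2 : ℝ)..(1 / 2), f x * planeChar (-m, 0) x) (f x) := by
  have : Fact (0 < (1 : ℝ)) := ⟨one_pos⟩
  have hfour : ∀ (m : ℤ) (t : ℝ), fourier m (t : AddCircle (1 : ℝ)) = planeChar (m, 0) t := by
    intro m t
    rw [fourier_coe_apply, planeChar]
    congr 1
    push_cast
    simp
    ring
  have hend : (-1 / 2 : ℝ) + 1 = 1 / 2 := by norm_num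
  -- Equal values at the two ends let `f` descend to a continuous function on the circle, where
  -- absolute convergence of the series implies pointwise inversion.
  let g : C(AddCircle (1 : ℝ), ℂ) := ⟨AddCircle.liftIco 1 (-1 / 2) f,
    AddCircle.liftIco_continuous (by rw [hend, h0, h1]) hf.continuousOn⟩
  have hcoef : ∀ m : ℤ, fourierCoeff g m =
      ∫ x in (-1 / 2 : ℝ)..(1 / 2), f x * planeChar (-m, 0) x := by
    intro m
    change fourierCoeff (AddCircle.liftIco 1 (-1 / 2) f) m = _
    rw [fourierCoeff_liftIco_eq, fourierCoeffOn_eq_integral]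
    rw [hend, show (1 / 2 - -1 / 2 : ℝ) = 1 by norm_num]
    simp only [div_one, one_smul, smul_eq_mul]
    refine intervalIntegral.integral_congr fun t _ => ?_
    rw [hfour, mul_comm]
  have hsum : Summable (fourierCoeff g) := by
    refine Summable.of_norm ?_
    simpa only [hcoef] using hs
  have hval : g (x : AddCircle (1 : ℝ)) = f x := by
    rcases hx.2.lt_or_eq with h | h
    · exact AddCircle.liftIco_coe_apply (by rw [hend]; exact ⟨hx.1, h⟩)
    · have : (x : AddCircle (1 : ℝ)) = ((-1 / 2 : ℝ) : AddCircle (1 : ℝ)) := by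
        rw [h, ← hend, AddCircle.coe_add_period]
      rw [this, h, h1, ← h0]
      exact AddCircle.liftIco_coe_apply (by rw [hend]; norm_num)
  have := has_pointwise_sum_fourier_series_of_summable hsum (x : AddCircle (1 : ℝ))
  rw [hval] at this
  simpa only [hcoef, hfour, smul_eq_mul, mul_comm] using this

/-- The coefficients of an absolutely convergent Fourier series are determined by its sum. -/
lemma eq_zero_of_fourier_series_eq_zero {b : ℤ → ℂ} (hb : Summable fun m => ‖b m‖)
    (h : ∀ x ∈ Set.Icc (-1 / 2 : ℝ) (1 / 2), ∑' m, planeChar (m, 0) x * b m = 0) (k : ℤ) :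
    b k = 0 := by
  have : Fact (0 < (1 : ℝ)) := ⟨one_pos⟩
  have hfour : ∀ (m : ℤ) (t : ℝ), fourier m (t : AddCircle (1 : ℝ)) = planeChar (m, 0) t := by
    intro m t
    rw [fourier_coe_apply, planeChar]
    congr 1
    push_cast
    simp
    ring
  have hnorm : ∀ (m : ℤ) (t : AddCircle (1 : ℝ)), ‖fourier m t‖ = 1 := fun m t =>
    Circle.norm_coe _
  -- The series is integrated term by term against the character of frequency `-k`; orthogonality
  -- isolates `b k`.
  let F : ℤ → AddCircle (1 : ℝ) → ℂ := fun m t => fourier (-k) t * (b m * fourier m t)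
  have hint : ∀ m, Integrable (F m) (haarAddCircle (T := 1)) := fun m =>
    (by fun_prop : Continuous (F m)).integrable_of_hasCompactSupport
      (HasCompactSupport.of_compactSpace _)
  have hF : ∀ m t, ‖F m t‖ = ‖b m‖ := fun m t => by
    simp only [F, norm_mul, hnorm, one_mul, mul_one]
  have key := hasSum_integral_of_summable_integral_norm hint (by
    simpa only [hF, integral_const, smul_eq_mul, probReal_univ, one_mul] using hb)
  have hzero : ∀ t : AddCircle (1 : ℝ), ∑' m, F m t = 0 := by
    intro t
    obtain ⟨x, hx, rfl⟩ : ∃ x ∈ Set.Icc (-1 / 2 : ℝ) (1 / 2), (x : AddCircle (1 : ℝ)) = t := by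
      obtain ⟨y, hy⟩ := (AddCircle.coe_image_Icc_eq (1 : ℝ) (-1 / 2)).ge (Set.mem_univ t)
      exact ⟨y, ⟨hy.1.1, by linarith [hy.1.2]⟩, hy.2⟩
    simp only [F, tsum_mul_left, hfour]
    rw [show ∑' m, b m * planeChar (m, 0) (x : ℂ) = ∑' m, planeChar (m, 0) (x : ℂ) * b m from
      tsum_congr fun m => mul_comm _ _, h x hx, mul_zero]
  have hval : ∀ m, ∫ t, F m t ∂(haarAddCircle (T := 1)) = if m = k then b k else 0 := by
    intro m
    have h1 : ∫ t, F m t ∂(haarAddCircle (T := 1)) =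
        b m * fourierCoeff (fun t : AddCircle (1 : ℝ) => fourier m t) k := by
      rw [fourierCoeff, ← integral_const_mul]
      refine integral_congr_ae (Filter.Eventually.of_forall fun t => ?_)
      simp only [F, smul_eq_mul]
      ring
    rw [h1]
    have h2 := congrFun (fourierCoeff_fourier (T := 1) m) k
    rw [show (fun t : AddCircle (1 : ℝ) => fourier m t) = ⇑(fourier (T := 1) m) from rfl, h2]
    by_cases hmk : m = k
    · simp [hmk]
    · simp [hmk, Ne.symm hmk]
  simp only [hval, hzero, integral_zero] at key
  exact (hasSum_ite_eq k (b k)).unique key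

end FourierSeries

namespace Wiener

lemma planeChar_prod (m n : ℤ) (x y : ℝ) :
    planeChar (m, n) (x + y * Complex.I) = planeChar (m, 0) x * planeChar (n, 0) y := by
  rw [planeChar, planeChar, planeChar, ← Complex.exp_add]
  congr 1
  simp
  ring

/-- An element of the Wiener algebra is determined by its values on the unit square. -/
lemma eq_of_eval_eq {a b : Wiener}
    (h : ∀ x ∈ Set.Icc (-1 / 2 : ℝ) (1 / 2), ∀ y ∈ Set.Icc (-1 / 2 : ℝ) (1 / 2),
      eval (x + y * Complex.I) a = eval (x + y * Complex.I) b) : a = b := by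
  rw [← sub_eq_zero]
  set d := a - b
  have hd : ∀ x ∈ Set.Icc (-1 / 2 : ℝ) (1 / 2), ∀ y ∈ Set.Icc (-1 / 2 : ℝ) (1 / 2),
      eval (x + y * Complex.I) d = 0 := fun x hx y hy => by rw [map_sub, h x hx y hy, sub_self]
  have hs := summable_norm d
  have hs1 : ∀ m, Summable fun n => ‖d (m, n)‖ := fun m => hs.prod_factor m
  have hbound : ∀ y : ℝ, ∀ m, ‖∑' n, planeChar (n, 0) (y : ℂ) * d (m, n)‖ ≤ ∑' n, ‖d (m, n)‖ := by
    intro y m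
    have : ∀ n, ‖planeChar (n, 0) (y : ℂ) * d (m, n)‖ = ‖d (m, n)‖ := fun n => by
      rw [norm_mul, norm_planeChar, one_mul]
    refine (norm_tsum_le_tsum_norm ?_).trans_eq (tsum_congr this)
    simpa only [this] using hs1 m
  refine ext_apply fun ⟨m, n⟩ => ?_
  rw [lp.coeFn_zero, Pi.zero_apply]
  -- One-variable uniqueness is used twice: for fixed `y` in the variable `x`, whose coefficients
  -- are the inner sums, and then in `y` for each fixed `m`.
  refine eq_zero_of_fourier_series_eq_zero (hs1 m) (fun y hy => ?_) n
  refine eq_zero_of_fourier_series_eq_zero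
    (b := fun m => ∑' n, planeChar (n, 0) (y : ℂ) * d (m, n))
    (Summable.of_nonneg_of_le (fun _ => norm_nonneg _) (hbound y) hs.prod) (fun x hx => ?_) m
  rw [← hd x hx y hy, eval_apply, Summable.tsum_prod]
  · refine tsum_congr fun m => ?_
    rw [← tsum_mul_left]
    refine tsum_congr fun n => ?_
    rw [planeChar_prod]
    ring
  · refine Summable.of_norm ?_
    simpa only [norm_mul, norm_planeChar, one_mul] using hs

end Wiener

end

/-! ### Test functions and the decay of their Fourier coefficients. -/

noncomputable section

open MeasureTheory

/-- Smooth functions on the plane supported in the disc of radius `1/4`. -/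
structure IsTest (F : ℂ → ℂ) : Prop where
  contDiff : ContDiff ℝ ∞ F
  tsupport_subset : tsupport F ⊆ Metric.closedBall 0 (1 / 4)

namespace IsTest

variable {F G : ℂ → ℂ}

lemma hasCompactSupport (hF : IsTest F) : HasCompactSupport F :=
  (isCompact_closedBall (0 : ℂ) (1 / 4)).of_isClosed_subset (isClosed_tsupport F) hF.2

lemma continuous (hF : IsTest F) : Continuous F := hF.1.continuous

lemma eq_zero (hF : IsTest F) {z : ℂ} (hz : 1 / 4 < ‖z‖) : F z = 0 := by
  refine image_eq_zero_of_notMem_tsupport fun h => ?_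
  have := hF.2 h
  rw [mem_closedBall_zero_iff] at this
  linarith

lemma of_eq_zero (h : ContDiff ℝ ∞ F) (h0 : ∀ z, 1 / 4 < ‖z‖ → F z = 0) : IsTest F := by
  refine ⟨h, closure_minimal (fun z hz => ?_) Metric.isClosed_closedBall⟩
  rw [mem_closedBall_zero_iff]
  by_contra hn
  exact hz (h0 z (not_le.1 hn))

lemma fderiv_apply (hF : IsTest F) (v : ℂ) : IsTest fun z => fderiv ℝ F z v :=
  ⟨(hF.1.fderiv_right (by simp)).clm_apply contDiff_const,
    (tsupport_fderiv_apply_subset ℝ v).trans hF.2⟩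

lemma sub (hF : IsTest F) (hG : IsTest G) : IsTest fun z => F z - G z :=
  of_eq_zero (hF.1.sub hG.1) fun z hz => by rw [hF.eq_zero hz, hG.eq_zero hz, sub_self]

lemma add (hF : IsTest F) (hG : IsTest G) : IsTest fun z => F z + G z :=
  of_eq_zero (hF.1.add hG.1) fun z hz => by rw [hF.eq_zero hz, hG.eq_zero hz, add_zero]

lemma mul_left (hF : IsTest F) (hG : ContDiff ℝ ∞ G) : IsTest fun z => G z * F z :=
  of_eq_zero (hG.mul hF.1) fun z hz => by rw [hF.eq_zero hz, mul_zero]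

lemma const_mul (hF : IsTest F) (c : ℂ) : IsTest fun z => c * F z := hF.mul_left contDiff_const

lemma conj (hF : IsTest F) : IsTest fun z => (starRingEnd ℂ) (F z) :=
  of_eq_zero (Complex.conjCLE.contDiff.comp hF.1) fun z hz => by rw [hF.eq_zero hz, map_zero]

lemma sum {ι : Type*} {s : Finset ι} {F : ι → ℂ → ℂ} (hF : ∀ i ∈ s, IsTest (F i)) :
    IsTest fun z => ∑ i ∈ s, F i z :=
  of_eq_zero (ContDiff.sum fun i hi => (hF i hi).1) fun _ hz =>
    Finset.sum_eq_zero fun i hi => (hF i hi).eq_zero hz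

end IsTest

/-- The real linear form `v ↦ 2 π i (m v₁ + n v₂)`, the logarithm of a character. -/
def planeFreq (n : ℤ × ℤ) : ℂ →L[ℝ] ℂ :=
  (2 * Real.pi * Complex.I) • (Complex.ofRealCLM.comp
    ((n.1 : ℝ) • Complex.reCLM + (n.2 : ℝ) • Complex.imCLM))

lemma planeFreq_apply (n : ℤ × ℤ) (v : ℂ) :
    planeFreq n v = 2 * Real.pi * Complex.I * (n.1 * v.re + n.2 * v.im) := by
  simp [planeFreq]
  ring

lemma planeChar_eq_exp (n : ℤ × ℤ) (z : ℂ) : planeChar n z = Complex.exp (planeFreq n z) := by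
  rw [planeFreq_apply, planeChar]
  congr 1
  push_cast
  ring

lemma planeFreq_neg (n : ℤ × ℤ) : planeFreq (-n) = -planeFreq n := by
  ext v
  simp [planeFreq_apply]
  ring

lemma hasFDerivAt_planeChar (n : ℤ × ℤ) (z : ℂ) :
    HasFDerivAt (planeChar n) (planeChar n z • planeFreq n) z := by
  have h := (planeFreq n).hasFDerivAt (x := z) |>.cexp
  simpa only [← planeChar_eq_exp, ← funext (planeChar_eq_exp n)] using h

lemma contDiff_planeChar (n : ℤ × ℤ) : ContDiff ℝ ω (planeChar n) := by
  rw [funext (planeChar_eq_exp n)]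
  exact (planeFreq n).contDiff.cexp

/-- The Fourier coefficients of a function supported in the unit square. -/
def planeCoeff (F : ℂ → ℂ) (n : ℤ × ℤ) : ℂ := ∫ z, F z * planeChar (-n) z

lemma continuous_planeChar (n : ℤ × ℤ) : Continuous (planeChar n) :=
  (contDiff_planeChar n).continuous

lemma IsTest.integrable {F : ℂ → ℂ} (hF : IsTest F) (n : ℤ × ℤ) :
    Integrable fun z => F z * planeChar n z :=
  (hF.continuous.mul (continuous_planeChar n)).integrable_of_hasCompactSupport
    hF.hasCompactSupport.mul_right

/-- Integration by parts over the whole plane, without boundary terms because `F` has compact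
support. -/
lemma planeCoeff_fderiv {F : ℂ → ℂ} (hF : IsTest F) (v : ℂ) (n : ℤ × ℤ) :
    planeCoeff (fun z => fderiv ℝ F z v) n = planeFreq n v * planeCoeff F n := by
  have hd : ∀ z, fderiv ℝ (planeChar (-n)) z v = -(planeFreq n v * planeChar (-n) z) := by
    intro z
    rw [(hasFDerivAt_planeChar (-n) z).fderiv, planeFreq_neg]
    simp [mul_comm]
  have h := integral_mul_fderiv_eq_neg_fderiv_mul_of_integrable (μ := volume)
    (f := F) (g := planeChar (-n)) (v := v) ((hF.fderiv_apply v).integrable (-n))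
    (by
      simp only [hd]
      convert ((hF.const_mul (planeFreq n v)).integrable (-n)).neg using 2 with z
      simp only [Pi.neg_apply]
      ring)
    (hF.integrable (-n))
    (fun z _ => hF.1.differentiable (by simp) z)
    (fun z _ => (contDiff_planeChar (-n)).differentiable (by simp) z)
  rw [planeCoeff, planeCoeff, ← neg_eq_iff_eq_neg.2 h, ← integral_const_mul, ← integral_neg]
  refine integral_congr_ae (Filter.Eventually.of_forall fun z => ?_)
  simp only [hd]
  ring

lemma planeCoeff_sub {F G : ℂ → ℂ} (hF : IsTest F) (hG : IsTest G) (n : ℤ × ℤ) :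
    planeCoeff (fun z => F z - G z) n = planeCoeff F n - planeCoeff G n := by
  rw [planeCoeff, planeCoeff, planeCoeff, ← integral_sub (hF.integrable _) (hG.integrable _)]
  simp only [sub_mul]

/-- The operator `F ↦ F - ∂ᵥ ∂ᵥ F`. -/
def oneSubSecond (v : ℂ) (F : ℂ → ℂ) (z : ℂ) : ℂ :=
  F z - fderiv ℝ (fun y => fderiv ℝ F y v) z v

lemma IsTest.oneSubSecond {F : ℂ → ℂ} (hF : IsTest F) (v : ℂ) : IsTest (oneSubSecond v F) :=
  hF.sub ((hF.fderiv_apply v).fderiv_apply v)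

lemma planeCoeff_oneSubSecond {F : ℂ → ℂ} (hF : IsTest F) (v : ℂ) (n : ℤ × ℤ) :
    planeCoeff (oneSubSecond v F) n = (1 - planeFreq n v ^ 2) * planeCoeff F n := by
  have := planeCoeff_sub hF ((hF.fderiv_apply v).fderiv_apply v) n
  rw [planeCoeff_fderiv (hF.fderiv_apply v), planeCoeff_fderiv hF] at this
  rw [show planeCoeff (_root_.oneSubSecond v F) n = _ from this]
  ring

lemma norm_planeCoeff_le {F : ℂ → ℂ} (hF : IsTest F) {M : ℝ} (hM : ∀ z, ‖F z‖ ≤ M) (n : ℤ × ℤ) :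
    ‖planeCoeff F n‖ ≤ M := by
  have hM0 : 0 ≤ M := (norm_nonneg _).trans (hM 0)
  have h1 : planeCoeff F n = ∫ z in Metric.closedBall (0 : ℂ) (1 / 4), F z * planeChar (-n) z := by
    refine (setIntegral_eq_integral_of_forall_compl_eq_zero fun z hz => ?_).symm
    rw [mem_closedBall_zero_iff, not_le] at hz
    rw [hF.eq_zero hz, zero_mul]
  -- The disc of radius `1/4` has area `π/16`.
  have hvol : volume.real (Metric.closedBall (0 : ℂ) (1 / 4)) ≤ 1 := by
    rw [measureReal_def, Complex.volume_closedBall]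
    simp only [ENNReal.toReal_mul, ENNReal.toReal_pow, ENNReal.coe_toReal, NNReal.coe_real_pi]
    rw [ENNReal.toReal_ofReal (by norm_num)]
    nlinarith [Real.pi_lt_four]
  rw [h1]
  refine (norm_setIntegral_le_of_norm_le_const (C := M) ?_ fun z _ => ?_).trans ?_
  · exact (isCompact_closedBall _ _).measure_lt_top
  · rw [norm_mul, norm_planeChar, mul_one]
    exact hM z
  · exact mul_le_of_le_one_right hM0 hvol

/-- The weights which bound the Fourier coefficients of test functions. -/
def planeWeight (n : ℤ × ℤ) : ℝ := (1 + (n.1 : ℝ) ^ 2)⁻¹ * (1 + (n.2 : ℝ) ^ 2)⁻¹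

lemma summable_planeWeight : Summable planeWeight := by
  have h : Summable fun m : ℤ => (1 + (m : ℝ) ^ 2)⁻¹ := by
    refine Summable.of_norm_bounded_eventually
      (g := fun m : ℤ => 1 / (m : ℝ) ^ 2) (Real.summable_one_div_int_pow.2 one_lt_two) ?_
    filter_upwards [(Set.finite_singleton (0 : ℤ)).compl_mem_cofinite] with m hm
    have hm' : (m : ℝ) ≠ 0 := by exact_mod_cast hm
    have h2 : 0 < (m : ℝ) ^ 2 := by positivity
    rw [Real.norm_of_nonneg (by positivity), one_div]
    exact inv_anti₀ h2 (by linarith)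
  exact h.mul_of_nonneg h (fun _ => by positivity) (fun _ => by positivity)

/-- The operator `(1 - ∂ₓ²) (1 - ∂ᵧ²)`. -/
def smoothing (F : ℂ → ℂ) : ℂ → ℂ := oneSubSecond 1 (oneSubSecond Complex.I F)

lemma IsTest.smoothing {F : ℂ → ℂ} (hF : IsTest F) : IsTest (smoothing F) :=
  (hF.oneSubSecond _).oneSubSecond _

/-- The operator `(1 - ∂ₓ²)(1 - ∂ᵧ²)` has symbol `(1 + 4π²m²)(1 + 4π²n²)`, which dominates the
inverse of the weight. A uniform bound on finitely many derivatives thus controls the Wiener norm.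
-/
lemma norm_planeCoeff_le_weight {F : ℂ → ℂ} (hF : IsTest F) {M : ℝ}
    (hM : ∀ z, ‖smoothing F z‖ ≤ M) (n : ℤ × ℤ) :
    ‖planeCoeff F n‖ ≤ M * planeWeight n := by
  have hM0 : 0 ≤ M := (norm_nonneg _).trans (hM 0)
  have h := norm_planeCoeff_le hF.smoothing hM n
  have hsq : ∀ k : ℤ, 1 + (k : ℝ) ^ 2 ≤ ‖(1 - (2 * Real.pi * Complex.I * k) ^ 2 : ℂ)‖ := by
    intro k
    have h1 : (1 - (2 * Real.pi * Complex.I * k) ^ 2 : ℂ) =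
        ((1 + (2 * Real.pi * k) ^ 2 : ℝ) : ℂ) := by
      push_cast
      rw [mul_pow, mul_pow, mul_pow, Complex.I_sq]
      ring
    rw [h1, Complex.norm_real, Real.norm_of_nonneg (by positivity), mul_pow]
    have : (1 : ℝ) ≤ (2 * Real.pi) ^ 2 := by nlinarith [Real.pi_gt_three]
    nlinarith [sq_nonneg (k : ℝ)]
  have h0 : planeCoeff (_root_.smoothing F) n = (1 - planeFreq n 1 ^ 2) *
      ((1 - planeFreq n Complex.I ^ 2) * planeCoeff F n) := by
    rw [← planeCoeff_oneSubSecond hF, ← planeCoeff_oneSubSecond (hF.oneSubSecond _)]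
    rfl
  rw [h0, norm_mul, norm_mul] at h
  have ha := hsq n.1
  have hb := hsq n.2
  simp only [planeFreq_apply, Complex.one_re, Complex.one_im, Complex.I_re, Complex.I_im,
    Complex.ofReal_one, Complex.ofReal_zero, mul_one, mul_zero, add_zero, zero_add] at h
  have h3 : (1 + (n.1 : ℝ) ^ 2) * ((1 + (n.2 : ℝ) ^ 2) * ‖planeCoeff F n‖) ≤ M := by
    refine le_trans ?_ h
    gcongr
  rw [planeWeight, ← mul_inv, ← div_eq_mul_inv, le_div_iff₀ (by positivity)]
  linarith

lemma summable_norm_planeCoeff {F : ℂ → ℂ} (hF : IsTest F) :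
    Summable fun n => ‖planeCoeff F n‖ := by
  obtain ⟨M, hM⟩ := hF.smoothing.continuous.bounded_above_of_compact_support
    hF.smoothing.hasCompactSupport
  exact Summable.of_nonneg_of_le (fun _ => norm_nonneg _) (norm_planeCoeff_le_weight hF hM)
    (summable_planeWeight.mul_left M)

lemma planeCoeff_eq_iterated {F : ℂ → ℂ} (hF : IsTest F) (m n : ℤ) :
    planeCoeff F (m, n) = ∫ y in (-1 / 2 : ℝ)..(1 / 2),
      (∫ x in (-1 / 2 : ℝ)..(1 / 2), F (x + y * Complex.I) * planeChar (-m, 0) x) *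
        planeChar (-n, 0) y := by
  have hout : ∀ x y : ℝ, x ∉ Set.Ioc (-1 / 2 : ℝ) (1 / 2) → F (x + y * Complex.I) = 0 := by
    intro x y hx
    refine hF.eq_zero (lt_of_lt_of_le ?_ (Complex.abs_re_le_norm _))
    simp only [Complex.add_re, Complex.ofReal_re, Complex.re_ofReal_mul, Complex.I_re, mul_zero,
      add_zero]
    rw [Set.mem_Ioc, not_and_or, not_lt, not_le] at hx
    rw [lt_abs]
    rcases hx with h | h
    · right; linarith
    · left; linarith
  have hout' : ∀ x y : ℝ, y ∉ Set.Ioc (-1 / 2 : ℝ) (1 / 2) → F (x + y * Complex.I) = 0 := by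
    intro x y hx
    refine hF.eq_zero (lt_of_lt_of_le ?_ (Complex.abs_im_le_norm _))
    simp only [Complex.add_im, Complex.ofReal_im, Complex.im_ofReal_mul, Complex.I_im, mul_one,
      zero_add]
    rw [Set.mem_Ioc, not_and_or, not_lt, not_le] at hx
    rw [lt_abs]
    rcases hx with h | h
    · right; linarith
    · left; linarith
  have hmp := Complex.volume_preserving_equiv_real_prod.symm
  have h1 : planeCoeff F (m, n) = ∫ p : ℝ × ℝ,
      F (p.1 + p.2 * Complex.I) * planeChar (-(m, n)) (p.1 + p.2 * Complex.I) := by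
    rw [planeCoeff, ← hmp.integral_comp Complex.measurableEquivRealProd.symm.measurableEmbedding]
    refine integral_congr_ae (Filter.Eventually.of_forall fun p => ?_)
    have hp : Complex.measurableEquivRealProd.symm p = p.1 + p.2 * Complex.I := by
      rw [Complex.measurableEquivRealProd_symm_apply, Complex.mk_eq_add_mul_I]
    simp only [hp]
  have hint : Integrable (fun p : ℝ × ℝ =>
      F (p.1 + p.2 * Complex.I) * planeChar (-(m, n)) (p.1 + p.2 * Complex.I))
      (volume.prod volume) := by
    have h2 := (hmp.integrable_comp_emb
      Complex.measurableEquivRealProd.symm.measurableEmbedding).2 (hF.integrable (-(m, n)))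
    rw [← Measure.volume_eq_prod]
    convert h2 using 2 with p
    have hp : Complex.measurableEquivRealProd.symm p = p.1 + p.2 * Complex.I := by
      rw [Complex.measurableEquivRealProd_symm_apply, Complex.mk_eq_add_mul_I]
    simp only [Function.comp_apply, hp]
  rw [h1, Measure.volume_eq_prod, integral_prod_symm _ hint,
    intervalIntegral.integral_of_le (by norm_num),
    setIntegral_eq_integral_of_forall_compl_eq_zero]
  · refine integral_congr_ae (Filter.Eventually.of_forall fun y => ?_)
    simp only
    rw [intervalIntegral.integral_of_le (by norm_num),
      setIntegral_eq_integral_of_forall_compl_eq_zero, ← integral_mul_const]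
    · refine integral_congr_ae (Filter.Eventually.of_forall fun x => ?_)
      simp only
      rw [Prod.neg_mk, Wiener.planeChar_prod]
      ring
    · intro x hx
      rw [hout x y hx, zero_mul]
  · intro y hy
    simp [hout' _ y hy]

/-- Inversion is done one variable at a time. The partial coefficient `c m` is a continuous function
of `y` that vanishes at the ends of the period, so the one-variable result applies to it, and again
to `x ↦ F (x + iy)`. -/
lemma hasSum_planeCoeff {F : ℂ → ℂ} (hF : IsTest F) {x y : ℝ}
    (hx : x ∈ Set.Icc (-1 / 2 : ℝ) (1 / 2)) (hy : y ∈ Set.Icc (-1 / 2 : ℝ) (1 / 2)) :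
    ∑' n, planeChar n (x + y * Complex.I) * planeCoeff F n = F (x + y * Complex.I) := by
  have hs := summable_norm_planeCoeff hF
  set c : ℤ → ℝ → ℂ := fun m y =>
    ∫ x in (-1 / 2 : ℝ)..(1 / 2), F (x + y * Complex.I) * planeChar (-m, 0) x with hc
  have hcont : ∀ m, Continuous (c m) := by
    intro m
    have h1 := hF.continuous
    have h2 := continuous_planeChar (-m, 0)
    apply intervalIntegral.continuous_parametric_intervalIntegral_of_continuous'
    fun_prop
  have hre : ∀ x y : ℝ, 1 / 4 < |x| → F (x + y * Complex.I) = 0 := by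
    intro x y hx
    refine hF.eq_zero (lt_of_lt_of_le ?_ (Complex.abs_re_le_norm _))
    simpa using hx
  have him : ∀ x y : ℝ, 1 / 4 < |y| → F (x + y * Complex.I) = 0 := by
    intro x y hx
    refine hF.eq_zero (lt_of_lt_of_le ?_ (Complex.abs_im_le_norm _))
    simpa using hx
  have habs : (1 / 4 : ℝ) < |1 / 2| := by rw [abs_of_pos] <;> norm_num
  have habs' : (1 / 4 : ℝ) < |-1 / 2| := by rw [abs_of_neg] <;> norm_num
  have hcoef : ∀ m n, ∫ y in (-1 / 2 : ℝ)..(1 / 2), c m y * planeChar (-n, 0) y =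
      planeCoeff F (m, n) := fun m n => (planeCoeff_eq_iterated hF m n).symm
  have hsum1 : ∀ m, HasSum (fun n => planeChar (n, 0) y * planeCoeff F (m, n)) (c m y) := by
    intro m
    have := hasSum_fourier_of_vanishing_ends (hcont m)
      (by simp only [hc, him _ _ habs', zero_mul, intervalIntegral.integral_zero])
      (by simp only [hc, him _ _ habs, zero_mul, intervalIntegral.integral_zero])
      (by simp only [hcoef]; exact hs.prod_factor m) hy
    simpa only [hcoef] using this
  have hcs : Summable fun m => ‖c m y‖ := by
    refine Summable.of_nonneg_of_le (fun _ => norm_nonneg _) (fun m => ?_) hs.prod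
    have h1 : ∀ n, ‖planeChar (n, 0) (y : ℂ) * planeCoeff F (m, n)‖ = ‖planeCoeff F (m, n)‖ :=
      fun n => by rw [norm_mul, norm_planeChar, one_mul]
    rw [← (hsum1 m).tsum_eq]
    refine (norm_tsum_le_tsum_norm ?_).trans_eq (tsum_congr h1)
    simpa only [h1] using hs.prod_factor m
  have hsum2 := hasSum_fourier_of_vanishing_ends (f := fun x => F (x + y * Complex.I))
    (by have := hF.continuous; fun_prop) (hre _ _ habs') (hre _ _ habs) hcs hx
  rw [← hsum2.tsum_eq, Summable.tsum_prod]
  · refine tsum_congr fun m => ?_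
    change _ = planeChar (m, 0) (x : ℂ) * c m y
    rw [← (hsum1 m).tsum_eq, ← tsum_mul_left]
    refine tsum_congr fun n => ?_
    rw [Wiener.planeChar_prod]
    ring
  · refine Summable.of_norm ?_
    simpa only [norm_mul, norm_planeChar, one_mul] using hs

namespace Wiener

open Classical in
/-- The element of the Wiener algebra defined by a test function. -/
def ofFun (F : ℂ → ℂ) : Wiener :=
  -- The default `0` makes `ofFun` total, so that families of functions need not carry summability
  -- proofs; it is never reached on test functions.
  if h : Summable fun n => ‖planeCoeff F n‖ then mk (planeCoeff F) h else 0

lemma ofFun_apply {F : ℂ → ℂ} (hF : IsTest F) (n : ℤ × ℤ) : ofFun F n = planeCoeff F n := by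
  rw [ofFun, dif_pos (summable_norm_planeCoeff hF), mk_apply]

/-- The support lies strictly inside the unit square, so `F` agrees there with its periodization.
Outside the square the two differ, which is why the coordinates are restricted. -/
lemma eval_ofFun {F : ℂ → ℂ} (hF : IsTest F) {x y : ℝ}
    (hx : x ∈ Set.Icc (-1 / 2 : ℝ) (1 / 2)) (hy : y ∈ Set.Icc (-1 / 2 : ℝ) (1 / 2)) :
    eval (x + y * Complex.I) (ofFun F) = F (x + y * Complex.I) := by
  rw [eval_apply, ← hasSum_planeCoeff hF hx hy]
  simp only [ofFun_apply hF]

lemma norm_ofFun_le {F : ℂ → ℂ} (hF : IsTest F) {M : ℝ} (hM : ∀ z, ‖smoothing F z‖ ≤ M) :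
    ‖ofFun F‖ ≤ M * ∑' n, planeWeight n := by
  rw [← tsum_mul_left]
  refine norm_le_of_le (summable_planeWeight.mul_left M) fun n => ?_
  rw [ofFun_apply hF]
  exact norm_planeCoeff_le_weight hF hM n

lemma ofFun_sub {F G : ℂ → ℂ} (hF : IsTest F) (hG : IsTest G) :
    ofFun (fun z => F z - G z) = ofFun F - ofFun G := ext_apply fun n => by
  rw [lp.coeFn_sub, Pi.sub_apply, ofFun_apply (hF.sub hG), ofFun_apply hF, ofFun_apply hG,
    planeCoeff_sub hF hG]

lemma ofFun_fderiv_apply {F : ℂ → ℂ} (hF : IsTest F) (v : ℂ) (n : ℤ × ℤ) :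
    ofFun (fun z => fderiv ℝ F z v) n = planeFreq n v * ofFun F n := by
  rw [ofFun_apply (hF.fderiv_apply v), ofFun_apply hF, planeCoeff_fderiv hF]

end Wiener

end

/-! ### Smooth families of test functions in the Wiener norm. -/

noncomputable section

open Filter Topology

section Parameters

variable {P : Type*} [NormedAddCommGroup P] [NormedSpace ℝ P]

lemma fderiv_partial_right {F : P × ℂ → ℂ} (hF : ContDiff ℝ ∞ F) (a : P) (z v : ℂ) :
    fderiv ℝ (fun z => F (a, z)) z v = fderiv ℝ F (a, z) (0, v) := by
  have h := ((hF.differentiable (by simp) (a, z)).hasFDerivAt).comp z (hasFDerivAt_prodMk_right a z)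
  have h' : HasFDerivAt (fun z => F (a, z)) _ z := h
  rw [h'.fderiv]
  simp

lemma contDiff_fderiv_partial_right {F : P × ℂ → ℂ} (hF : ContDiff ℝ ∞ F) (v : ℂ) :
    ContDiff ℝ ∞ fun p : P × ℂ => fderiv ℝ F p (0, v) :=
  (hF.fderiv_right (by simp)).clm_apply contDiff_const

lemma exists_oneSubSecond {F : P × ℂ → ℂ} (hF : ContDiff ℝ ∞ F) (v : ℂ) :
    ∃ G : P × ℂ → ℂ, ContDiff ℝ ∞ G ∧
      ∀ a, oneSubSecond v (fun z => F (a, z)) = fun z => G (a, z) := by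
  have h1 := contDiff_fderiv_partial_right hF v
  refine ⟨fun p => F p - fderiv ℝ (fun p : P × ℂ => fderiv ℝ F p (0, v)) p (0, v),
    hF.sub (contDiff_fderiv_partial_right h1 v), fun a => funext fun z => ?_⟩
  have h2 := fderiv_partial_right h1 a z v
  simp only [oneSubSecond, fderiv_partial_right hF, h2]

/-- Derivatives in `z` of a smooth family are again smooth jointly in parameter and point; this is
what makes the bound of `norm_ofFun_le` uniform in the parameter. -/
lemma exists_smoothing {F : P × ℂ → ℂ} (hF : ContDiff ℝ ∞ F) :
    ∃ G : P × ℂ → ℂ, ContDiff ℝ ∞ G ∧ ∀ a, smoothing (fun z => F (a, z)) = fun z => G (a, z) := by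
  obtain ⟨G, hG, h⟩ := exists_oneSubSecond hF Complex.I
  obtain ⟨G', hG', h'⟩ := exists_oneSubSecond hG 1
  exact ⟨G', hG', fun a => by rw [smoothing, h, h']⟩

lemma isTest_slice {F : P × ℂ → ℂ} (hF : ContDiff ℝ ∞ F)
    (h0 : ∀ a z, 1 / 4 < ‖z‖ → F (a, z) = 0) (a : P) : IsTest fun z => F (a, z) :=
  .of_eq_zero (hF.comp (contDiff_const.prodMk contDiff_id)) (h0 a)

/-- A smooth family of test functions is continuous as a family in the Wiener algebra. -/
lemma Wiener.continuous_ofFun {F : P × ℂ → ℂ} (hF : ContDiff ℝ ∞ F)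
    (h0 : ∀ a z, 1 / 4 < ‖z‖ → F (a, z) = 0) :
    Continuous fun a => Wiener.ofFun fun z => F (a, z) := by
  rw [continuous_iff_continuousAt]
  intro a₀
  set D : P × ℂ → ℂ := fun p => F p - F (a₀, p.2) with hD
  have hDs : ContDiff ℝ ∞ D := hF.sub (hF.comp (contDiff_const.prodMk contDiff_snd))
  have hD0 : ∀ a z, 1 / 4 < ‖z‖ → D (a, z) = 0 := fun a z hz => by
    simp only [hD, h0 _ z hz, sub_self]
  obtain ⟨G, hG, hGD⟩ := exists_smoothing hDs
  have hzero : ∀ z, G (a₀, z) = 0 := by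
    intro z
    rw [← congrFun (hGD a₀) z]
    have h1 : ∀ v, oneSubSecond v (fun _ => 0) = fun _ => 0 := fun v => by
      funext z
      simp [oneSubSecond]
    simp [hD, smoothing, h1]
  have hnorm : ∀ a, Wiener.ofFun (fun z => F (a, z)) - Wiener.ofFun (fun z => F (a₀, z)) =
      Wiener.ofFun fun z => D (a, z) := fun a =>
    (Wiener.ofFun_sub (isTest_slice hF h0 a) (isTest_slice hF h0 a₀)).symm
  rw [ContinuousAt, tendsto_iff_norm_sub_tendsto_zero]
  simp only [hnorm]
  set W := ∑' n, planeWeight n with hW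
  have hW0 : 0 ≤ W := tsum_nonneg fun n => by unfold planeWeight; positivity
  rw [Metric.tendsto_nhds]
  intro ε hε
  -- The smoothed difference `G` is continuous and vanishes at `a₀`. Compactness of the disc makes
  -- it uniformly small for nearby parameters; the factor `W + 1` absorbs the sum of the weights.
  have hδ : 0 < ε / (2 * (W + 1)) := by positivity
  have hev : ∀ᶠ a in 𝓝 a₀, ∀ z ∈ Metric.closedBall (0 : ℂ) (1 / 4),
      ‖G (a, z)‖ < ε / (2 * (W + 1)) := by
    refine (isCompact_closedBall (0 : ℂ) (1 / 4)).eventually_forall_of_forall_eventually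
      fun z _ => ?_
    have : ContinuousAt (fun p : P × ℂ => ‖G p‖) (a₀, z) := hG.continuous.norm.continuousAt
    refine this.eventually_lt_const ?_
    simpa [hzero] using hδ
  filter_upwards [hev] with a ha
  have hT := isTest_slice hDs hD0 a
  have hle : ∀ z, ‖smoothing (fun z => D (a, z)) z‖ ≤ ε / (2 * (W + 1)) := by
    intro z
    by_cases hz : 1 / 4 < ‖z‖
    · rw [hT.smoothing.eq_zero hz, norm_zero]
      exact hδ.le
    · rw [hGD a]
      exact (ha z (by rwa [mem_closedBall_zero_iff, ← not_lt])).le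
  have := Wiener.norm_ofFun_le hT hle
  rw [dist_zero_right, norm_norm]
  refine this.trans_lt ?_
  rw [← hW, div_mul_eq_mul_div, div_lt_iff₀ (by positivity)]
  nlinarith

end Parameters

/-! ### Cauchy-Riemann operators and their inverses on the torus. -/

/-- The Cauchy-Riemann operator `∂/∂z̄`. -/
def dbar (F : ℂ → ℂ) (z : ℂ) : ℂ := (fderiv ℝ F z 1 + Complex.I * fderiv ℝ F z Complex.I) / 2

/-- The operator `∂/∂z`. -/
def del (F : ℂ → ℂ) (z : ℂ) : ℂ := (fderiv ℝ F z 1 - Complex.I * fderiv ℝ F z Complex.I) / 2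

lemma fderiv_eq_del_dbar (F : ℂ → ℂ) (z v : ℂ) :
    fderiv ℝ F z v = del F z * v + dbar F z * (starRingEnd ℂ) v := by
  have hv : v = v.re • (1 : ℂ) + v.im • Complex.I := by
    simp [Complex.re_add_im]
  conv_lhs => rw [hv, map_add, map_smul, map_smul]
  have h1 : v = v.re + v.im * Complex.I := (Complex.re_add_im v).symm
  have h2 : (starRingEnd ℂ) v = v.re - v.im * Complex.I := by
    apply Complex.ext <;> simp
  rw [h2]
  simp only [del, dbar, Complex.real_smul]
  linear_combination ((v.im : ℂ) * fderiv ℝ F z Complex.I) * Complex.I_sq -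
    ((fderiv ℝ F z 1 - Complex.I * fderiv ℝ F z Complex.I) / 2) * h1

lemma IsTest.dbar {F : ℂ → ℂ} (hF : IsTest F) : IsTest (dbar F) := by
  have := ((hF.fderiv_apply 1).add ((hF.fderiv_apply Complex.I).const_mul Complex.I)).const_mul
    (1 / 2)
  convert this using 2 with z
  rw [_root_.dbar]
  ring

lemma IsTest.del {F : ℂ → ℂ} (hF : IsTest F) : IsTest (del F) := by
  have := ((hF.fderiv_apply 1).sub ((hF.fderiv_apply Complex.I).const_mul Complex.I)).const_mul
    (1 / 2)
  convert this using 2 with z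
  rw [_root_.del]
  ring

namespace Wiener

/-- The symbol of the Cauchy-Riemann operator. -/
def dbarSymbol (n : ℤ × ℤ) : ℂ := Real.pi * Complex.I * (n.1 + n.2 * Complex.I)

/-- The symbol of the operator `∂/∂z`. -/
def delSymbol (n : ℤ × ℤ) : ℂ := Real.pi * Complex.I * (n.1 - n.2 * Complex.I)

lemma planeCoeff_dbar {F : ℂ → ℂ} (hF : IsTest F) (n : ℤ × ℤ) :
    planeCoeff (dbar F) n = dbarSymbol n * planeCoeff F n := by
  have hx := planeCoeff_fderiv hF 1 n
  have hy := planeCoeff_fderiv hF Complex.I n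
  have h : planeCoeff (dbar F) n = (planeCoeff (fun z => fderiv ℝ F z 1) n +
      Complex.I * planeCoeff (fun z => fderiv ℝ F z Complex.I) n) / 2 := by
    simp only [planeCoeff, dbar]
    rw [← MeasureTheory.integral_const_mul, ← MeasureTheory.integral_add
      ((hF.fderiv_apply 1).integrable _) (((hF.fderiv_apply _).integrable _).const_mul _),
      ← MeasureTheory.integral_div]
    congr 1 with z
    ring
  rw [h, hx, hy, planeFreq_apply, planeFreq_apply, dbarSymbol]
  simp
  ring

lemma planeCoeff_del {F : ℂ → ℂ} (hF : IsTest F) (n : ℤ × ℤ) :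
    planeCoeff (del F) n = delSymbol n * planeCoeff F n := by
  have hx := planeCoeff_fderiv hF 1 n
  have hy := planeCoeff_fderiv hF Complex.I n
  have h : planeCoeff (del F) n = (planeCoeff (fun z => fderiv ℝ F z 1) n -
      Complex.I * planeCoeff (fun z => fderiv ℝ F z Complex.I) n) / 2 := by
    simp only [planeCoeff, del]
    rw [← MeasureTheory.integral_const_mul, ← MeasureTheory.integral_sub
      ((hF.fderiv_apply 1).integrable _) (((hF.fderiv_apply _).integrable _).const_mul _),
      ← MeasureTheory.integral_div]
    congr 1 with z
    ring
  rw [h, hx, hy, planeFreq_apply, planeFreq_apply, delSymbol]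
  simp
  ring

/-- Up to the common factor `π i` the two symbols are complex conjugate. The Beurling multiplier
therefore has norm at most `1` on the Wiener algebra, with no singular integral estimate. -/
lemma norm_delSymbol (n : ℤ × ℤ) : ‖delSymbol n‖ = ‖dbarSymbol n‖ := by
  have h : (n.1 - n.2 * Complex.I : ℂ) = (starRingEnd ℂ) (n.1 + n.2 * Complex.I) := by
    simp [sub_eq_add_neg]
  rw [delSymbol, dbarSymbol, h, norm_mul, norm_mul _ (_ + _), RCLike.norm_conj]

lemma one_le_norm_dbarSymbol {n : ℤ × ℤ} (hn : n ≠ 0) : 1 ≤ ‖dbarSymbol n‖ := by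
  rw [dbarSymbol, norm_mul, norm_mul, Complex.norm_I, mul_one, Complex.norm_real,
    Real.norm_of_nonneg Real.pi_pos.le]
  have h1 : (1 : ℝ) ≤ ‖(n.1 + n.2 * Complex.I : ℂ)‖ := by
    by_cases h : n.1 = 0
    · have h2 : n.2 ≠ 0 := fun h2 => hn (Prod.ext h h2)
      refine le_trans ?_ (Complex.abs_im_le_norm _)
      simpa using (by exact_mod_cast Int.one_le_abs h2 : (1 : ℝ) ≤ |(n.2 : ℝ)|)
    · refine le_trans ?_ (Complex.abs_re_le_norm _)
      simpa using (by exact_mod_cast Int.one_le_abs h : (1 : ℝ) ≤ |(n.1 : ℝ)|)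
  nlinarith [Real.pi_gt_three]

lemma dbarSymbol_ne_zero {n : ℤ × ℤ} (hn : n ≠ 0) : dbarSymbol n ≠ 0 := by
  intro h
  have := one_le_norm_dbarSymbol hn
  rw [h, norm_zero] at this
  linarith

/-- The Beurling transform `∂ ∂̄⁻¹` on the torus. -/
def beurling : Wiener →L[ℂ] Wiener :=
  -- At `n = 0` the quotient is `0 / 0 = 0`, which is the right value because `∂F` and `∂̄F` both
  -- have mean zero.
  multiplier (fun n => delSymbol n / dbarSymbol n) 1 fun n => by
    rw [norm_div, norm_delSymbol]
    exact div_self_le_one _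

lemma norm_beurling_le : ‖beurling‖ ≤ 1 := norm_multiplier_le _ _ _

/-- The inverse of `∂̄` on the torus, up to means. -/
def dbarInv : Wiener →L[ℂ] Wiener :=
  -- The convention `0⁻¹ = 0` removes the mean.
  multiplier (fun n => (dbarSymbol n)⁻¹) 1 fun n => by
    by_cases hn : n = 0
    · simp [hn, dbarSymbol]
    · rw [norm_inv]
      exact inv_le_one_of_one_le₀ (one_le_norm_dbarSymbol hn)

lemma beurling_ofFun_dbar {F : ℂ → ℂ} (hF : IsTest F) :
    beurling (ofFun (dbar F)) = ofFun (del F) := ext_apply fun n => by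
  rw [beurling, multiplier_apply, ofFun_apply hF.dbar, ofFun_apply hF.del, planeCoeff_dbar hF,
    planeCoeff_del hF]
  by_cases hn : n = 0
  · simp [hn, delSymbol]
  · rw [← mul_assoc, div_mul_cancel₀ _ (dbarSymbol_ne_zero hn)]

/-- The constant functions in the Wiener algebra. -/
def const : ℂ →L[ℂ] Wiener := lp.singleContinuousLinearMap ℂ (fun _ : ℤ × ℤ => ℂ) 1 0

lemma const_apply (c : ℂ) (n : ℤ × ℤ) : const c n = if n = 0 then c else 0 := by
  rw [const, lp.singleContinuousLinearMap_apply]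
  split_ifs with h
  · rw [h, lp.single_apply_self]
  · rw [lp.single_apply_ne _ _ _ h]

lemma eval_const (z c : ℂ) : eval z (const c) = c := by
  rw [eval_apply, tsum_eq_single 0 fun n hn => by rw [const_apply, if_neg hn, mul_zero],
    const_apply, if_pos rfl, planeChar_zero, one_mul]

/-- The inverse of `∂̄` on the torus, normalized to vanish at the corner `(1 + i) / 2` of the unit
square. -/
def dbarInvCorner : Wiener →L[ℂ] Wiener :=
  dbarInv - const.comp ((eval ((1 / 2 : ℝ) + (1 / 2 : ℝ) * Complex.I)).comp dbarInv)

/-- Inverting `∂̄` recovers `F` only up to its mean. Test functions vanish at the corner `(1 + i) /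
2`, so subtracting the value there restores the lost constant. -/
lemma dbarInvCorner_ofFun_dbar {F : ℂ → ℂ} (hF : IsTest F) :
    dbarInvCorner (ofFun (dbar F)) = ofFun F := by
  have h1 : dbarInv (ofFun (dbar F)) = ofFun F - const (ofFun F 0) := ext_apply fun n => by
    rw [dbarInv, multiplier_apply, lp.coeFn_sub, Pi.sub_apply, const_apply, ofFun_apply hF.dbar,
      ofFun_apply hF, ofFun_apply hF, planeCoeff_dbar hF]
    by_cases hn : n = 0
    · simp [hn, dbarSymbol]
    · rw [if_neg hn, sub_zero, inv_mul_cancel_left₀ (dbarSymbol_ne_zero hn)]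
  have h2 : eval ((1 / 2 : ℝ) + (1 / 2 : ℝ) * Complex.I) (ofFun F) = 0 := by
    rw [eval_ofFun hF (by norm_num) (by norm_num)]
    refine hF.eq_zero (lt_of_lt_of_le ?_ (Complex.abs_re_le_norm _))
    norm_num
  simp only [dbarInvCorner, sub_apply, ContinuousLinearMap.comp_apply, h1,
    map_sub, h2, eval_const, zero_sub, map_neg]
  abel

end Wiener

end

/-! ### Regularity of fixed points; quadratic maps. -/

noncomputable section

open Filter Topology

section FixedPoint

variable {P X : Type*} [NormedAddCommGroup P] [NormedSpace ℝ P] [CompleteSpace P]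
  [NormedAddCommGroup X] [NormedSpace ℝ X] [CompleteSpace X]

/-- A continuous family of fixed points of a regular family of maps, which is a contraction
infinitesimally, is as regular as the family of maps. -/
lemma contDiffAt_of_isFixedPt {n : WithTop ℕ∞} (hn : n ≠ 0) {G : P × X → X} {h : P → X} {a : P}
    {L : X →L[ℝ] X} (hG : ContDiffAt ℝ n G (a, h a)) (hh : ContinuousAt h a)
    (hfix : ∀ᶠ b in 𝓝 a, G (b, h b) = h b)
    (hL : HasFDerivAt (fun x => G (a, x)) L (h a)) (hL1 : ‖L‖ < 1) : ContDiffAt ℝ n h a := by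
  set f : P × X → X := fun p => p.2 - G p with hf
  have hfs : ContDiffAt ℝ n f (a, h a) := contDiffAt_snd.sub hG
  -- The derivative of `x - G(a, x)` in `x` is `1 - L`, invertible by the Neumann series, so the
  -- implicit function theorem applies.
  have hinv : (fderiv ℝ f (a, h a) ∘L .inr ℝ P X).IsInvertible := by
    have h1 : HasFDerivAt (fun x => f (a, x)) (fderiv ℝ f (a, h a) ∘L .inr ℝ P X) (h a) :=
      ((hfs.differentiableAt hn).hasFDerivAt).comp (h a) (hasFDerivAt_prodMk_right a (h a))
    have h2 : HasFDerivAt (fun x => f (a, x)) (1 - L) (h a) := (hasFDerivAt_id _).sub hL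
    rw [h1.unique h2]
    obtain ⟨u, hu⟩ := isUnit_one_sub_of_norm_lt_one hL1
    exact ⟨ContinuousLinearEquiv.unitsEquiv ℝ X u, by rw [← hu]; rfl⟩
  have hcont : Tendsto (fun b => (b, h b)) (𝓝 a) (𝓝 (a, h a)) :=
    tendsto_id.prodMk_nhds hh
  have hzero : ∀ᶠ b in 𝓝 a, f (b, h b) = 0 := hfix.mono fun b hb => by rw [hf]; simp [hb]
  -- The implicit function is the only solution near `(a, h a)`; continuity of `h` keeps `(b, h b)`
  -- in that neighbourhood, so `h` coincides with it.
  have key := hcont.eventually (hfs.eventually_apply_eq_iff_implicitFunction hn hinv)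
  refine (hfs.contDiffAt_implicitFunction hn hinv).congr_of_eventuallyEq ?_
  filter_upwards [key, hzero] with b hb hb0
  exact (hb.1 (by rw [hb0, hzero.self_of_nhds])).symm

end FixedPoint

section Quadratic

variable {ι : Type*} [Fintype ι] {Y : Type*} [NormedAddCommGroup Y] [NormedSpace ℝ Y]
  [NormedSpace ℂ Y] [SMulCommClass ℝ ℂ Y]

/-- The quadratic map on families defined by a real bilinear product and complex structure
constants. -/
def quadTerm (B : Y →L[ℝ] Y →L[ℝ] Y) (c : ι → ι → ι → ℂ) (h : ι → Y) (i : ι) : Y :=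
  ∑ j, ∑ k, c i j k • B (h j) (h k)

lemma contDiff_quadTerm {n : WithTop ℕ∞} (B : Y →L[ℝ] Y →L[ℝ] Y) (c : ι → ι → ι → ℂ) (i : ι) :
    ContDiff ℝ n fun h : ι → Y => quadTerm B c h i := by
  unfold quadTerm
  refine ContDiff.sum fun j _ => ContDiff.sum fun k _ => ContDiff.const_smul _ ?_
  fun_prop

/-- The differential of `quadTerm`. -/
def quadTermDeriv (B : Y →L[ℝ] Y →L[ℝ] Y) (c : ι → ι → ι → ℂ) (h : ι → Y) :
    (ι → Y) →L[ℝ] (ι → Y) :=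
  .pi fun i => ∑ j, ∑ k, c i j k •
    ((B (h j)).comp (.proj k) + (B.flip (h k)).comp (.proj j))

lemma quadTermDeriv_apply (B : Y →L[ℝ] Y →L[ℝ] Y) (c : ι → ι → ι → ℂ) (h x : ι → Y) (i : ι) :
    quadTermDeriv B c h x i = ∑ j, ∑ k, c i j k • (B (h j) (x k) + B (x j) (h k)) := by
  simp [quadTermDeriv]

lemma hasFDerivAt_quadTerm (B : Y →L[ℝ] Y →L[ℝ] Y) (c : ι → ι → ι → ℂ) (h : ι → Y) :
    HasFDerivAt (fun h : ι → Y => quadTerm B c h) (quadTermDeriv B c h) h := by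
  rw [hasFDerivAt_pi']
  intro i
  rw [quadTermDeriv, ContinuousLinearMap.proj_pi]
  refine HasFDerivAt.fun_sum fun j _ => HasFDerivAt.fun_sum fun k _ =>
    HasFDerivAt.fun_const_smul ?_ _
  convert! B.hasFDerivAt_of_bilinear
    (ContinuousLinearMap.proj (R := ℝ) (φ := fun _ : ι => Y) j).hasFDerivAt
    (ContinuousLinearMap.proj (R := ℝ) (φ := fun _ : ι => Y) k).hasFDerivAt using 1

lemma norm_quadTermDeriv_le (B : Y →L[ℝ] Y →L[ℝ] Y) (c : ι → ι → ι → ℂ) (h : ι → Y) {δ : ℝ}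
    (hδ : 0 ≤ δ) (h1 : ∀ j x, ‖B (h j) x‖ ≤ δ * ‖x‖) (h2 : ∀ j x, ‖B x (h j)‖ ≤ δ * ‖x‖) :
    ‖quadTermDeriv B c h‖ ≤ (∑ i, ∑ j, ∑ k, ‖c i j k‖) * (2 * δ) := by
  refine ContinuousLinearMap.opNorm_le_bound _ (by positivity) fun x => ?_
  rw [pi_norm_le_iff_of_nonneg (by positivity)]
  intro i
  have hterm : ∀ j k, ‖c i j k • (B (h j) (x k) + B (x j) (h k))‖ ≤
      ‖c i j k‖ * (2 * δ * ‖x‖) := by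
    intro j k
    rw [norm_smul]
    refine mul_le_mul_of_nonneg_left ((norm_add_le _ _).trans ?_) (norm_nonneg _)
    have hj := mul_le_mul_of_nonneg_left (norm_le_pi_norm x j) hδ
    have hk := mul_le_mul_of_nonneg_left (norm_le_pi_norm x k) hδ
    linarith [h1 j (x k), h2 k (x j)]
  rw [quadTermDeriv_apply]
  calc _ ≤ ∑ j, ∑ k, ‖c i j k‖ * (2 * δ * ‖x‖) :=
        (norm_sum_le _ _).trans (Finset.sum_le_sum fun j _ =>
          (norm_sum_le _ _).trans (Finset.sum_le_sum fun k _ => hterm j k))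
    _ = (∑ j, ∑ k, ‖c i j k‖) * (2 * δ * ‖x‖) := by
        simp only [Finset.sum_mul]
    _ ≤ (∑ i, ∑ j, ∑ k, ‖c i j k‖) * (2 * δ * ‖x‖) := by
        refine mul_le_mul_of_nonneg_right ?_ (by positivity)
        exact Finset.single_le_sum (f := fun i => ∑ j, ∑ k, ‖c i j k‖)
          (fun i _ => by positivity) (Finset.mem_univ i)
    _ = _ := by ring

end Quadratic

/-! ### The deformed Cauchy-Riemann equation. -/

namespace Wiener

/-- The product of the Wiener algebra as a real bilinear map. -/
def mulR : Wiener →L[ℝ] Wiener →L[ℝ] Wiener := mul.bilinearRestrictScalars ℝ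

@[simp] lemma mulR_apply (a b : Wiener) : mulR a b = mul a b := rfl

lemma norm_mulR_apply_le (a b : Wiener) : ‖mulR a b‖ ≤ ‖a‖ * ‖b‖ :=
  (mul a).le_of_opNorm_le (norm_mul_apply_le a) b

lemma norm_conj_apply_le (a : Wiener) : ‖conj a‖ ≤ ‖a‖ := by
  simpa using conj.le_of_opNorm_le norm_conj_le a

/-- The operator `dbarInvCorner` as a real linear map. -/
def dbarInvR : Wiener →L[ℝ] Wiener := dbarInvCorner.restrictScalars ℝ

@[simp] lemma dbarInvR_apply (a : Wiener) : dbarInvR a = dbarInvCorner a := rfl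

/-- The real bilinear map `(a, b) ↦ conj (∂̄⁻¹ a) * ∂̄⁻¹ b`. -/
def dbarInvMul : Wiener →L[ℝ] Wiener →L[ℝ] Wiener :=
  mulR.bilinearComp (conj.comp dbarInvR) dbarInvR

lemma dbarInvMul_apply (a b : Wiener) :
    dbarInvMul a b = mul (conj (dbarInvR a)) (dbarInvR b) := rfl

lemma norm_dbarInvMul_apply_le (a b : Wiener) :
    ‖dbarInvMul a b‖ ≤ ‖dbarInvR a‖ * ‖dbarInvR b‖ :=
  (norm_mulR_apply_le _ _).trans
    (mul_le_mul_of_nonneg_right (norm_conj_apply_le _) (norm_nonneg _))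

end Wiener

section Deformation

/-- The chain rule for the Cauchy-Riemann operators under the deformation `z ↦ z + a η(z)` of the
plane. -/
lemma dbar_deformation {W η : ℂ → ℂ} (hW : Differentiable ℝ W) (hη : Differentiable ℝ η)
    (hreal : ∀ z, (starRingEnd ℂ) (η z) = η z) (a z : ℂ) :
    dbar (fun z => W (z + a * η z)) z =
      -(a * (del η z * dbar (fun z => W (z + a * η z)) z)) +
      a * (dbar η z * del (fun z => W (z + a * η z)) z) +
      (1 + a * del η z + (starRingEnd ℂ) a * dbar η z) * dbar W (z + a * η z) := by
  -- Reality of `η` gives `conj (∂η) = ∂̄η`, so that no conjugate derivatives of `η` remain.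
  have hreal' : ∀ v, (starRingEnd ℂ) (fderiv ℝ η z v) = fderiv ℝ η z v := by
    intro v
    have h := (Complex.conjCLE.toContinuousLinearMap.hasFDerivAt (x := η z)).comp z
      (hη z).hasFDerivAt
    have h' : HasFDerivAt η _ z := h.congr_of_eventuallyEq (Eventually.of_forall fun z =>
      (hreal z).symm)
    conv_rhs => rw [h'.fderiv]
    rfl
  have hd : ∀ v, fderiv ℝ (fun z => W (z + a * η z)) z v =
      del W (z + a * η z) * (v + a * fderiv ℝ η z v) +
      dbar W (z + a * η z) * (starRingEnd ℂ) (v + a * fderiv ℝ η z v) := by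
    intro v
    have h1 : HasFDerivAt (fun z => z + a * η z) (.id ℝ ℂ + a • fderiv ℝ η z) z :=
      (hasFDerivAt_id z).add ((hη z).hasFDerivAt.const_mul a)
    have h2 := (hW (z + a * η z)).hasFDerivAt.comp z h1
    have h3 : HasFDerivAt (fun z => W (z + a * η z)) _ z := h2
    rw [h3.fderiv, ← fderiv_eq_del_dbar]
    simp
  simp only [map_add, map_mul, hreal'] at hd
  -- Let `D` be the deformed function. Then `∂̄D = p a ∂̄η + q (1 + ā ∂̄η)` and `∂D = p (1 + a ∂η) +
  -- q ā ∂η`. Eliminating `p` leaves `q = ∂̄W` as the only derivative of `W` at the displaced point,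
  -- and there the differential equation replaces it by values.
  generalize hp : del W (z + a * η z) = p at *
  generalize hq : dbar W (z + a * η z) = q at *
  rw [dbar, del, dbar, del, hd, hd]
  simp only [map_one, Complex.conj_I]
  generalize fderiv ℝ η z 1 = s
  generalize fderiv ℝ η z Complex.I = t
  generalize (starRingEnd ℂ) a = b
  ring_nf
  simp only [Complex.I_sq]
  ring

end Deformation

end

/-! ### Analyticity for sesquilinear Cauchy-Riemann systems. -/

noncomputable section

open Filter Topology

lemma dbar_congr {F G : ℂ → ℂ} {z : ℂ} (h : F =ᶠ[𝓝 z] G) : dbar F z = dbar G z := by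
  rw [dbar, dbar, h.fderiv_eq]

/-- A real bump function on the plane, as a complex valued function. -/
lemma exists_bump {r R : ℝ} (hr : 0 < r) (hR : r < R) : ∃ χ : ℂ → ℂ, ContDiff ℝ ∞ χ ∧
    (∀ z, (starRingEnd ℂ) (χ z) = χ z) ∧ (∀ z, ‖z‖ ≤ r → χ z = 1) ∧ ∀ z, R ≤ ‖z‖ → χ z = 0 := by
  let f : ContDiffBump (0 : ℂ) := ⟨r, R, hr, hR⟩
  refine ⟨fun z => (f z : ℂ), Complex.ofRealCLM.contDiff.comp f.contDiff,
    fun z => Complex.conj_ofReal _, fun z hz => ?_, fun z hz => ?_⟩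
  · simp only
    rw [f.one_of_mem_closedBall (by simpa using hz), Complex.ofReal_one]
  · simp only
    rw [f.zero_of_le_dist (by simpa using hz), Complex.ofReal_zero]

lemma contDiff_deformation {W η : ℂ → ℂ} (hW : ContDiff ℝ ∞ W) (hη : ContDiff ℝ ∞ η) :
    ContDiff ℝ ∞ fun p : ℂ × ℂ => W (p.2 + p.1 * η p.2) :=
  hW.comp (contDiff_snd.add (contDiff_fst.mul (hη.comp contDiff_snd)))

lemma contDiff_dbar_partial {P : Type*} [NormedAddCommGroup P] [NormedSpace ℝ P]
    {F : P × ℂ → ℂ} (hF : ContDiff ℝ ∞ F) :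
    ContDiff ℝ ∞ fun p : P × ℂ => dbar (fun z => F (p.1, z)) p.2 := by
  simp only [dbar, fderiv_partial_right hF]
  exact ((contDiff_fderiv_partial_right hF 1).add
    (contDiff_const.mul (contDiff_fderiv_partial_right hF Complex.I))).div_const 2

namespace Wiener

variable {ι : Type*} [Fintype ι]

/-- The equation satisfied by deformations of a solution of a sesquilinear Cauchy-Riemann
equation. -/
def deformMap (c : ι → ι → ι → ℂ) (S : ι → Wiener) (E₁ E₂ : Wiener) (p : ℂ × (ι → Wiener))
    (i : ι) : Wiener :=
  -- The unknown is the family of `∂̄`-derivatives. The functions and their `∂`-derivatives are then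
  -- bounded operators applied to it, so the whole expression is a polynomial in `a`, `conj a` and
  -- the unknown.
  -(p.1 • mulR E₁ (p.2 i)) + p.1 • mulR E₂ (beurling (p.2 i)) +
    ((quadTerm dbarInvMul c p.2 i + S i) + p.1 • mulR E₁ (quadTerm dbarInvMul c p.2 i + S i) +
      (starRingEnd ℂ) p.1 • mulR E₂ (quadTerm dbarInvMul c p.2 i + S i))

lemma contDiff_deformMap {n : WithTop ℕ∞} (c : ι → ι → ι → ℂ) (S : ι → Wiener) (E₁ E₂ : Wiener) :
    ContDiff ℝ n (deformMap c S E₁ E₂) := by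
  rw [contDiff_pi]
  intro i
  have h1 : ContDiff ℝ n fun p : ℂ × (ι → Wiener) => p.2 i := by fun_prop
  have h2 : ContDiff ℝ n fun p : ℂ × (ι → Wiener) => quadTerm dbarInvMul c p.2 i + S i :=
    ((contDiff_quadTerm dbarInvMul c i).comp contDiff_snd).add contDiff_const
  have h3 : ContDiff ℝ n fun p : ℂ × (ι → Wiener) => beurling (p.2 i) :=
    (beurling.restrictScalars ℝ).contDiff.comp h1
  have h4 : ContDiff ℝ n fun p : ℂ × (ι → Wiener) => (starRingEnd ℂ) p.1 :=
    Complex.conjCLE.contDiff.comp contDiff_fst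
  have h5 := fun E : Wiener => (mulR E).contDiff (n := n)
  exact ((contDiff_fst.smul ((h5 E₁).comp h1)).neg.add (contDiff_fst.smul ((h5 E₂).comp h3))).add
    ((h2.add (contDiff_fst.smul ((h5 E₁).comp h2))).add (h4.smul ((h5 E₂).comp h2)))

end Wiener

open Wiener

/-- Analyticity of solutions of sesquilinear Cauchy-Riemann equations, for test functions which are
small in the Wiener algebra. -/
lemma analyticAt_of_dbar_eq_of_small {ι : Type*} [Fintype ι] {c : ι → ι → ι → ℂ} {W : ι → ℂ → ℂ}
    (hW : ∀ i, IsTest (W i)) {r δ : ℝ} (hr : 0 < r) (hr1 : r ≤ 1 / 4)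
    (heq : ∀ i z, ‖z‖ < r → dbar (W i) z = ∑ j, ∑ k, c i j k * ((starRingEnd ℂ) (W j z) * W k z))
    (hδ : ∀ i, ‖ofFun (W i)‖ ≤ δ) (hδ0 : 0 ≤ δ)
    (hsmall : (∑ i, ∑ j, ∑ k, ‖c i j k‖) * (2 * δ * ‖dbarInvR‖) < 1) (i : ι) :
    AnalyticAt ℝ (W i) 0 := by
  -- The bump lives in the disc of radius `r / 2`, so small deformations only move points within the
  -- disc where the equation holds.
  obtain ⟨η, hη, hreal, hη1, hη0⟩ := exists_bump (show 0 < r / 4 by positivity)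
    (show r / 4 < r / 2 by linarith)
  have hηT : IsTest η := .of_eq_zero hη fun z hz => hη0 z (by linarith)
  obtain ⟨M, hM⟩ := hηT.continuous.bounded_above_of_compact_support hηT.hasCompactSupport
  -- the deformed functions
  set D : ι → ℂ → ℂ → ℂ := fun i a z => W i (z + a * η z) with hD
  have hDs : ∀ i, ContDiff ℝ ∞ fun p : ℂ × ℂ => D i p.1 p.2 := fun i =>
    contDiff_deformation (hW i).1 hη
  have hDout : ∀ i a z, 1 / 4 < ‖z‖ → D i a z = 0 := fun i a z hz => by
    simp only [hD]
    rw [hη0 z (by linarith), mul_zero, add_zero, (hW i).eq_zero hz]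
  have hDT : ∀ i a, IsTest (D i a) := fun i a =>
    isTest_slice (F := fun p : ℂ × ℂ => D i p.1 p.2) (hDs i) (hDout i) a
  set H : ℂ → ι → Wiener := fun a i => ofFun (dbar (D i a)) with hH
  have hHc : Continuous H := by
    refine continuous_pi fun i => ?_
    refine continuous_ofFun (F := fun p : ℂ × ℂ => dbar (D i p.1) p.2)
      (contDiff_dbar_partial (F := fun p : ℂ × ℂ => D i p.1 p.2) (hDs i)) fun a z hz => ?_
    exact (hDT i a).dbar.eq_zero hz
  -- the inhomogeneous term
  set Q : (ι → ℂ) → ι → ℂ := fun w i => ∑ j, ∑ k, c i j k * ((starRingEnd ℂ) (w j) * w k) with hQ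
  have hQT : ∀ i, IsTest fun z => Q (fun j => W j z) i := fun i =>
    IsTest.sum fun j _ => IsTest.sum fun k _ => (((hW k).mul_left (hW j).conj.1).const_mul _)
  set S : ι → ℂ → ℂ := fun i z => dbar (W i) z - Q (fun j => W j z) i with hS
  have hST : ∀ i, IsTest (S i) := fun i => (hW i).dbar.sub (hQT i)
  have hS0 : ∀ i z, ‖z‖ < r → S i z = 0 := fun i z hz => by
    simp only [hS, hQ, heq i z hz, sub_self]
  -- the equation in the Wiener algebra
  have hK : ∀ a i, dbarInvR (H a i) = ofFun (D i a) := fun a i => by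
    rw [dbarInvR_apply, dbarInvCorner_ofFun_dbar (hDT i a)]
  have hfix : ∀ᶠ a in 𝓝 (0 : ℂ),
      deformMap c (fun i => ofFun (S i)) (ofFun (del η)) (ofFun (dbar η)) (a, H a) = H a := by
    have hball : ∀ᶠ a : ℂ in 𝓝 0, ‖a‖ * (|M| + 1) < r / 2 := by
      have : Continuous fun a : ℂ => ‖a‖ * (|M| + 1) := by fun_prop
      exact this.continuousAt.eventually_lt_const (by simpa using hr)
    filter_upwards [hball] with a ha
    refine funext fun i => eq_of_eval_eq fun x hx y hy => ?_
    set z : ℂ := x + y * Complex.I with hz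
    -- The error term `S` of the equation vanishes on the disc of radius `r`, and outside radius `r
    -- / 2` nothing moves. Hence `S` is insensitive to small deformations and enters as a constant
    -- independent of `a`.
    have hSa : S i (z + a * η z) = S i z := by
      by_cases hzr : r / 2 ≤ ‖z‖
      · rw [hη0 z hzr, mul_zero, add_zero]
      · rw [not_le] at hzr
        rw [hS0 i z (by linarith), hS0]
        have h1 : ‖a * η z‖ < r / 2 := by
          rw [norm_mul]
          refine lt_of_le_of_lt ?_ ha
          gcongr
          exact (hM z).trans ((le_abs_self M).trans (by linarith))
        exact (norm_add_le _ _).trans_lt (by linarith)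
    have hquad : eval z (quadTerm dbarInvMul c (H a) i) = Q (fun j => D j a z) i := by
      simp only [quadTerm, dbarInvMul_apply, hK, map_sum, map_smul, eval_mul, eval_conj, smul_eq_mul, hQ]
      refine Finset.sum_congr rfl fun j _ => Finset.sum_congr rfl fun k _ => ?_
      rw [hz, eval_ofFun (hDT j a) hx hy, eval_ofFun (hDT k a) hx hy]
    have hev : ∀ {F : ℂ → ℂ}, IsTest F → eval z (ofFun F) = F z := fun hF => eval_ofFun hF hx hy
    have hdef := dbar_deformation ((hW i).1.differentiable (by simp))
      (hη.differentiable (by simp)) hreal a z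
    have hQS : dbar (W i) (z + a * η z) = Q (fun j => D j a z) i + S i z := by
      rw [← hSa]
      simp only [hS, hD]
      ring
    rw [hQS] at hdef
    change _ = eval z (ofFun (dbar (D i a)))
    rw [hev (hDT i a).dbar]
    change _ = dbar (fun z => W i (z + a * η z)) z
    rw [hdef]
    simp only [deformMap, map_add, map_neg, map_smul, mulR_apply, eval_mul, smul_eq_mul, hquad,
      hev hηT.del, hev hηT.dbar, hev (hST i)]
    rw [show H a i = ofFun (dbar (D i a)) from rfl, beurling_ofFun_dbar (hDT i a),
      hev (hDT i a).dbar, hev (hDT i a).del]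
    simp only [hD]
    ring
  have hD00 : ∀ i, D i 0 = W i := fun i => funext fun z => by simp [hD]
  -- At `a = 0` only the quadratic term depends on the unknown; its differential is linear in `W`
  -- and so has norm less than `1` by the smallness assumption.
  have hderiv : HasFDerivAt (fun h => deformMap c (fun i => ofFun (S i)) (ofFun (del η))
      (ofFun (dbar η)) (0, h)) (quadTermDeriv dbarInvMul c (H 0)) (H 0) := by
    have : (fun h => deformMap c (fun i => ofFun (S i)) (ofFun (del η)) (ofFun (dbar η)) (0, h)) =
        fun h => quadTerm dbarInvMul c h + fun i => ofFun (S i) := by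
      funext h i
      simp [deformMap]
    rw [this]
    exact (hasFDerivAt_quadTerm dbarInvMul c (H 0)).add_const _
  have hHω : ContDiffAt ℝ ω H 0 := by
    refine contDiffAt_of_isFixedPt (by simp) (contDiff_deformMap c _ _ _).contDiffAt
      hHc.continuousAt hfix hderiv ?_
    have hH0 : ∀ j, ‖dbarInvR (H 0 j)‖ ≤ δ := fun j => by
      rw [hK, hD00]
      exact hδ j
    refine (norm_quadTermDeriv_le dbarInvMul c (H 0) (δ := δ * ‖dbarInvR‖) (by positivity)
      (fun j x => ?_) fun j x => ?_).trans_lt (by rwa [← mul_assoc (2 : ℝ)])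
    · refine (norm_dbarInvMul_apply_le _ _).trans ?_
      rw [mul_assoc]
      exact mul_le_mul (hH0 j) (dbarInvR.le_opNorm x) (norm_nonneg _) hδ0
    · refine (norm_dbarInvMul_apply_le _ _).trans ?_
      rw [mul_comm, mul_assoc]
      exact mul_le_mul (hH0 j) (dbarInvR.le_opNorm x) (norm_nonneg _) hδ0
  -- Since `η 0 = 1`, evaluating the deformed function at the origin turns the parameter into the
  -- argument: the value is `W i a`.
  have hfin : (fun a => eval ((0 : ℝ) + (0 : ℝ) * Complex.I) (dbarInvR (H a i))) =ᶠ[𝓝 0] W i := by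
    refine Eventually.of_forall fun a => ?_
    simp only
    rw [hK, eval_ofFun (hDT i a) (by norm_num) (by norm_num)]
    simp [hD, hη1 0 (by rw [norm_zero]; positivity)]
  refine AnalyticAt.congr ?_ hfin
  refine ContDiffAt.analyticAt ?_
  have h1 : ContDiffAt ℝ ω (fun a => H a i) 0 := (contDiffAt_pi.1 hHω) i
  exact (((eval _).restrictScalars ℝ).comp dbarInvR).contDiff.contDiffAt.comp (0 : ℂ) h1

end

/-! ### Removing the smallness assumption by dilation. -/

noncomputable section

open Filter Topology Wiener

lemma exists_contDiff_extension {F : ℂ → ℂ} {ρ : ℝ} (hρ : 0 < ρ)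
    (hF : ContDiffOn ℝ ∞ F (Metric.ball 0 ρ)) :
    ∃ G : ℂ → ℂ, ContDiff ℝ ∞ G ∧ ∀ z, ‖z‖ ≤ ρ / 4 → G z = F z := by
  obtain ⟨χ, hχ, -, hχ1, hχ0⟩ := exists_bump (show 0 < ρ / 4 by positivity)
    (show ρ / 4 < ρ / 2 by linarith)
  refine ⟨fun z => χ z * F z, contDiff_iff_contDiffAt.2 fun z => ?_, fun z hz => by
    simp only [hχ1 z hz, one_mul]⟩
  by_cases hz : ‖z‖ < ρ
  · exact hχ.contDiffAt.mul (hF.contDiffAt (Metric.isOpen_ball.mem_nhds (by simpa using hz)))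
  · have hev : ∀ᶠ y : ℂ in 𝓝 z, ρ / 2 < ‖y‖ :=
      continuous_norm.continuousAt.eventually_const_lt (by linarith)
    refine (contDiffAt_const (c := (0 : ℂ))).congr_of_eventuallyEq ?_
    filter_upwards [hev] with y hy
    rw [hχ0 y hy.le, zero_mul]

lemma fderiv_comp_real_mul {F : ℂ → ℂ} {ε : ℝ} {z : ℂ} (hF : DifferentiableAt ℝ F (ε * z)) (v : ℂ) :
    fderiv ℝ (fun z : ℂ => F (ε * z)) z v = ε * fderiv ℝ F (ε * z) v := by
  have h1 : HasFDerivAt (fun z : ℂ => (ε : ℂ) * z) ((ε : ℂ) • ContinuousLinearMap.id ℝ ℂ) z :=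
    (hasFDerivAt_id z).const_mul _
  have h2 : HasFDerivAt (fun z : ℂ => F (ε * z)) _ z := hF.hasFDerivAt.comp z h1
  rw [h2.fderiv]
  have : (ε : ℂ) * v = ε • v := by simp
  simp only [ContinuousLinearMap.comp_apply, smul_apply,
    ContinuousLinearMap.id_apply, smul_eq_mul]
  rw [this, map_smul, Complex.real_smul]

lemma dbar_comp_real_mul {F : ℂ → ℂ} {ε : ℝ} {z : ℂ} (hF : DifferentiableAt ℝ F (ε * z)) :
    dbar (fun z : ℂ => F (ε * z)) z = ε * dbar F (ε * z) := by
  rw [dbar, dbar, fderiv_comp_real_mul hF, fderiv_comp_real_mul hF]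
  ring

lemma del_comp_real_mul {F : ℂ → ℂ} {ε : ℝ} {z : ℂ} (hF : DifferentiableAt ℝ F (ε * z)) :
    del (fun z : ℂ => F (ε * z)) z = ε * del F (ε * z) := by
  rw [del, del, fderiv_comp_real_mul hF, fderiv_comp_real_mul hF]
  ring

lemma dbar_const_mul {F : ℂ → ℂ} {z : ℂ} (hF : DifferentiableAt ℝ F z) (c : ℂ) :
    dbar (fun z => c * F z) z = c * dbar F z := by
  rw [dbar, dbar, fderiv_const_mul hF c]
  simp only [smul_apply, smul_eq_mul]
  ring

/-- A family of dilations, cut off to test functions, that vanishes in the limit tends to `0` in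
the Wiener algebra. -/
lemma tendsto_ofFun_dilation {χ : ℂ → ℂ} (hχ : ContDiff ℝ ∞ χ) (hχ0 : ∀ z, 1 / 4 ≤ ‖z‖ → χ z = 0)
    {F : ℝ × ℂ → ℂ} (hF : ContDiff ℝ ∞ F) (hF0 : ∀ z, F (0, z) = 0) :
    Tendsto (fun ε : ℝ => ‖ofFun fun z => χ z * F (ε, z)‖) (𝓝 0) (𝓝 0) := by
  have hs : ContDiff ℝ ∞ fun p : ℝ × ℂ => χ p.2 * F p := (hχ.comp contDiff_snd).mul hF
  have hc := continuous_ofFun (F := fun p : ℝ × ℂ => χ p.2 * F p) hs fun ε z hz => by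
    simp only [hχ0 z hz.le, zero_mul]
  have h0 : ofFun (fun z => χ z * F (0, z)) = 0 := by
    have hT : IsTest fun _ : ℂ => (0 : ℂ) := .of_eq_zero contDiff_const fun _ _ => rfl
    have h1 := ofFun_sub hT hT
    simp only [sub_self] at h1
    simp only [hF0, mul_zero, h1]
  have := (hc.norm).tendsto 0
  simpa only [h0, norm_zero] using this

/-- Analyticity of solutions of sesquilinear Cauchy-Riemann equations. -/
theorem analyticAt_of_dbar_eq {ι : Type*} [Fintype ι] {c : ι → ι → ι → ℂ} {W : ι → ℂ → ℂ}
    {ρ : ℝ} (hρ : 0 < ρ) (hW : ∀ i, ContDiffOn ℝ ∞ (W i) (Metric.ball 0 ρ))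
    (heq : ∀ i, ∀ z ∈ Metric.ball (0 : ℂ) ρ,
      dbar (W i) z = ∑ j, ∑ k, c i j k * ((starRingEnd ℂ) (W j z) * W k z)) (i : ι) :
    AnalyticAt ℝ (W i) 0 := by
  choose G hG hGW using fun i => exists_contDiff_extension hρ (hW i)
  have hevW : ∀ i z, ‖z‖ < ρ / 4 → G i =ᶠ[𝓝 z] W i := by
    intro i z hz
    filter_upwards [continuous_norm.continuousAt.eventually_lt_const hz] with y hy
    exact hGW i y hy.le
  have hGeq : ∀ i z, ‖z‖ < ρ / 4 →
      dbar (G i) z = ∑ j, ∑ k, c i j k * ((starRingEnd ℂ) (G j z) * G k z) := by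
    intro i z hz
    rw [dbar_congr (hevW i z hz), heq i z (by rw [mem_ball_zero_iff]; linarith)]
    simp only [hGW _ z hz.le]
  obtain ⟨χ, hχ, -, hχ1, hχ0⟩ := exists_bump (show (0 : ℝ) < 1 / 8 by norm_num)
    (show (1 / 8 : ℝ) < 1 / 4 by norm_num)
  -- The dilation `ε G(ε z)` preserves the system: the prefactor and the derivative contribute `ε²`
  -- on the left, and the sesquilinear right hand side is of degree two. As `ε` tends to `0` the
  -- cut-off dilations tend to `0` in the Wiener norm.
  set F : ι → ℝ × ℂ → ℂ := fun i p => p.1 * G i (p.1 * p.2) with hF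
  have hFs : ∀ i, ContDiff ℝ ∞ (F i) := fun i => by
    have h1 : ContDiff ℝ ∞ fun p : ℝ × ℂ => (p.1 : ℂ) :=
      Complex.ofRealCLM.contDiff.comp contDiff_fst
    exact h1.mul ((hG i).comp (h1.mul contDiff_snd))
  have htend : ∀ i, Tendsto (fun ε : ℝ => ‖ofFun fun z => χ z * F i (ε, z)‖) (𝓝 0) (𝓝 0) :=
    fun i => tendsto_ofFun_dilation hχ hχ0 (hFs i) fun z => by simp [hF]
  set C := (∑ i, ∑ j, ∑ k, ‖c i j k‖) with hC
  have hC0 : 0 ≤ C := by positivity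
  set δ : ℝ := (2 * (C + 1) * (‖dbarInvR‖ + 1))⁻¹ / 2 with hδ
  have hδ0 : 0 < δ := by positivity
  have hsmall : C * (2 * δ * ‖dbarInvR‖) < 1 := by
    have h1 : 2 * δ * (2 * (C + 1) * (‖dbarInvR‖ + 1)) = 1 := by
      rw [hδ]
      field_simp
    have h2 : C * ‖dbarInvR‖ ≤ (C + 1) * (‖dbarInvR‖ + 1) := by
      have := norm_nonneg dbarInvR
      nlinarith
    nlinarith
  have hev : ∀ᶠ ε : ℝ in 𝓝[>] 0, ∀ i, ‖ofFun fun z => χ z * F i (ε, z)‖ < δ := by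
    rw [eventually_all]
    exact fun i => ((htend i).mono_left nhdsWithin_le_nhds).eventually_lt_const hδ0
  obtain ⟨ε, hεδ, hε⟩ := (hev.and self_mem_nhdsWithin).exists
  have hε : 0 < ε := hε
  have hT : ∀ i, IsTest fun z => χ z * F i (ε, z) := fun i =>
    .of_eq_zero (hχ.mul ((hFs i).comp (contDiff_const.prodMk contDiff_id))) fun z hz => by
      rw [hχ0 z hz.le, zero_mul]
  have hloc : ∀ i z, ‖z‖ < 1 / 8 →
      (fun z => χ z * F i (ε, z)) =ᶠ[𝓝 z] fun z => (ε : ℂ) * G i (ε * z) := by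
    intro i z hz
    filter_upwards [continuous_norm.continuousAt.eventually_lt_const hz] with y hy
    simp only [hF]
    rw [hχ1 y hy.le, one_mul]
  have key := analyticAt_of_dbar_eq_of_small (c := c) hT
    (r := min (1 / 8) (ρ / 4 / ε)) (δ := δ) (by positivity)
    ((min_le_left _ _).trans (by norm_num)) (fun i z hz => by
      have hz1 := hz.trans_le (min_le_left _ _)
      have hz2 : ‖(ε : ℂ) * z‖ < ρ / 4 := by
        have := hz.trans_le (min_le_right _ _)
        rw [lt_div_iff₀ hε] at this
        rw [norm_mul, Complex.norm_real, Real.norm_of_nonneg hε.le]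
        linarith
      have hd := (hG i).differentiable (by simp) ((ε : ℂ) * z)
      rw [dbar_congr (hloc i z hz1), dbar_const_mul, dbar_comp_real_mul hd, hGeq i _ hz2]
      · simp only [Finset.mul_sum, hχ1 z hz1.le, hF, one_mul, map_mul, Complex.conj_ofReal]
        refine Finset.sum_congr rfl fun j _ => Finset.sum_congr rfl fun k _ => ?_
        ring
      · exact hd.comp z (by fun_prop))
    (fun i => (hεδ i).le) hδ0.le hsmall i
  have key2 : AnalyticAt ℝ (fun z => (ε : ℂ) * G i (ε * z)) 0 :=
    key.congr (hloc i 0 (by norm_num))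
  have key3 : AnalyticAt ℝ (fun z : ℂ => (ε : ℂ)⁻¹ * ((ε : ℂ) * G i (ε * ((ε : ℂ)⁻¹ * z)))) 0 := by
    have h1 : AnalyticAt ℝ (fun z : ℂ => (ε : ℂ)⁻¹ * z) 0 := analyticAt_const.mul analyticAt_id
    exact analyticAt_const.mul (key2.comp_of_eq h1 (by simp))
  refine key3.congr ?_
  filter_upwards [hevW i 0 (by simpa using hρ)] with z hz
  have hε' : (ε : ℂ) ≠ 0 := by exact_mod_cast hε.ne'
  rw [mul_inv_cancel_left₀ hε', inv_mul_cancel_left₀ hε', hz]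

end

/-! ### Translations of the torus and termwise differentiation. -/

noncomputable section

open Filter Topology

namespace Wiener

/-- Translations of the torus. -/
def torusTranslate (x : ℂ) : Wiener →L[ℂ] Wiener :=
  multiplier (fun n => planeChar n x) 1 fun n => (norm_planeChar n x).le

lemma eval_torusTranslate (x z : ℂ) (a : Wiener) : eval z (torusTranslate x a) = eval (x + z) a := by
  rw [eval_apply, eval_apply]
  refine tsum_congr fun n => ?_
  rw [torusTranslate, multiplier_apply, planeChar_add_right]
  ring

lemma eval_zero_translate (x : ℂ) (a : Wiener) : eval 0 (torusTranslate x a) = eval x a := by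
  rw [eval_torusTranslate, add_zero]

lemma translate_mul (x : ℂ) (a b : Wiener) :
    torusTranslate x (mul a b) = mul (torusTranslate x a) (torusTranslate x b) :=
  eq_of_eval_eq fun _ _ _ _ => by simp only [eval_torusTranslate, eval_mul]

lemma translate_beurling (x : ℂ) (a : Wiener) :
    torusTranslate x (beurling a) = beurling (torusTranslate x a) := ext_apply fun n => by
  simp only [torusTranslate, beurling, multiplier_apply]
  ring

lemma norm_translate_apply_le (x : ℂ) (a : Wiener) : ‖torusTranslate x a‖ ≤ ‖a‖ := by
  simpa using (torusTranslate x).le_of_opNorm_le (norm_multiplier_le _ _ _) a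

lemma planeFreq_eq (n : ℤ × ℤ) (v : ℂ) :
    planeFreq n v = delSymbol n * v + dbarSymbol n * (starRingEnd ℂ) v := by
  have h1 : v = v.re + v.im * Complex.I := (Complex.re_add_im v).symm
  have h2 : (starRingEnd ℂ) v = v.re - v.im * Complex.I := by
    apply Complex.ext <;> simp
  rw [h2, planeFreq_apply, delSymbol, dbarSymbol]
  conv_rhs => enter [1, 2]; rw [h1]
  linear_combination (2 * Real.pi * Complex.I * n.2 * v.im) * Complex.I_sq

lemma norm_planeFreq_le (n : ℤ × ℤ) : ‖planeFreq n‖ ≤ 2 * ‖dbarSymbol n‖ := by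
  refine ContinuousLinearMap.opNorm_le_bound _ (by positivity) fun v => ?_
  rw [planeFreq_eq]
  refine (norm_add_le _ _).trans_eq ?_
  rw [norm_mul, norm_mul, norm_delSymbol, RCLike.norm_conj]
  ring

lemma exists_basis : ∃ e : ℤ × ℤ → Wiener, (∀ n, ‖e n‖ = 1) ∧
    ∀ a : Wiener, HasSum (fun n => a n • e n) a := by
  refine ⟨fun n => lp.single 1 n (1 : ℂ), fun n => ?_, fun a => ?_⟩
  · rw [lp.norm_single (by simp), norm_one]
  · have h := lp.hasSum_single (p := 1) (by simp) a
    refine h.congr_fun fun n => ?_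
    rw [← lp.single_smul, smul_eq_mul, mul_one]

/-- Differentiating a translate multiplies the `n`-th coefficient by a frequency of size at most `2
‖dbarSymbol n‖`, and `dbarSymbol n` times the coefficient of `F` is that of `∂̄F`, which is
summable. -/
lemma hasFDerivAt_translate {F : ℂ → ℂ} (hF : IsTest F) (x : ℂ) :
    HasFDerivAt (fun x => torusTranslate x (ofFun F))
      (Complex.reCLM.smulRight (torusTranslate x (ofFun fun z => fderiv ℝ F z 1)) +
        Complex.imCLM.smulRight (torusTranslate x (ofFun fun z => fderiv ℝ F z Complex.I))) x := by
  obtain ⟨e, he1, he⟩ := exists_basis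
  have hser : ∀ (y : ℂ) (b : Wiener), HasSum (fun n => (planeChar n y * b n) • e n)
      (torusTranslate y b) := fun y b => he (torusTranslate y b)
  have hf : ∀ n y, HasFDerivAt (fun y => (planeChar n y * ofFun F n) • e n)
      ((ofFun F n • planeChar n y • planeFreq n).smulRight (e n)) y := fun n y =>
    ((hasFDerivAt_planeChar n y).mul_const _).smul_const _
  have hu : Summable fun n => ‖ofFun F n‖ * ‖planeFreq n‖ := by
    have h1 := summable_norm (ofFun (dbar F))
    refine Summable.of_nonneg_of_le (fun n => by positivity) (fun n => ?_) (h1.mul_left 2)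
    rw [ofFun_apply hF.dbar, planeCoeff_dbar hF, norm_mul, ofFun_apply hF, ← mul_assoc, mul_comm]
    exact mul_le_mul_of_nonneg_right (norm_planeFreq_le n) (norm_nonneg _)
  have hf' : ∀ n y, ‖(ofFun F n • planeChar n y • planeFreq n).smulRight (e n)‖ ≤
      ‖ofFun F n‖ * ‖planeFreq n‖ := fun n y => by
    refine ContinuousLinearMap.opNorm_le_bound _ (by positivity) fun v => ?_
    rw [ContinuousLinearMap.smulRight_apply, norm_smul, he1, mul_one]
    simp only [smul_apply, norm_smul, norm_planeChar, one_mul, mul_assoc]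
    exact mul_le_mul_of_nonneg_left ((planeFreq n).le_opNorm v) (norm_nonneg _)
  have key := hasFDerivAt_tsum hu hf hf' (hser x _).summable x
  simp only [(hser _ (ofFun F)).tsum_eq] at key
  refine key.congr_fderiv (ContinuousLinearMap.ext fun v => ?_)
  have hsum : Summable fun n => (ofFun F n • planeChar n x • planeFreq n).smulRight (e n) :=
    Summable.of_norm_bounded hu fun n => hf' n x
  have h1 := ((ContinuousLinearMap.apply ℝ Wiener v).hasSum hsum.hasSum)
  have h2 := ((hser x (ofFun fun z => fderiv ℝ F z 1)).const_smul v.re).add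
    ((hser x (ofFun fun z => fderiv ℝ F z Complex.I)).const_smul v.im)
  refine h1.unique (h2.congr_fun fun n => ?_)
  simp only [ContinuousLinearMap.apply_apply,
    ContinuousLinearMap.smulRight_apply, smul_apply, ofFun_fderiv_apply hF, smul_eq_mul]
  rw [← smul_assoc, ← smul_assoc, ← add_smul]
  congr 1
  simp only [Complex.real_smul, planeFreq_apply]
  simp
  ring

/-- Induction works because the partial derivatives of the family of translates are families of
translates of test functions again. -/
lemma contDiff_translate {F : ℂ → ℂ} (hF : IsTest F) :
    ContDiff ℝ ∞ fun x => torusTranslate x (ofFun F) := by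
  rw [contDiff_infty]
  intro k
  induction k generalizing F with
  | zero =>
    rw [Nat.cast_zero, contDiff_zero]
    exact continuous_iff_continuousAt.2 fun x => (hasFDerivAt_translate hF x).continuousAt
  | succ k ih =>
    rw [Nat.cast_succ, contDiff_succ_iff_hasFDerivAt]
    refine ⟨_, ?_, fun x => hasFDerivAt_translate hF x⟩
    have h1 := ih (hF.fderiv_apply 1)
    have h2 := ih (hF.fderiv_apply Complex.I)
    exact (contDiff_const.smulRight h1).add (contDiff_const.smulRight h2)

/-- The series `dbarInv a` can be differentiated term by term. -/
lemma hasFDerivAt_eval_dbarInv (a : Wiener) (z : ℂ) :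
    HasFDerivAt (fun z => eval z (dbarInv a))
      (eval z (beurling a) • (ContinuousLinearMap.id ℝ ℂ) +
        (eval z a - a 0) • Complex.conjCLE.toContinuousLinearMap) z := by
  have hf : ∀ n y, HasFDerivAt (fun y => planeChar n y * dbarInv a n)
      (dbarInv a n • planeChar n y • planeFreq n) y := fun n y =>
    (hasFDerivAt_planeChar n y).mul_const _
  have hle : ∀ n, ‖planeFreq n‖ * ‖dbarInv a n‖ ≤ 2 * ‖a n‖ := by
    intro n
    rw [dbarInv, multiplier_apply, norm_mul, norm_inv]
    by_cases hn : n = 0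
    · simp [hn, dbarSymbol]
    · have h1 : ‖dbarSymbol n‖ ≠ 0 := norm_ne_zero_iff.2 (dbarSymbol_ne_zero hn)
      calc _ ≤ (2 * ‖dbarSymbol n‖) * (‖dbarSymbol n‖⁻¹ * ‖a n‖) :=
            mul_le_mul_of_nonneg_right (norm_planeFreq_le n) (by positivity)
        _ = 2 * ‖a n‖ := by field_simp
  have hf' : ∀ n y, ‖dbarInv a n • planeChar n y • planeFreq n‖ ≤ 2 * ‖a n‖ := fun n y => by
    rw [norm_smul, norm_smul, norm_planeChar, one_mul, mul_comm]
    exact hle n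
  have hu : Summable fun n => 2 * ‖a n‖ := (summable_norm a).mul_left 2
  have hs : ∀ (b : Wiener) (y : ℂ), Summable fun n => planeChar n y * b n := fun b y => by
    refine Summable.of_norm ?_
    simpa only [norm_mul, norm_planeChar, one_mul] using summable_norm b
  have key := hasFDerivAt_tsum hu hf hf' (hs _ z) z
  simp only [← eval_apply] at key
  refine key.congr_fderiv (ContinuousLinearMap.ext fun v => ?_)
  have hsum : Summable fun n => dbarInv a n • planeChar n z • planeFreq n :=
    Summable.of_norm_bounded hu fun n => hf' n z
  have h1 := ((ContinuousLinearMap.apply ℝ ℂ v).hasSum hsum.hasSum).tsum_eq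
  simp only [ContinuousLinearMap.apply_apply] at h1
  rw [← h1]
  -- The frequency zero was annihilated by `dbarInv`, so `∂̄` returns `a` minus its mean `a 0`.
  have h2 : HasSum (fun n : ℤ × ℤ => (if n = 0 then a 0 else 0 : ℂ)) (a 0) := hasSum_ite_eq 0 (a 0)
  have h3 := ((hs (beurling a) z).hasSum.mul_right v).add
    (((hs a z).hasSum.sub h2).mul_right ((starRingEnd ℂ) v))
  rw [← eval_apply, ← eval_apply] at h3
  simp only [add_apply, smul_apply, ContinuousLinearMap.id_apply, smul_eq_mul]
  refine (tsum_congr fun n => ?_).trans h3.tsum_eq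
  simp only [beurling, dbarInv, multiplier_apply, planeFreq_eq]
  by_cases hn : n = 0
  · simp [hn, dbarSymbol, delSymbol, planeChar_zero]
  · have := dbarSymbol_ne_zero hn
    rw [if_neg hn]
    field_simp
    ring

end Wiener

end

/-! ### The Beltrami equation. -/

noncomputable section

open Filter Topology Wiener

lemma dbar_eq_of_hasFDerivAt {f : ℂ → ℂ} {p q z : ℂ}
    (h : HasFDerivAt f (p • ContinuousLinearMap.id ℝ ℂ +
      q • Complex.conjCLE.toContinuousLinearMap) z) : dbar f z = q := by
  rw [dbar, h.fderiv]
  simp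
  linear_combination (p / 2 - q / 2) * Complex.I_sq

lemma del_eq_of_hasFDerivAt {f : ℂ → ℂ} {p q z : ℂ}
    (h : HasFDerivAt f (p • ContinuousLinearMap.id ℝ ℂ +
      q • Complex.conjCLE.toContinuousLinearMap) z) : del f z = p := by
  rw [del, h.fderiv]
  simp
  linear_combination (-p / 2 + q / 2) * Complex.I_sq

/-- Smooth solutions of the Beltrami equation for small test functions. -/
lemma exists_beltrami_of_small {μ : ℂ → ℂ} (hμ : IsTest μ) (hsmall : ‖ofFun μ‖ ≤ 1 / 4) :
    ∃ f : ℂ → ℂ, ContDiff ℝ ∞ f ∧ ∀ z, ‖z‖ ≤ 1 / 4 →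
      dbar f z = μ z * del f z ∧ ‖dbar f z‖ < ‖del f z‖ := by
  set m := ofFun μ with hm
  -- The equation is solved for `h = ∂̄f`, with `∂f = 1 + beurling h`: it reads `(1 - L) h = μ`,
  -- where `L` is `beurling` followed by multiplication by `μ`. The variant `L x` belongs to the
  -- translated coefficient.
  set L : ℂ → Wiener →L[ℂ] Wiener := fun x => (mul (torusTranslate x m)).comp beurling with hL
  have hLn : ∀ x, ‖L x‖ ≤ 1 / 4 := by
    intro x
    refine ContinuousLinearMap.opNorm_le_bound _ (by norm_num) fun b => ?_
    refine ((mul (torusTranslate x m)).le_of_opNorm_le (norm_mul_apply_le _) _).trans ?_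
    have h1 := (norm_translate_apply_le x m).trans hsmall
    have h2 : ‖beurling b‖ ≤ ‖b‖ := by
      simpa using beurling.le_of_opNorm_le norm_beurling_le b
    exact mul_le_mul h1 h2 (norm_nonneg _) (by norm_num)
  have hunit : ∀ x, IsUnit (1 - L x) := fun x =>
    isUnit_one_sub_of_norm_lt_one ((hLn x).trans_lt (by norm_num))
  have hsol : ∀ x a b, (1 - L x) a = b → a = Ring.inverse (1 - L x) b := by
    intro x a b hab
    rw [← hab, ← mul_apply_eq_comp, Ring.inverse_mul_cancel _ (hunit x)]
    rfl
  set h : Wiener := Ring.inverse (1 - L 0) (torusTranslate 0 m) with hh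
  have ht0 : ∀ a, torusTranslate 0 a = a := fun a => ext_apply fun n => by
    rw [torusTranslate, multiplier_apply, planeChar_zero_right, one_mul]
  have hheq : h = mul m (beurling h) + m := by
    have h1 : (1 - L 0) h = torusTranslate 0 m := by
      rw [hh, ← mul_apply_eq_comp, Ring.mul_inverse_cancel _ (hunit 0)]
      rfl
    simp only [hL, sub_apply, one_apply_eq_self, ContinuousLinearMap.comp_apply,
      ht0] at h1
    exact sub_eq_iff_eq_add'.1 h1
  have hhn : ‖h‖ ≤ 1 / 3 := by
    have h1 : ‖mul m (beurling h)‖ ≤ 1 / 4 * ‖h‖ := by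
      have := (L 0).le_of_opNorm_le (hLn 0) h
      simpa only [hL, ContinuousLinearMap.comp_apply, ht0] using this
    have h2 : ‖h‖ ≤ 1 / 4 * ‖h‖ + 1 / 4 :=
      calc ‖h‖ = ‖mul m (beurling h) + m‖ := by rw [← hheq]
        _ ≤ _ := (norm_add_le _ _).trans (add_le_add h1 hsmall)
    linarith
  have hbn : ‖beurling h‖ ≤ 1 / 3 := by
    refine le_trans ?_ hhn
    simpa using beurling.le_of_opNorm_le norm_beurling_le h
  -- Regularity comes from translating the equation. The translates of `μ` depend smoothly on `x`
  -- and inversion of operators is smooth, hence so do the translates of `h`; evaluation at `0`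
  -- returns the function `h` itself.
  have htr : ∀ x, torusTranslate x h = Ring.inverse (1 - L x) (torusTranslate x m) := by
    intro x
    refine hsol x _ _ ?_
    have h1 : torusTranslate x h = mul (torusTranslate x m) (beurling (torusTranslate x h)) + torusTranslate x m := by
      conv_lhs => rw [hheq]
      rw [map_add, translate_mul, translate_beurling]
    simp only [hL, sub_apply, one_apply_eq_self, ContinuousLinearMap.comp_apply]
    conv_lhs => enter [1]; rw [h1]
    abel
  have hms : ContDiff ℝ ∞ fun x => torusTranslate x m := contDiff_translate hμ
  have htrs : ContDiff ℝ ∞ fun x => torusTranslate x h := by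
    have hLs : ContDiff ℝ ∞ L := by
      have h1 : ContDiff ℝ ∞ fun x => mul (torusTranslate x m) :=
        (mul.restrictScalars ℝ).contDiff.comp hms
      exact (((ContinuousLinearMap.compL ℂ Wiener Wiener Wiener).flip
        beurling).restrictScalars ℝ).contDiff.comp h1
    have hinv : ContDiff ℝ ∞ fun x => Ring.inverse (1 - L x) := by
      rw [contDiff_iff_contDiffAt]
      intro x
      obtain ⟨u, hu⟩ := hunit x
      have h1 : ContDiffAt ℝ ∞ Ring.inverse (1 - L x) := by
        rw [← hu]
        exact (contDiffAt_ringInverse ℂ u).restrict_scalars ℝ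
      exact h1.comp x (contDiff_const.sub hLs).contDiffAt
    rw [funext htr]
    have happ : IsBoundedBilinearMap ℝ fun p : (Wiener →L[ℂ] Wiener) × Wiener => p.1 p.2 :=
      ((ContinuousLinearMap.id ℂ (Wiener →L[ℂ] Wiener)).bilinearRestrictScalars
        ℝ).isBoundedBilinearMap
    exact happ.contDiff.comp (hinv.prodMk hms)
  -- The summand `h 0 * conj z` supplies the mean of `∂̄f`, which a periodic function cannot have.
  set f : ℂ → ℂ := fun z => z + h 0 * (starRingEnd ℂ) z + eval z (dbarInv h) with hf
  have hderiv : ∀ z, HasFDerivAt f ((1 + eval z (beurling h)) • ContinuousLinearMap.id ℝ ℂ +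
      eval z h • Complex.conjCLE.toContinuousLinearMap) z := by
    intro z
    have h1 : HasFDerivAt (fun z => h 0 * (starRingEnd ℂ) z)
        (h 0 • Complex.conjCLE.toContinuousLinearMap) z :=
      Complex.conjCLE.toContinuousLinearMap.hasFDerivAt.const_mul (h 0)
    refine (((hasFDerivAt_id z).add h1).add (hasFDerivAt_eval_dbarInv h z)).congr_fderiv ?_
    refine ContinuousLinearMap.ext fun v => ?_
    simp only [add_apply, smul_apply, smul_eq_mul, ContinuousLinearMap.id_apply]
    ring
  have hevs : ∀ T : Wiener →L[ℂ] ℂ, ContDiff ℝ ∞ fun z => T (torusTranslate z h) := fun T =>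
    (T.restrictScalars ℝ).contDiff.comp htrs
  have hfs : ContDiff ℝ ∞ f := by
    rw [contDiff_infty_iff_fderiv]
    refine ⟨fun z => (hderiv z).differentiableAt, ?_⟩
    rw [funext fun z => (hderiv z).fderiv]
    have h1 : ContDiff ℝ ∞ fun z => eval z h := by
      simpa only [eval_zero_translate] using hevs (eval 0)
    have h2 : ContDiff ℝ ∞ fun z => eval z (beurling h) := by
      simp only [← eval_zero_translate _ (beurling h), translate_beurling]
      exact hevs ((eval 0).comp beurling)
    exact ((contDiff_const.add h2).smul contDiff_const).add (h1.smul contDiff_const)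
  refine ⟨f, hfs, fun z hz => ?_⟩
  rw [dbar_eq_of_hasFDerivAt (hderiv z), del_eq_of_hasFDerivAt (hderiv z)]
  constructor
  · have hre := (Complex.abs_re_le_norm z).trans hz
    have him := (Complex.abs_im_le_norm z).trans hz
    rw [abs_le] at hre him
    have h1 := eval_ofFun hμ (x := z.re) (y := z.im) ⟨by linarith, by linarith⟩
      ⟨by linarith, by linarith⟩
    rw [Complex.re_add_im] at h1
    conv_lhs => rw [hheq]
    rw [map_add, eval_mul, hm, h1]
    ring
  -- Here `‖∂̄f‖ ≤ 1/3` while `‖∂f‖ ≥ 1 - 1/3`.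
  · have h1 := (norm_eval_le z h).trans hhn
    have h2 := (norm_eval_le z (beurling h)).trans hbn
    have h3 := norm_sub_le_norm_add (1 : ℂ) (eval z (beurling h))
    rw [norm_one] at h3
    linarith

/-- Local smooth solutions of the Beltrami equation. -/
theorem exists_beltrami {μ : ℂ → ℂ} {ρ : ℝ} (hρ : 0 < ρ) (hμ : ContDiffOn ℝ ∞ μ (Metric.ball 0 ρ))
    (hμ0 : μ 0 = 0) :
    ∃ (r : ℝ) (f : ℂ → ℂ), 0 < r ∧ ContDiff ℝ ∞ f ∧ ∀ z, ‖z‖ < r →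
      dbar f z = μ z * del f z ∧ ‖dbar f z‖ < ‖del f z‖ := by
  obtain ⟨G, hG, hGμ⟩ := exists_contDiff_extension hρ hμ
  obtain ⟨χ, hχ, -, hχ1, hχ0⟩ := exists_bump (show (0 : ℝ) < 1 / 8 by norm_num)
    (show (1 / 8 : ℝ) < 1 / 4 by norm_num)
  set F : ℝ × ℂ → ℂ := fun p => G (p.1 * p.2) with hF
  have hFs : ContDiff ℝ ∞ F :=
    hG.comp ((Complex.ofRealCLM.contDiff.comp contDiff_fst).mul contDiff_snd)
  -- Because `μ 0 = 0`, the cut-off dilations `μ(ε z)` tend to `0` in the Wiener norm, so a small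
  -- `ε` reaches the case already solved.
  have htend := tendsto_ofFun_dilation hχ hχ0 hFs fun z => by
    simp only [hF, Complex.ofReal_zero, zero_mul]
    rw [hGμ 0 (by rw [norm_zero]; positivity), hμ0]
  obtain ⟨ε, hεδ, hε⟩ := (((htend.mono_left nhdsWithin_le_nhds).eventually_lt_const
    (show (0 : ℝ) < 1 / 4 by norm_num)).and (self_mem_nhdsWithin (s := Set.Ioi 0))).exists
  have hε : 0 < ε := hε
  have hε' : (ε : ℂ) ≠ 0 := by exact_mod_cast hε.ne'
  have hT : IsTest fun z => χ z * F (ε, z) :=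
    .of_eq_zero (hχ.mul (hFs.comp (contDiff_const.prodMk contDiff_id))) fun z hz => by
      rw [hχ0 z hz.le, zero_mul]
  obtain ⟨f, hf, hfμ⟩ := exists_beltrami_of_small hT hεδ.le
  have hinv : ContDiff ℝ ∞ fun z : ℂ => ((ε⁻¹ : ℝ) : ℂ) * z := contDiff_const.mul contDiff_id
  refine ⟨min (ε / 8) (ρ / 4), fun z => f (((ε⁻¹ : ℝ) : ℂ) * z), by positivity, hf.comp hinv,
    fun z hz => ?_⟩
  have hd := hf.differentiable (by simp) (((ε⁻¹ : ℝ) : ℂ) * z)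
  rw [dbar_comp_real_mul hd, del_comp_real_mul hd]
  have hz1 : ‖((ε⁻¹ : ℝ) : ℂ) * z‖ < 1 / 8 := by
    have := hz.trans_le (min_le_left _ _)
    rw [norm_mul, Complex.norm_real, Real.norm_of_nonneg (by positivity), inv_mul_lt_iff₀ hε]
    linarith
  obtain ⟨h1, h2⟩ := hfμ _ (hz1.le.trans (by norm_num))
  constructor
  · rw [h1, hχ1 _ hz1.le]
    simp only [hF]
    rw [one_mul, Complex.ofReal_inv, mul_inv_cancel_left₀ hε',
      hGμ z (hz.le.trans (min_le_right _ _))]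
    ring
  · rw [norm_mul, norm_mul]
    refine mul_lt_mul_of_pos_left h2 ?_
    rw [Complex.norm_real, norm_pos_iff]
    exact (inv_pos.2 hε).ne'

end

/-! ### The cross product and special Lagrangian planes. -/

noncomputable section

section Algebra

lemma inner_C3 (u v : C3) : inner ℝ u v =
    (u 0).re * (v 0).re + (u 0).im * (v 0).im + ((u 1).re * (v 1).re + (u 1).im * (v 1).im) +
      ((u 2).re * (v 2).re + (u 2).im * (v 2).im) := by
  simp [PiLp.inner_apply, Fin.sum_univ_three, Complex.inner]
  ring

lemma kahlerForm_eq (u v : C3) : kahlerForm u v =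
    (u 0).re * (v 0).im - (u 0).im * (v 0).re + ((u 1).re * (v 1).im - (u 1).im * (v 1).re) +
      ((u 2).re * (v 2).im - (u 2).im * (v 2).re) := by
  simp [kahlerForm, Fin.sum_univ_three]
  ring

@[simp] lemma crossC_zero' (u v : C3) :
    crossC u v 0 = (starRingEnd ℂ) (u 1 * v 2 - u 2 * v 1) := rfl

@[simp] lemma crossC_one' (u v : C3) :
    crossC u v 1 = (starRingEnd ℂ) (u 2 * v 0 - u 0 * v 2) := rfl

@[simp] lemma crossC_two' (u v : C3) :
    crossC u v 2 = (starRingEnd ℂ) (u 0 * v 1 - u 1 * v 0) := rfl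

lemma C3.ext {u v : C3} (h0 : u 0 = v 0) (h1 : u 1 = v 1) (h2 : u 2 = v 2) : u = v := by
  ext i
  fin_cases i <;> assumption

lemma inner_crossC (u v w : C3) : inner ℝ (crossC u v) w = reOmega u v w := by
  rw [inner_C3, reOmega, Matrix.det_fin_three]
  simp
  ring

lemma reOmega_cyclic (u v w : C3) : reOmega u v w = reOmega v w u := by
  rw [reOmega, reOmega, Matrix.det_fin_three, Matrix.det_fin_three]
  simp
  ring

lemma crossC_swap (u v : C3) : crossC v u = -crossC u v := by
  apply C3.ext <;> simp [mul_comm]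

lemma crossC_self (u : C3) : crossC u u = 0 := by
  apply C3.ext <;> simp [mul_comm]

/-- The cross product as a continuous real bilinear map. -/
def crossB : C3 →L[ℝ] C3 →L[ℝ] C3 :=
  LinearMap.toContinuousBilinearMap (LinearMap.mk₂ ℝ crossC
    (fun u u' v => by apply C3.ext <;> simp <;> ring)
    (fun c u v => by apply C3.ext <;> simp [Complex.real_smul] <;> ring)
    (fun u v v' => by apply C3.ext <;> simp <;> ring)
    (fun c u v => by apply C3.ext <;> simp [Complex.real_smul] <;> ring))

@[simp] lemma crossB_apply (u v : C3) : crossB u v = crossC u v := rfl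

/-- The Kähler form as a continuous real bilinear map. -/
def kahlerB : C3 →L[ℝ] C3 →L[ℝ] ℝ :=
  LinearMap.toContinuousBilinearMap (LinearMap.mk₂ ℝ kahlerForm
    (fun u u' v => by simp [kahlerForm_eq]; ring)
    (fun c u v => by simp [kahlerForm_eq]; ring)
    (fun u v v' => by simp [kahlerForm_eq]; ring)
    (fun c u v => by simp [kahlerForm_eq]; ring))

@[simp] lemma kahlerB_apply (u v : C3) : kahlerB u v = kahlerForm u v := rfl

lemma kahlerForm_swap (u v : C3) : kahlerForm v u = -kahlerForm u v := by
  rw [kahlerForm_eq, kahlerForm_eq]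
  ring

lemma kahlerForm_self (u : C3) : kahlerForm u u = 0 := by
  rw [kahlerForm_eq]
  ring

lemma norm_sq_C3 (u : C3) : ‖u‖ ^ 2 = (u 0).re ^ 2 + (u 0).im ^ 2 + ((u 1).re ^ 2 + (u 1).im ^ 2) +
    ((u 2).re ^ 2 + (u 2).im ^ 2) := by
  rw [← real_inner_self_eq_norm_sq, inner_C3]
  ring

/-- For a unit vector `u` and `v` with `⟨u, v⟩ = ω(u, v) = 0` this says that `u ×` squares to `-1`,
the source of the complex structure. -/
lemma crossC_crossC (u v : C3) : crossC u (crossC u v) =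
    ((inner ℝ u v : ℂ) + kahlerForm u v * Complex.I) • u - (‖u‖ ^ 2 : ℝ) • v := by
  rw [norm_sq_C3, inner_C3, kahlerForm_eq]
  simp only [pow_two]
  apply C3.ext <;> simp <;> apply Complex.ext <;> simp <;> ring

lemma norm_sq_crossC (u v : C3) :
    ‖crossC u v‖ ^ 2 = ‖u‖ ^ 2 * ‖v‖ ^ 2 - inner ℝ u v ^ 2 - kahlerForm u v ^ 2 := by
  rw [norm_sq_C3, norm_sq_C3, norm_sq_C3, inner_C3, kahlerForm_eq]
  simp
  ring

lemma inner_crossC_left (u v : C3) : inner ℝ u (crossC u v) = 0 := by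
  rw [inner_C3]
  simp
  ring

lemma inner_crossC_right (u v : C3) : inner ℝ v (crossC u v) = 0 := by
  rw [inner_C3]
  simp
  ring

lemma kahlerForm_crossC_left (u v : C3) : kahlerForm u (crossC u v) = 0 := by
  rw [kahlerForm_eq]
  simp
  ring

end Algebra

namespace IsSpecialLagrangianPlane

variable {V : Submodule ℝ C3}

/-- The equality case of the calibration inequality: the hypotheses give `‖u × v - w‖² = -ω(u,v)²`,
so both sides vanish. -/
lemma crossC_eq_and_kahlerForm_eq_zero {u v w : C3} (hu : ‖u‖ = 1) (hv : ‖v‖ = 1) (hw : ‖w‖ = 1) (huv : inner ℝ u v = 0)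
    (h : reOmega u v w = 1) : crossC u v = w ∧ kahlerForm u v = 0 := by
  have h1 := norm_sq_crossC u v
  rw [hu, hv, huv] at h1
  rw [← inner_crossC] at h
  have h2 : ‖crossC u v - w‖ ^ 2 = -kahlerForm u v ^ 2 := by
    rw [norm_sub_sq_real, h1, h, hw]
    ring
  have h3 : kahlerForm u v ^ 2 = 0 := by
    nlinarith [sq_nonneg ‖crossC u v - w‖, sq_nonneg (kahlerForm u v)]
  rw [h3, neg_zero, sq_eq_zero_iff, norm_eq_zero, sub_eq_zero] at h2
  exact ⟨h2, by simpa using h3⟩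

/-- `Re Ω` is cyclically symmetric, so the equality case applies to each consecutive pair of the
basis; bilinearity later carries both facts to the whole plane. -/
lemma exists_basis (hV : IsSpecialLagrangianPlane V) : ∃ b : Fin 3 → C3, Orthonormal ℝ b ∧
    Submodule.span ℝ (Set.range b) = V ∧ ∀ i j, crossC (b i) (b j) ∈ V ∧
      kahlerForm (b i) (b j) = 0 := by
  obtain ⟨b, hb, hspan, h⟩ := hV
  refine ⟨b, hb, hspan, ?_⟩
  have hmem : ∀ i, b i ∈ V := fun i => hspan ▸ Submodule.subset_span ⟨i, rfl⟩
  have h01 := crossC_eq_and_kahlerForm_eq_zero (hb.1 0) (hb.1 1) (hb.1 2) (hb.2 (by decide)) h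
  rw [reOmega_cyclic] at h
  have h12 := crossC_eq_and_kahlerForm_eq_zero (hb.1 1) (hb.1 2) (hb.1 0) (hb.2 (by decide)) h
  rw [reOmega_cyclic] at h
  have h20 := crossC_eq_and_kahlerForm_eq_zero (hb.1 2) (hb.1 0) (hb.1 1) (hb.2 (by decide)) h
  have hlt : ∀ i j : Fin 3, i = j ∨ (crossC (b i) (b j) ∈ V ∧ kahlerForm (b i) (b j) = 0) ∨
      (crossC (b j) (b i) ∈ V ∧ kahlerForm (b j) (b i) = 0) := by
    intro i j
    fin_cases i <;> fin_cases j <;>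
      simp [h01.1, h12.1, h20.1, h01.2, h12.2, h20.2, hmem]
  intro i j
  rcases hlt i j with rfl | h | h
  · rw [crossC_self, kahlerForm_self]
    exact ⟨V.zero_mem, rfl⟩
  · exact h
  · rw [crossC_swap, kahlerForm_swap, h.2, neg_zero]
    exact ⟨V.neg_mem h.1, rfl⟩

lemma crossC_mem (hV : IsSpecialLagrangianPlane V) {u v : C3} (hu : u ∈ V) (hv : v ∈ V) :
    crossC u v ∈ V := by
  obtain ⟨b, -, hspan, hb⟩ := hV.exists_basis
  rw [← crossB_apply]
  have h1 : ∀ i, ∀ v ∈ V, crossB (b i) v ∈ V := by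
    intro i
    have : V ≤ V.comap (crossB (b i)).toLinearMap := by
      conv_lhs => rw [← hspan]
      rw [Submodule.span_le]
      rintro _ ⟨j, rfl⟩
      exact (hb i j).1
    exact this
  have : V ≤ V.comap (crossB.flip v).toLinearMap := by
    conv_lhs => rw [← hspan]
    rw [Submodule.span_le]
    rintro _ ⟨i, rfl⟩
    exact h1 i v hv
  exact this hu

lemma kahlerForm_eq_zero (hV : IsSpecialLagrangianPlane V) {u v : C3} (hu : u ∈ V) (hv : v ∈ V) :
    kahlerForm u v = 0 := by
  obtain ⟨b, -, hspan, hb⟩ := hV.exists_basis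
  rw [← kahlerB_apply]
  have h1 : ∀ i, ∀ v ∈ V, kahlerB (b i) v = 0 := by
    intro i
    have : V ≤ LinearMap.ker (kahlerB (b i)).toLinearMap := by
      conv_lhs => rw [← hspan]
      rw [Submodule.span_le]
      rintro _ ⟨j, rfl⟩
      exact (hb i j).2
    exact this
  have : V ≤ LinearMap.ker (kahlerB.flip v).toLinearMap := by
    conv_lhs => rw [← hspan]
    rw [Submodule.span_le]
    rintro _ ⟨i, rfl⟩
    exact h1 i v hv
  exact this hu

lemma finrank_eq (hV : IsSpecialLagrangianPlane V) : Module.finrank ℝ V = 3 := by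
  obtain ⟨b, hb, hspan, -⟩ := hV
  rw [← hspan, finrank_span_eq_card hb.linearIndependent, Fintype.card_fin]

lemma norm_crossC (hV : IsSpecialLagrangianPlane V) {u p : C3} (hu : u ∈ V) (hu1 : ‖u‖ = 1)
    (hp : p ∈ V) (hup : inner ℝ u p = 0) : ‖crossC u p‖ = ‖p‖ := by
  have h := norm_sq_crossC u p
  rw [hu1, hup, hV.kahlerForm_eq_zero hu hp] at h
  have h2 : ‖crossC u p‖ ^ 2 = ‖p‖ ^ 2 := by rw [h]; ring
  exact (pow_left_inj₀ (norm_nonneg _) (norm_nonneg _) two_ne_zero).1 h2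

lemma crossC_crossC_eq (hV : IsSpecialLagrangianPlane V) {u p : C3} (hu : u ∈ V) (hu1 : ‖u‖ = 1)
    (hp : p ∈ V) (hup : inner ℝ u p = 0) : crossC u (crossC u p) = -p := by
  rw [crossC_crossC, hup, hV.kahlerForm_eq_zero hu hp, hu1]
  simp

/-- A special Lagrangian plane is spanned by `u`, `p` and `u × p`. -/
lemma exists_eq (hV : IsSpecialLagrangianPlane V) {u p q : C3} (hu : u ∈ V) (hu1 : ‖u‖ = 1)
    (hp : p ∈ V) (hup : inner ℝ u p = 0) (hp0 : p ≠ 0) (hq : q ∈ V) :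
    ∃ x y z : ℝ, q = x • u + y • p + z • crossC u p := by
  set b : Fin 3 → C3 := ![u, p, crossC u p] with hb
  have hli : LinearIndependent ℝ b := by
    refine linearIndependent_of_ne_zero_of_inner_eq_zero (𝕜 := ℝ) ?_ ?_
    · have h3 : crossC u p ≠ 0 := by
        rw [← norm_ne_zero_iff, hV.norm_crossC hu hu1 hp hup]
        exact norm_ne_zero_iff.2 hp0
      have h1 : u ≠ 0 := by
        rw [← norm_ne_zero_iff, hu1]
        exact one_ne_zero
      intro i
      fin_cases i
      exacts [h1, hp0, h3]
    · have h1 := inner_crossC_left u p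
      have h2 := inner_crossC_right u p
      intro i j hij
      fin_cases i <;> fin_cases j <;>
        first
        | exact absurd rfl hij
        | simpa [hb] using hup
        | simpa [hb, real_inner_comm] using hup
        | simpa [hb] using h1
        | simpa [hb, real_inner_comm] using h1
        | simpa [hb] using h2
        | simpa [hb, real_inner_comm] using h2
  have hspan : Submodule.span ℝ (Set.range b) = V := by
    refine Submodule.eq_of_le_of_finrank_eq ?_ ?_
    · rw [Submodule.span_le]
      rintro _ ⟨i, rfl⟩
      fin_cases i
      exacts [hu, hp, hV.crossC_mem hu hp]
    · rw [finrank_span_eq_card hli, Fintype.card_fin, hV.finrank_eq]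
  rw [← hspan, Submodule.mem_span_range_iff_exists_fun] at hq
  obtain ⟨c, hc⟩ := hq
  exact ⟨c 0, c 1, c 2, by rw [← hc, Fin.sum_univ_three]; rfl⟩

/-- Conformality in a special Lagrangian plane. -/
lemma conformal_iff (hV : IsSpecialLagrangianPlane V) {u p q : C3} (hu : u ∈ V) (hu1 : ‖u‖ = 1)
    (hp : p ∈ V) (hq : q ∈ V) (hup : inner ℝ u p = 0) (huq : inner ℝ u q = 0) (hp0 : p ≠ 0) :
    (‖p‖ = ‖q‖ ∧ inner ℝ p q = 0 ∧ 0 < reOmega u p q) ↔ q = crossC u p := by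
  have hpp : 0 < ‖p‖ ^ 2 := by positivity
  have hnc := hV.norm_crossC hu hu1 hp hup
  constructor
  · rintro ⟨h1, h2, h3⟩
    obtain ⟨x, y, z, rfl⟩ := hV.exists_eq hu hu1 hp hup hp0 hq
    simp only [inner_add_right, inner_smul_right, hup, inner_crossC_left, inner_crossC_right,
      real_inner_self_eq_norm_sq, hu1, mul_zero, add_zero, one_pow, mul_one] at huq h2
    rw [real_inner_comm, hup, mul_zero, zero_add] at h2
    have hy : y = 0 := (mul_eq_zero.1 h2).resolve_right hpp.ne'
    subst hy huq
    simp only [zero_smul, zero_add] at h1 h3 ⊢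
    rw [← inner_crossC, inner_smul_right, real_inner_self_eq_norm_sq, hnc] at h3
    have hz : 0 < z := pos_of_mul_pos_left h3 hpp.le
    rw [norm_smul, hnc, Real.norm_of_nonneg hz.le] at h1
    have hz1 : z = 1 := by
      have : 0 < ‖p‖ := norm_pos_iff.2 hp0
      nlinarith
    rw [hz1, one_smul]
  · rintro rfl
    refine ⟨hnc.symm, inner_crossC_right u p, ?_⟩
    rw [← inner_crossC, real_inner_self_eq_norm_sq, hnc]
    exact hpp

end IsSpecialLagrangianPlane

/-- A unit vector `F` and a vector `X` which is Lagrangian with respect to it and independent of it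
span a special Lagrangian plane together with `F × X`, up to multiples of `F`. -/
lemma isSpecialLagrangianPlane_span {F X Y : C3} (hF : ‖F‖ = 1) (hω : kahlerForm F X = 0)
    {c : ℝ} (hY : Y = crossC F X + c • F) (hX : ∀ a : ℝ, X ≠ a • F) {V : Submodule ℝ C3}
    (hV : V = Submodule.span ℝ {F, X, Y}) : IsSpecialLagrangianPlane V := by
  set a := inner ℝ F X with ha
  -- A Gram-Schmidt step: subtracting a multiple of `F` changes neither `F × X` nor `ω(F, X)`.
  set X' := X - a • F with hX'
  have hX0 : X' ≠ 0 := sub_ne_zero.2 (hX a)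
  have hn : 0 < ‖X'‖ := norm_pos_iff.2 hX0
  have hin : inner ℝ F X' = 0 := by
    rw [hX', inner_sub_right, inner_smul_right, real_inner_self_eq_norm_sq, hF, ← ha]
    ring
  have hcr : crossC F X' = crossC F X := by
    rw [← crossB_apply, hX', map_sub, map_smul, crossB_apply, crossB_apply, crossC_self]
    simp
  have hω' : kahlerForm F X' = 0 := by
    rw [← kahlerB_apply, hX', map_sub, map_smul, kahlerB_apply, kahlerB_apply, hω, kahlerForm_self]
    simp
  have hnc : ‖crossC F X'‖ = ‖X'‖ := by
    have h := norm_sq_crossC F X'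
    rw [hF, hin, hω'] at h
    have h2 : ‖crossC F X'‖ ^ 2 = ‖X'‖ ^ 2 := by rw [h]; ring
    exact (pow_left_inj₀ (norm_nonneg _) (norm_nonneg _) two_ne_zero).1 h2
  set n := ‖X'‖⁻¹ with hn'
  have hn0 : n ≠ 0 := inv_ne_zero hn.ne'
  have hnn : n * ‖X'‖ = 1 := inv_mul_cancel₀ hn.ne'
  refine ⟨![F, n • X', n • crossC F X'], ?_, ?_, ?_⟩
  · have h1 := inner_crossC_left F X'
    have h2 := inner_crossC_right F X'
    have h1' := h1
    have h2' := h2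
    have hin' := hin
    rw [real_inner_comm] at h1' h2' hin'
    constructor
    · intro i
      have hnpos : 0 ≤ n := by positivity
      fin_cases i
      · exact hF
      · change ‖n • X'‖ = 1
        rw [norm_smul, Real.norm_of_nonneg hnpos, hnn]
      · change ‖n • crossC F X'‖ = 1
        rw [norm_smul, Real.norm_of_nonneg hnpos, hnc, hnn]
    · intro i j hij
      fin_cases i <;> fin_cases j <;>
        first
        | exact absurd rfl hij
        | simp [inner_smul_left, inner_smul_right, hin, h1, h2, hin', h1', h2']
  · rw [hV]
    have hXeq : X = X' + a • F := by rw [hX']; abel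
    apply le_antisymm
    · rw [Submodule.span_le]
      have hFm : F ∈ Submodule.span ℝ {F, X, Y} := Submodule.subset_span (by simp)
      have hXm : X ∈ Submodule.span ℝ {F, X, Y} := Submodule.subset_span (by simp)
      have hYm : Y ∈ Submodule.span ℝ {F, X, Y} := Submodule.subset_span (by simp)
      rintro _ ⟨i, rfl⟩
      fin_cases i
      · exact hFm
      · exact Submodule.smul_mem _ _ (Submodule.sub_mem _ hXm (Submodule.smul_mem _ _ hFm))
      · refine Submodule.smul_mem _ _ ?_
        have : crossC F X' = Y - c • F := by rw [hcr, hY]; abel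
        rw [this]
        exact Submodule.sub_mem _ hYm (Submodule.smul_mem _ _ hFm)
    · set W := Submodule.span ℝ (Set.range ![F, n • X', n • crossC F X']) with hW
      have hFm : F ∈ W := Submodule.subset_span ⟨0, rfl⟩
      have h1m : n • X' ∈ W := Submodule.subset_span ⟨1, rfl⟩
      have h2m : n • crossC F X' ∈ W := Submodule.subset_span ⟨2, rfl⟩
      rw [Submodule.smul_mem_iff _ hn0] at h1m h2m
      rw [Submodule.span_le]
      rintro x (rfl | rfl | rfl)
      · exact hFm
      · rw [hXeq]
        exact W.add_mem h1m (W.smul_mem _ hFm)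
      · rw [hY, ← hcr]
        exact W.add_mem h2m (W.smul_mem _ hFm)
  · simp only [Matrix.cons_val_zero, Matrix.cons_val_one, Matrix.cons_val]
    rw [← inner_crossC, ← crossB_apply, map_smul, crossB_apply, inner_smul_left, inner_smul_right,
      real_inner_self_eq_norm_sq, hnc]
    simp only [conj_trivial]
    calc n * (n * ‖X'‖ ^ 2) = (n * ‖X'‖) ^ 2 := by ring
      _ = 1 := by rw [hnn, one_pow]

end

/-! ### Conformal patches and their Laplacian. -/

noncomputable section
open Topology

/-- A parametrized surface `F : U → S⁵` in oriented conformal coordinates that spans a special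
Lagrangian cone. -/
structure IsConformalPatch (F : ℂ → C3) (U : Set ℂ) : Prop where
  isOpen : IsOpen U
  contDiffOn : ContDiffOn ℝ ∞ F U
  norm_eq_one : ∀ z ∈ U, ‖F z‖ = 1
  ne_zero : ∀ z ∈ U, fderiv ℝ F z 1 ≠ 0
  kahler : ∀ z ∈ U, kahlerForm (F z) (fderiv ℝ F z 1) = 0
  eq_cross : ∀ z ∈ U, fderiv ℝ F z Complex.I = crossC (F z) (fderiv ℝ F z 1)

lemma inner_fderiv_eq_zero {E : Type*} [NormedAddCommGroup E] [NormedSpace ℝ E] {F : E → C3}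
    {U : Set E} (hU : IsOpen U)
    (hF : ∀ z ∈ U, ‖F z‖ = 1) {z : E} (hz : z ∈ U) (hd : DifferentiableAt ℝ F z) (v : E) :
    inner ℝ (F z) (fderiv ℝ F z v) = 0 := by
  have h1 : (fun y => inner ℝ (F y) (F y)) =ᶠ[𝓝 z] fun _ => (1 : ℝ) := by
    filter_upwards [hU.mem_nhds hz] with y hy
    rw [real_inner_self_eq_norm_sq, hF y hy, one_pow]
  have h2 := h1.fderiv_eq (𝕜 := ℝ)
  have h3 := congrArg (fun L => L v) h2
  simp only [fderiv_inner_apply ℝ hd hd, fderiv_const_apply, zero_apply] at h3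
  rw [real_inner_comm] at h3
  rw [real_inner_comm]
  linarith

namespace IsConformalPatch

variable {F : ℂ → C3} {U : Set ℂ} {z : ℂ}

lemma contDiffAt (h : IsConformalPatch F U) (hz : z ∈ U) : ContDiffAt ℝ ∞ F z :=
  h.contDiffOn.contDiffAt (h.isOpen.mem_nhds hz)

lemma differentiableAt (h : IsConformalPatch F U) (hz : z ∈ U) : DifferentiableAt ℝ F z :=
  (h.contDiffAt hz).differentiableAt (by simp)

lemma differentiableAt_fderiv (h : IsConformalPatch F U) (hz : z ∈ U) :
    DifferentiableAt ℝ (fderiv ℝ F) z :=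
  ((h.contDiffAt hz).fderiv_right (m := 1) (by norm_cast)).differentiableAt (by simp)

lemma hasFDerivAt_apply (h : IsConformalPatch F U) (hz : z ∈ U) (v : ℂ) :
    HasFDerivAt (fun y => fderiv ℝ F y v) ((fderiv ℝ (fderiv ℝ F) z).flip v) z :=
  ((ContinuousLinearMap.apply ℝ C3 v).hasFDerivAt.comp z (h.differentiableAt_fderiv hz).hasFDerivAt)

lemma snd_symm (h : IsConformalPatch F U) (hz : z ∈ U) (v w : ℂ) :
    fderiv ℝ (fderiv ℝ F) z v w = fderiv ℝ (fderiv ℝ F) z w v :=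
  ((h.contDiffAt hz).isSymmSndFDerivAt (by simp; norm_cast)) v w

lemma inner_eq_zero (h : IsConformalPatch F U) (hz : z ∈ U) (v : ℂ) :
    inner ℝ (F z) (fderiv ℝ F z v) = 0 :=
  inner_fderiv_eq_zero h.isOpen h.norm_eq_one hz (h.differentiableAt hz) v

lemma fderiv_eq (h : IsConformalPatch F U) (hz : z ∈ U) (v : ℂ) :
    fderiv ℝ F z v = v.re • fderiv ℝ F z 1 + v.im • crossC (F z) (fderiv ℝ F z 1) := by
  conv_lhs => rw [show v = v.re • (1 : ℂ) + v.im • Complex.I by simp [Complex.re_add_im]]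
  rw [map_add, map_smul, map_smul, h.eq_cross z hz]

lemma kahler_eq_zero (h : IsConformalPatch F U) (hz : z ∈ U) (v : ℂ) :
    kahlerForm (F z) (fderiv ℝ F z v) = 0 := by
  rw [h.fderiv_eq hz, ← kahlerB_apply, map_add, map_smul, map_smul, kahlerB_apply, kahlerB_apply,
    h.kahler z hz, kahlerForm_crossC_left]
  simp

lemma crossC_crossC_fderiv (h : IsConformalPatch F U) (hz : z ∈ U) (v : ℂ) :
    crossC (F z) (crossC (F z) (fderiv ℝ F z v)) = -fderiv ℝ F z v := by
  rw [crossC_crossC, h.inner_eq_zero hz, h.kahler_eq_zero hz, h.norm_eq_one z hz]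
  simp

lemma fderiv_I_mul (h : IsConformalPatch F U) (hz : z ∈ U) (v : ℂ) :
    fderiv ℝ F z (Complex.I * v) = crossC (F z) (fderiv ℝ F z v) := by
  rw [h.fderiv_eq hz (Complex.I * v), h.fderiv_eq hz v]
  simp only [← crossB_apply, map_add, map_smul]
  simp only [crossB_apply, h.crossC_crossC_fderiv hz]
  simp
  abel

lemma snd_I (h : IsConformalPatch F U) (hz : z ∈ U) (v : ℂ) :
    fderiv ℝ (fderiv ℝ F) z v Complex.I = crossC (fderiv ℝ F z v) (fderiv ℝ F z 1) +
      crossC (F z) (fderiv ℝ (fderiv ℝ F) z v 1) := by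
  have h1 : (fun y => fderiv ℝ F y Complex.I) =ᶠ[𝓝 z] fun y => crossB (F y) (fderiv ℝ F y 1) := by
    filter_upwards [h.isOpen.mem_nhds hz] with y hy using h.eq_cross y hy
  have h2 := (crossB.hasFDerivAt_of_bilinear (h.differentiableAt hz).hasFDerivAt
    (h.hasFDerivAt_apply hz 1)).congr_of_eventuallyEq h1
  have h3 := congrArg (fun L => L v) (h2.unique (h.hasFDerivAt_apply hz Complex.I))
  simp at h3
  rw [← h3, add_comm]

lemma inner_snd (h : IsConformalPatch F U) (hz : z ∈ U) (v w : ℂ) :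
    inner ℝ (F z) (fderiv ℝ (fderiv ℝ F) z w v) = -inner ℝ (fderiv ℝ F z w) (fderiv ℝ F z v) := by
  have h1 : (fun y => inner ℝ (F y) (fderiv ℝ F y v)) =ᶠ[𝓝 z] fun _ => (0 : ℝ) := by
    filter_upwards [h.isOpen.mem_nhds hz] with y hy using h.inner_eq_zero hy v
  have h3 := congrArg (fun L => L w) (h1.fderiv_eq (𝕜 := ℝ))
  have hd := h.hasFDerivAt_apply hz v
  simp only [fderiv_inner_apply ℝ (h.differentiableAt hz) hd.differentiableAt, hd.fderiv,
    fderiv_const_apply, zero_apply, ContinuousLinearMap.flip_apply] at h3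
  linarith

lemma kahler_snd (h : IsConformalPatch F U) (hz : z ∈ U) (v w : ℂ) :
    kahlerForm (F z) (fderiv ℝ (fderiv ℝ F) z w v) =
      -kahlerForm (fderiv ℝ F z w) (fderiv ℝ F z v) := by
  have h1 : (fun y => kahlerB (F y) (fderiv ℝ F y v)) =ᶠ[𝓝 z] fun _ => (0 : ℝ) := by
    filter_upwards [h.isOpen.mem_nhds hz] with y hy using h.kahler_eq_zero hy v
  have h2 := (kahlerB.hasFDerivAt_of_bilinear (h.differentiableAt hz).hasFDerivAt
    (h.hasFDerivAt_apply hz v)).fderiv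
  rw [h1.fderiv_eq] at h2
  have h3 := congrArg (fun L => L w) h2
  simp at h3
  linarith

/-- The Laplacian of a conformally parametrized link. -/
lemma laplacian (h : IsConformalPatch F U) (hz : z ∈ U) :
    fderiv ℝ (fderiv ℝ F) z 1 1 + fderiv ℝ (fderiv ℝ F) z Complex.I Complex.I =
      (2 : ℝ) • crossC (fderiv ℝ F z Complex.I) (fderiv ℝ F z 1) := by
  have h1 := h.inner_eq_zero hz 1
  rw [real_inner_comm] at h1
  have h2 : crossC (fderiv ℝ F z Complex.I) (fderiv ℝ F z 1) = -(‖fderiv ℝ F z 1‖ ^ 2) • F z := by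
    rw [h.eq_cross z hz, crossC_swap (fderiv ℝ F z 1), crossC_swap (fderiv ℝ F z 1) (F z), ← crossB_apply, map_neg,
      neg_neg, crossB_apply, crossC_crossC, h1, kahlerForm_swap, h.kahler z hz]
    simp
  -- Differentiating `F_t = F × F_s` gives `F_st = F × F_ss` and `F_tt = F_t × F_s + F × F_st`. By
  -- the triple product `F × (F × F_ss) = -F_ss - ‖F_s‖² F`, and the last term is `F_t × F_s` once
  -- more.
  rw [h.snd_I hz, h.snd_symm hz Complex.I 1, h.snd_I hz 1, crossC_self, zero_add, crossC_crossC,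
    h.inner_snd hz, h.kahler_snd hz, kahlerForm_self, h.norm_eq_one z hz,
    real_inner_self_eq_norm_sq, h2]
  simp [two_smul]
  norm_cast
  abel

end IsConformalPatch

end

/-! ### Conformal patches are real analytic. -/

noncomputable section
open Topology ComplexConjugate

/-- Sesquilinear expressions in finitely many complex variables. -/
def IsSesquilinear {ι : Type*} [Fintype ι] (g : (ι → ℂ) → ℂ) : Prop :=
  ∃ c : ι → ι → ℂ, ∀ w, g w = ∑ j, ∑ k, c j k * (conj (w j) * w k)

namespace IsSesquilinear

variable {ι : Type*} [Fintype ι] {f g : (ι → ℂ) → ℂ}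

lemma mul_apply [DecidableEq ι] (j k : ι) :
    IsSesquilinear fun w : ι → ℂ => conj (w j) * w k :=
  ⟨fun a b => if a = j then (if b = k then 1 else 0) else 0, fun w => by simp⟩

lemma sub (hf : IsSesquilinear f) (hg : IsSesquilinear g) :
    IsSesquilinear fun w => f w - g w := by
  obtain ⟨c, hc⟩ := hf
  obtain ⟨d, hd⟩ := hg
  refine ⟨fun j k => c j k - d j k, fun w => ?_⟩
  simp only [hc, hd, sub_mul, Finset.sum_sub_distrib]

lemma const_mul (a : ℂ) (hf : IsSesquilinear f) : IsSesquilinear fun w => a * f w := by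
  obtain ⟨c, hc⟩ := hf
  refine ⟨fun j k => a * c j k, fun w => ?_⟩
  simp only [hc, Finset.mul_sum, mul_assoc]

lemma zero : IsSesquilinear fun _ : ι → ℂ => (0 : ℂ) := ⟨0, fun w => by simp⟩

end IsSesquilinear

lemma analyticAt_of_dbar_eq_sesquilinear {ι : Type*} [Fintype ι] {g : ι → (ι → ℂ) → ℂ}
    (hg : ∀ i, IsSesquilinear (g i)) {W : ι → ℂ → ℂ} {U : Set ℂ} (hU : IsOpen U)
    (hW : ∀ i, ContDiffOn ℝ ∞ (W i) U)
    (heq : ∀ i, ∀ z ∈ U, dbar (W i) z = g i fun j => W j z) {z : ℂ} (hz : z ∈ U) (i : ι) :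
    AnalyticAt ℝ (W i) z := by
  choose c hc using hg
  obtain ⟨ρ, hρ, hball⟩ := Metric.isOpen_iff.1 hU z hz
  have hmem : ∀ y ∈ Metric.ball (0 : ℂ) ρ, z + y ∈ U := fun y hy => hball (by simpa using hy)
  have h := analyticAt_of_dbar_eq (c := c) (W := fun i y => W i (z + y)) hρ
    (fun i => (hW i).comp (by fun_prop) hmem)
    (fun i y hy => by
      rw [← hc i, ← heq i _ (hmem y hy), dbar, dbar, fderiv_comp_add_left]) i
  have h2 : AnalyticAt ℝ (fun y : ℂ => y - z) z := by fun_prop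
  have h3 := AnalyticAt.fun_comp (g := fun y => W i (z + y)) (f := fun y : ℂ => y - z) (x := z)
    (by simpa using h) h2
  simpa using h3

lemma dbar_conj {f : ℂ → ℂ} {z : ℂ} (hf : DifferentiableAt ℝ f z) :
    dbar (fun y => conj (f y)) z = conj (del f z) := by
  have h := (Complex.conjCLE.toContinuousLinearMap.hasFDerivAt.comp z hf.hasFDerivAt).fderiv
  have h' : fderiv ℝ (fun y => conj (f y)) z =
    Complex.conjCLE.toContinuousLinearMap.comp (fderiv ℝ f z) := h
  rw [dbar, del, h']
  simp [map_ofNat]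

namespace IsConformalPatch

variable {F : ℂ → C3} {U : Set ℂ} {z : ℂ}

lemma hasFDerivAt_coord {G : ℂ → C3} {G' : ℂ →L[ℝ] C3} (hG : HasFDerivAt G G' z) (j : Fin 3) :
    HasFDerivAt (fun y => G y j)
      (((EuclideanSpace.proj (𝕜 := ℂ) j).restrictScalars ℝ : C3 →L[ℝ] ℂ).comp G') z :=
  ((EuclideanSpace.proj (𝕜 := ℂ) j).restrictScalars ℝ : C3 →L[ℝ] ℂ).hasFDerivAt.comp z hG

/-- The holomorphic derivatives of the coordinates. -/
def delCoord (F : ℂ → C3) (j : Fin 3) (z : ℂ) : ℂ :=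
  (fderiv ℝ F z 1 j - Complex.I * fderiv ℝ F z Complex.I j) / 2

/-- The antiholomorphic derivatives of the coordinates. -/
def dbarCoord (F : ℂ → C3) (j : Fin 3) (z : ℂ) : ℂ :=
  (fderiv ℝ F z 1 j + Complex.I * fderiv ℝ F z Complex.I j) / 2

lemma hasFDerivAt_delCoord (h : IsConformalPatch F U) (hz : z ∈ U) (j : Fin 3) (v : ℂ) :
    DifferentiableAt ℝ (delCoord F j) z ∧ fderiv ℝ (delCoord F j) z v =
      (fderiv ℝ (fderiv ℝ F) z v 1 j - Complex.I * fderiv ℝ (fderiv ℝ F) z v Complex.I j) / 2 := by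
  have h1 := hasFDerivAt_coord (h.hasFDerivAt_apply hz 1) j
  have h2 := hasFDerivAt_coord (h.hasFDerivAt_apply hz Complex.I) j
  have h3 := (h1.sub (h2.const_mul Complex.I)).mul_const (2⁻¹ : ℂ)
  have h4 : HasFDerivAt (delCoord F j) _ z := h3
  refine ⟨h4.differentiableAt, ?_⟩
  rw [h4.fderiv]
  simp
  ring

lemma hasFDerivAt_dbarCoord (h : IsConformalPatch F U) (hz : z ∈ U) (j : Fin 3) (v : ℂ) :
    DifferentiableAt ℝ (dbarCoord F j) z ∧ fderiv ℝ (dbarCoord F j) z v =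
      (fderiv ℝ (fderiv ℝ F) z v 1 j + Complex.I * fderiv ℝ (fderiv ℝ F) z v Complex.I j) / 2 := by
  have h1 := hasFDerivAt_coord (h.hasFDerivAt_apply hz 1) j
  have h2 := hasFDerivAt_coord (h.hasFDerivAt_apply hz Complex.I) j
  have h3 := (h1.add (h2.const_mul Complex.I)).mul_const (2⁻¹ : ℂ)
  have h4 : HasFDerivAt (dbarCoord F j) _ z := h3
  refine ⟨h4.differentiableAt, ?_⟩
  rw [h4.fderiv]
  simp
  ring

lemma coord_laplacian (h : IsConformalPatch F U) (hz : z ∈ U) (j : Fin 3) :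
    fderiv ℝ (fderiv ℝ F) z 1 1 j + fderiv ℝ (fderiv ℝ F) z Complex.I Complex.I j =
      2 * crossC (fderiv ℝ F z Complex.I) (fderiv ℝ F z 1) j := by
  have := congrArg (fun v : C3 => v j) (h.laplacian hz)
  simpa using this

lemma dbar_delCoord (h : IsConformalPatch F U) (hz : z ∈ U) (j : Fin 3) :
    dbar (delCoord F j) z = crossC (fderiv ℝ F z Complex.I) (fderiv ℝ F z 1) j / 2 := by
  have h1 := h.coord_laplacian hz j
  rw [dbar, (h.hasFDerivAt_delCoord hz j _).2, (h.hasFDerivAt_delCoord hz j _).2,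
    h.snd_symm hz Complex.I 1]
  linear_combination h1 / 4 - (fderiv ℝ (fderiv ℝ F) z Complex.I Complex.I j / 4) * Complex.I_sq

lemma del_dbarCoord (h : IsConformalPatch F U) (hz : z ∈ U) (j : Fin 3) :
    del (dbarCoord F j) z = crossC (fderiv ℝ F z Complex.I) (fderiv ℝ F z 1) j / 2 := by
  have h1 := h.coord_laplacian hz j
  rw [del, (h.hasFDerivAt_dbarCoord hz j _).2, (h.hasFDerivAt_dbarCoord hz j _).2,
    h.snd_symm hz Complex.I 1]
  linear_combination h1 / 4 - (fderiv ℝ (fderiv ℝ F) z Complex.I Complex.I j / 4) * Complex.I_sq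

/-- The unknowns of the elliptic system solved by a conformal patch. -/
def unknown (F : ℂ → C3) (i : Fin 4 × Fin 3) (z : ℂ) : ℂ :=
  -- The second family is conjugated because `∂̄ (conj (∂̄F)) = conj (∂ ∂̄F)`. The constant `1`
  -- makes the linear equation for `F` itself sesquilinear.
  ![delCoord F i.2 z, conj (dbarCoord F i.2 z), F z i.2, 1] i.1

/-- The right hand side of the elliptic system solved by a conformal patch. -/
def systemRHS (i : Fin 4 × Fin 3) (w : Fin 4 × Fin 3 → ℂ) : ℂ :=
  ![-Complex.I * (conj (w (0, i.2 + 1)) * w (1, i.2 + 2) - conj (w (0, i.2 + 2)) * w (1, i.2 + 1)),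
    Complex.I * (conj (w (1, i.2 + 2)) * w (0, i.2 + 1) - conj (w (1, i.2 + 1)) * w (0, i.2 + 2)),
    conj (w (1, i.2)) * w (3, 0), 0] i.1

lemma isSesquilinear_systemRHS (i : Fin 4 × Fin 3) : IsSesquilinear (systemRHS i) := by
  obtain ⟨a, j⟩ := i
  fin_cases a
  · exact ((IsSesquilinear.mul_apply _ _).sub (IsSesquilinear.mul_apply _ _)).const_mul _
  · exact ((IsSesquilinear.mul_apply _ _).sub (IsSesquilinear.mul_apply _ _)).const_mul _
  · exact IsSesquilinear.mul_apply _ _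
  · exact IsSesquilinear.zero

/-- The product conjugates both factors, so `∂ ∂̄F` is quadratic in `conj (∂F)` and `conj (∂̄F)`. In
the chosen unknowns one factor is conjugated and the other is not, as sesquilinearity requires. -/
lemma crossC_eq_del_dbar (F : ℂ → C3) (z : ℂ) (j : Fin 3) :
    crossC (fderiv ℝ F z Complex.I) (fderiv ℝ F z 1) j / 2 =
      -Complex.I * (conj (delCoord F (j + 1) z) * conj (dbarCoord F (j + 2) z) -
        conj (delCoord F (j + 2) z) * conj (dbarCoord F (j + 1) z)) := by
  have hI := Complex.I_sq
  have h2 : conj (2 : ℂ) = 2 := map_ofNat _ 2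
  fin_cases j <;> simp [delCoord, dbarCoord, h2] <;> grind

lemma dbar_unknown (h : IsConformalPatch F U) (hz : z ∈ U) (i : Fin 4 × Fin 3) :
    dbar (unknown F i) z = systemRHS i fun j => unknown F j z := by
  obtain ⟨a, j⟩ := i
  fin_cases a
  · exact (h.dbar_delCoord hz j).trans (crossC_eq_del_dbar F z j)
  · refine (dbar_conj (h.hasFDerivAt_dbarCoord hz j 1).1).trans ?_
    rw [h.del_dbarCoord hz j, crossC_eq_del_dbar F z j]
    simp [systemRHS, unknown]
    ring
  · have h1 := hasFDerivAt_coord (h.differentiableAt hz).hasFDerivAt j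
    have h2 : dbar (fun y => F y j) z = dbarCoord F j z := by
      rw [dbar, h1.fderiv]
      rfl
    refine h2.trans ?_
    simp [systemRHS, unknown]
  · have : dbar (fun _ => (1 : ℂ)) z = 0 := by
      rw [dbar]
      simp
    refine Eq.trans this ?_
    simp [systemRHS]

lemma contDiffOn_unknown (h : IsConformalPatch F U) (i : Fin 4 × Fin 3) :
    ContDiffOn ℝ ∞ (unknown F i) U := by
  intro z hz
  apply ContDiffAt.contDiffWithinAt
  have hF := h.contDiffAt hz
  have h1 : ContDiffAt ℝ ∞ (fderiv ℝ F) z := hF.fderiv_right (by norm_cast)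
  have hc : ∀ {G : ℂ → C3}, ContDiffAt ℝ ∞ G z → ∀ j, ContDiffAt ℝ ∞ (fun y => G y j) z :=
    fun hG j => ((EuclideanSpace.proj (𝕜 := ℂ) j).restrictScalars ℝ :
      C3 →L[ℝ] ℂ).contDiff.contDiffAt.comp z hG
  have h2 : ∀ v : ℂ, ContDiffAt ℝ ∞ (fun y => fderiv ℝ F y v) z := fun v =>
    (ContinuousLinearMap.apply ℝ C3 v).contDiff.contDiffAt.comp z h1
  obtain ⟨a, j⟩ := i
  fin_cases a
  · exact ((hc (h2 1) j).sub (contDiffAt_const.mul (hc (h2 Complex.I) j))).div_const _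
  · exact Complex.conjCLE.contDiff.contDiffAt.comp z
      (((hc (h2 1) j).add (contDiffAt_const.mul (hc (h2 Complex.I) j))).div_const _)
  · exact hc hF j
  · exact contDiffAt_const

/-- Conformal patches are real analytic. -/
theorem analyticAt (h : IsConformalPatch F U) (hz : z ∈ U) : AnalyticAt ℝ F z := by
  have h1 : ∀ j, AnalyticAt ℝ (fun y => F y j) z := fun j =>
    analyticAt_of_dbar_eq_sesquilinear isSesquilinear_systemRHS h.isOpen h.contDiffOn_unknown
      (fun i y hy => h.dbar_unknown hy i) hz ((2, j) : Fin 4 × Fin 3)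
  have h2 : AnalyticAt ℝ (fun y j => F y j) z := AnalyticAt.pi h1
  exact ((PiLp.continuousLinearEquiv 2 ℝ
    (fun _ : Fin 3 => ℂ)).symm.toContinuousLinearMap.analyticAt _).comp h2

end IsConformalPatch

end

/-! ### Patches of cones in arbitrary coordinates. -/

noncomputable section
open Topology ComplexConjugate

lemma exists_local_diffeomorphism {f : ℂ → ℂ} {s : Set ℂ} (hs : IsOpen s)
    (hf : ContDiffOn ℝ ∞ f s) (hinj : ∀ z ∈ s, Function.Injective (fderiv ℝ f z)) {a : ℂ}
    (ha : a ∈ s) : ∃ e : OpenPartialHomeomorph ℂ ℂ, a ∈ e.source ∧ e.source ⊆ s ∧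
      (∀ z, e z = f z) ∧ ContDiffOn ℝ ∞ e e.source ∧ ContDiffOn ℝ ∞ e.symm e.target := by
  have hat : ∀ z ∈ s, ContDiffAt ℝ ∞ f z := fun z hz => hf.contDiffAt (hs.mem_nhds hz)
  have hder : ∀ z ∈ s, ∃ L : ℂ ≃L[ℝ] ℂ, HasFDerivAt f (L : ℂ →L[ℝ] ℂ) z := by
    intro z hz
    exact ⟨(LinearEquiv.ofInjectiveEndo (fderiv ℝ f z).toLinearMap
      (hinj z hz)).toContinuousLinearEquiv, ((hat z hz).differentiableAt (by simp)).hasFDerivAt⟩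
  obtain ⟨L, hL⟩ := hder a ha
  set e := (hat a ha).toOpenPartialHomeomorph f hL (by simp)
  have hmem : a ∈ e.source := (hat a ha).mem_toOpenPartialHomeomorph_source hL (by simp)
  have he : ∀ z, (e.restr s) z = f z := fun z => rfl
  have hsrc : (e.restr s).source ⊆ s := by
    rw [e.restr_source, hs.interior_eq]
    exact Set.inter_subset_right
  refine ⟨e.restr s, ?_, hsrc, he, (hf.mono hsrc).congr fun z _ => he z, ?_⟩
  · rw [e.restr_source, hs.interior_eq]
    exact ⟨hmem, ha⟩
  · intro w hw
    have hz := (e.restr s).map_target hw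
    obtain ⟨L', hL'⟩ := hder _ (hsrc hz)
    exact ((e.restr s).contDiffAt_symm hw hL' (hat _ (hsrc hz))).contDiffWithinAt

lemma injective_fderiv_of_norm_dbar_lt {f : ℂ → ℂ} {z : ℂ} (h : ‖dbar f z‖ < ‖del f z‖) :
    Function.Injective (fderiv ℝ f z) := by
  rw [injective_iff_map_eq_zero]
  intro v hv
  rw [fderiv_eq_del_dbar] at hv
  by_contra hv0
  have h1 : ‖del f z * v‖ = ‖dbar f z * conj v‖ := by
    rw [eq_neg_of_add_eq_zero_left hv, norm_neg]
  rw [norm_mul, norm_mul, RCLike.norm_conj] at h1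
  exact h.ne' (mul_right_cancel₀ (norm_ne_zero_iff.2 hv0) h1)

/-- A parametrized surface `F : U → S⁵` that spans a special Lagrangian cone. -/
structure IsConePatch (F : ℂ → C3) (U : Set ℂ) : Prop where
  isOpen : IsOpen U
  contDiffOn : ContDiffOn ℝ ∞ F U
  norm_eq_one : ∀ z ∈ U, ‖F z‖ = 1
  injective : ∀ z ∈ U, Function.Injective (fderiv ℝ F z)
  plane : ∀ z ∈ U, ∃ V : Submodule ℝ C3, IsSpecialLagrangianPlane V ∧ F z ∈ V ∧
    ∀ v, fderiv ℝ F z v ∈ V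

namespace IsConePatch

variable {F : ℂ → C3} {U : Set ℂ} {z : ℂ}

lemma contDiffAt (h : IsConePatch F U) (hz : z ∈ U) : ContDiffAt ℝ ∞ F z :=
  h.contDiffOn.contDiffAt (h.isOpen.mem_nhds hz)

lemma differentiableAt (h : IsConePatch F U) (hz : z ∈ U) : DifferentiableAt ℝ F z :=
  (h.contDiffAt hz).differentiableAt (by simp)

lemma inner_eq_zero (h : IsConePatch F U) (hz : z ∈ U) (v : ℂ) :
    inner ℝ (F z) (fderiv ℝ F z v) = 0 :=
  inner_fderiv_eq_zero h.isOpen h.norm_eq_one hz (h.differentiableAt hz) v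

lemma fderiv_ne_zero (h : IsConePatch F U) (hz : z ∈ U) {v : ℂ} (hv : v ≠ 0) :
    fderiv ℝ F z v ≠ 0 := fun h0 => hv (h.injective z hz (by rw [h0, map_zero]))

lemma kahler_eq_zero (h : IsConePatch F U) (hz : z ∈ U) (v : ℂ) :
    kahlerForm (F z) (fderiv ℝ F z v) = 0 := by
  obtain ⟨V, hV, hF, hd⟩ := h.plane z hz
  exact hV.kahlerForm_eq_zero hF (hd v)

lemma crossC_crossC_fderiv (h : IsConePatch F U) (hz : z ∈ U) (v : ℂ) :
    crossC (F z) (crossC (F z) (fderiv ℝ F z v)) = -fderiv ℝ F z v := by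
  obtain ⟨V, hV, hF, hd⟩ := h.plane z hz
  exact hV.crossC_crossC_eq hF (h.norm_eq_one z hz) (hd v) (h.inner_eq_zero hz v)

/-- The conformality of the coordinates at a point. -/
lemma conformal_iff (h : IsConePatch F U) (hz : z ∈ U) :
    (‖fderiv ℝ F z 1‖ = ‖fderiv ℝ F z Complex.I‖ ∧
      inner ℝ (fderiv ℝ F z 1) (fderiv ℝ F z Complex.I) = 0 ∧
      0 < reOmega (F z) (fderiv ℝ F z 1) (fderiv ℝ F z Complex.I)) ↔
    fderiv ℝ F z Complex.I = crossC (F z) (fderiv ℝ F z 1) := by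
  obtain ⟨V, hV, hF, hd⟩ := h.plane z hz
  exact hV.conformal_iff hF (h.norm_eq_one z hz) (hd 1) (hd Complex.I) (h.inner_eq_zero hz _)
    (h.inner_eq_zero hz _) (h.fderiv_ne_zero hz one_ne_zero)

lemma isConformalPatch (h : IsConePatch F U)
    (hc : ∀ z ∈ U, fderiv ℝ F z Complex.I = crossC (F z) (fderiv ℝ F z 1)) :
    IsConformalPatch F U where
  isOpen := h.isOpen
  contDiffOn := h.contDiffOn
  norm_eq_one := h.norm_eq_one
  ne_zero _ hz := h.fderiv_ne_zero hz one_ne_zero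
  kahler _ hz := h.kahler_eq_zero hz 1
  eq_cross := hc

/-- Conformality may be tested on any nonzero tangent vector. -/
lemma isConformalPatch_of_exists (h : IsConePatch F U)
    (hc : ∀ z ∈ U, ∃ v : ℂ, v ≠ 0 ∧
      fderiv ℝ F z (Complex.I * v) = crossC (F z) (fderiv ℝ F z v)) :
    IsConformalPatch F U := by
  refine h.isConformalPatch fun z hz => ?_
  obtain ⟨v, hv, hv2⟩ := hc z hz
  set a := v⁻¹ with ha
  -- As `F ×` squares to `-1` on the image of `dF`, compatibility on `v` extends to the real span of
  -- `v` and `i v`, which is everything.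
  have h1 : (1 : ℂ) = a.re • v + a.im • (Complex.I * v) := by
    rw [Complex.real_smul, Complex.real_smul]
    linear_combination v * (Complex.re_add_im a).symm - (inv_mul_cancel₀ hv)
  have hI : Complex.I = a.re • (Complex.I * v) - a.im • v := by
    rw [Complex.real_smul, Complex.real_smul]
    rw [Complex.real_smul, Complex.real_smul] at h1
    linear_combination Complex.I * h1 + a.im * v * Complex.I_sq
  conv_lhs => rw [hI]
  conv_rhs => rw [h1]
  simp only [← crossB_apply, map_add, map_sub, map_smul]
  rw [crossB_apply, crossB_apply, hv2, h.crossC_crossC_fderiv hz, smul_neg, sub_eq_add_neg]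

lemma hasFDerivAt_comp_symm (h : IsConePatch F U) {e : OpenPartialHomeomorph ℂ ℂ}
    (hU : e.source ⊆ U) (he' : ContDiffOn ℝ ∞ e.symm e.target) {w : ℂ} (hw : w ∈ e.target) :
    HasFDerivAt (fun y => F (e.symm y))
      ((fderiv ℝ F (e.symm w)).comp (fderiv ℝ e.symm w)) w :=
  (h.differentiableAt (hU (e.map_target hw))).hasFDerivAt.comp w
    (((he'.contDiffAt (e.open_target.mem_nhds hw)).differentiableAt (by simp)).hasFDerivAt)

lemma _root_.OpenPartialHomeomorph.fderiv_symm_comp {e : OpenPartialHomeomorph ℂ ℂ}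
    (he : ContDiffOn ℝ ∞ e e.source) (he' : ContDiffOn ℝ ∞ e.symm e.target) {w : ℂ}
    (hw : w ∈ e.target) (v : ℂ) :
    fderiv ℝ e (e.symm w) (fderiv ℝ e.symm w v) = v := by
  have h1 := ((he'.contDiffAt (e.open_target.mem_nhds hw)).differentiableAt (by simp)).hasFDerivAt
  have h2 := ((he.contDiffAt (e.open_source.mem_nhds (e.map_target hw))).differentiableAt
    (by simp)).hasFDerivAt
  have h3 := (h2.comp w h1).congr_of_eventuallyEq (f₁ := id) (by
    filter_upwards [e.open_target.mem_nhds hw] with y hy using (e.right_inv hy).symm)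
  exact congrArg (fun L => L v) (h3.unique (hasFDerivAt_id w))

lemma _root_.OpenPartialHomeomorph.fderiv_comp_symm {e : OpenPartialHomeomorph ℂ ℂ}
    (he : ContDiffOn ℝ ∞ e e.source) (he' : ContDiffOn ℝ ∞ e.symm e.target) {z : ℂ}
    (hz : z ∈ e.source) (v : ℂ) :
    fderiv ℝ e.symm (e z) (fderiv ℝ e z v) = v := by
  have := OpenPartialHomeomorph.fderiv_symm_comp (e := e.symm) he' he hz v
  simpa using this

lemma comp_symm (h : IsConePatch F U) {e : OpenPartialHomeomorph ℂ ℂ}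
    (hU : e.source ⊆ U) (he : ContDiffOn ℝ ∞ e e.source)
    (he' : ContDiffOn ℝ ∞ e.symm e.target) :
    IsConePatch (fun y => F (e.symm y)) e.target where
  isOpen := e.open_target
  contDiffOn := h.contDiffOn.comp he' fun _ hw => hU (e.map_target hw)
  norm_eq_one _ hw := h.norm_eq_one _ (hU (e.map_target hw))
  injective w hw := by
    rw [(h.hasFDerivAt_comp_symm hU he' hw).fderiv]
    exact (h.injective _ (hU (e.map_target hw))).comp
      (Function.LeftInverse.injective (OpenPartialHomeomorph.fderiv_symm_comp he he' hw))
  plane w hw := by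
    obtain ⟨V, hV, h1, h2⟩ := h.plane _ (hU (e.map_target hw))
    refine ⟨V, hV, h1, fun v => ?_⟩
    rw [(h.hasFDerivAt_comp_symm hU he' hw).fderiv]
    exact h2 _

/-- The rotation by a right angle in terms of the coordinates. -/
lemma reOmega_smul_crossC (h : IsConePatch F U) (hz : z ∈ U) :
    reOmega (F z) (fderiv ℝ F z 1) (fderiv ℝ F z Complex.I) • crossC (F z) (fderiv ℝ F z 1) =
      ‖fderiv ℝ F z 1‖ ^ 2 • fderiv ℝ F z Complex.I -
        inner ℝ (fderiv ℝ F z 1) (fderiv ℝ F z Complex.I) • fderiv ℝ F z 1 := by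
  obtain ⟨V, hV, hF, hd⟩ := h.plane z hz
  have h1 := h.norm_eq_one z hz
  have hp := h.inner_eq_zero hz 1
  obtain ⟨x, y, c, hq⟩ := hV.exists_eq hF h1 (hd 1) hp
    (h.fderiv_ne_zero hz one_ne_zero) (hd Complex.I)
  have hx := h.inner_eq_zero hz Complex.I
  have hp' := hp
  rw [real_inner_comm] at hp'
  rw [hq] at hx ⊢
  simp only [inner_add_right, inner_smul_right, hp, inner_crossC_left,
    real_inner_self_eq_norm_sq, h1, mul_zero, add_zero, one_pow, mul_one] at hx
  subst hx
  rw [← inner_crossC]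
  simp only [inner_add_right, inner_smul_right, inner_crossC_right, hp',
    real_inner_self_eq_norm_sq, hV.norm_crossC hF h1 (hd 1) hp]
  rw [show inner ℝ (crossC (F z) (fderiv ℝ F z 1)) (fderiv ℝ F z 1) = 0 by
    rw [real_inner_comm, inner_crossC_right]]
  module

/-- If it vanished, `reOmega_smul_crossC` would make the two partial derivatives linearly dependent.
-/
lemma reOmega_ne_zero (h : IsConePatch F U) (hz : z ∈ U) :
    reOmega (F z) (fderiv ℝ F z 1) (fderiv ℝ F z Complex.I) ≠ 0 := by
  intro h0
  have h1 := h.reOmega_smul_crossC hz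
  rw [h0, zero_smul, ← map_smul, ← map_smul, ← map_sub] at h1
  have h2 := h.injective z hz ((map_zero _).trans h1)
  have h3 := congrArg Complex.im h2
  rw [Complex.sub_im, Complex.smul_im, Complex.smul_im] at h3
  have h4 : ‖fderiv ℝ F z 1‖ ≠ 0 := norm_ne_zero_iff.2 (h.fderiv_ne_zero hz one_ne_zero)
  simp at h3
  exact h4 ((pow_eq_zero_iff two_ne_zero).1 h3.symm)

end IsConePatch

end

/-! ### Existence of conformal coordinates. -/

noncomputable section
open Topology ComplexConjugate

namespace IsConePatch

variable {F : ℂ → C3} {U : Set ℂ} {z : ℂ}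

lemma exists_conformal_of_normalized (h : IsConePatch F U) (h0 : (0 : ℂ) ∈ U)
    (hn : fderiv ℝ F 0 Complex.I = crossC (F 0) (fderiv ℝ F 0 1)) :
    ∃ e : OpenPartialHomeomorph ℂ ℂ, (0 : ℂ) ∈ e.source ∧ e.source ⊆ U ∧
      ContDiffOn ℝ ∞ e e.source ∧ ContDiffOn ℝ ∞ e.symm e.target ∧
      IsConformalPatch (fun y => F (e.symm y)) e.target := by
  set p : ℂ → C3 := fun y => fderiv ℝ F y 1 with hp
  set q : ℂ → C3 := fun y => fderiv ℝ F y Complex.I with hq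
  set D : ℂ → ℝ := fun y => inner ℝ (crossB (F y) (p y)) (q y) with hD
  have hDO : ∀ y, D y = reOmega (F y) (p y) (q y) := fun y => inner_crossC _ _ _
  have hG : ContDiffOn ℝ ∞ (fderiv ℝ F) U :=
    h.contDiffOn.fderiv_of_isOpen h.isOpen (by norm_cast)
  have hps : ContDiffOn ℝ ∞ p U := hG.clm_apply contDiffOn_const
  have hqs : ContDiffOn ℝ ∞ q U := hG.clm_apply contDiffOn_const
  have hDs : ContDiffOn ℝ ∞ D U :=
    ((crossB.contDiff.comp_contDiffOn h.contDiffOn).clm_apply hps).inner ℝ hqs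
  have hD0 : 0 < D 0 := by
    rw [hDO]
    exact ((h.conformal_iff h0).2 hn).2.2
  obtain ⟨ρ, hρ, hball⟩ := Metric.isOpen_iff.1
    (hDs.continuousOn.isOpen_inter_preimage h.isOpen isOpen_Ioi) 0 ⟨h0, hD0⟩
  have hbU : Metric.ball (0 : ℂ) ρ ⊆ U := fun y hy => (hball hy).1
  have hbD : ∀ y ∈ Metric.ball (0 : ℂ) ρ, 0 < D y := fun y hy => (hball hy).2
  -- The functions `α` and `β` express the rotated vector `F × F_s` as `dF(α + β i)`.
  set α : ℂ → ℝ := fun y => -inner ℝ (p y) (q y) / D y with hα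
  set β : ℂ → ℝ := fun y => inner ℝ (p y) (p y) / D y with hβ
  have hαs : ContDiffOn ℝ ∞ α (Metric.ball 0 ρ) :=
    ((hps.inner ℝ hqs).mono hbU).neg.div (hDs.mono hbU) fun y hy => (hbD y hy).ne'
  have hβs : ContDiffOn ℝ ∞ β (Metric.ball 0 ρ) :=
    ((hps.inner ℝ hps).mono hbU).div (hDs.mono hbU) fun y hy => (hbD y hy).ne'
  have hβpos : ∀ y ∈ Metric.ball (0 : ℂ) ρ, 0 ≤ β y := fun y hy =>
    div_nonneg real_inner_self_nonneg (hbD y hy).le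
  have hJ : ∀ y ∈ Metric.ball (0 : ℂ) ρ,
      fderiv ℝ F y (α y + β y * Complex.I) = crossC (F y) (p y) := by
    intro y hy
    have h1 := h.reOmega_smul_crossC (hbU hy)
    rw [← hDO y] at h1
    have hne := (hbD y hy).ne'
    have h2 : crossC (F y) (p y) = α y • p y + β y • q y := by
      rw [← inv_smul_smul₀ hne (crossC (F y) (p y)), h1, hα, hβ]
      simp only [real_inner_self_eq_norm_sq, div_eq_inv_mul]
      module
    rw [h2, ← map_smul, ← map_smul, ← map_add]
    simp
  -- A conformal coordinate `f` must satisfy `i df(1) = df(α + β i)`. Splitting `df` into `∂f` and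
  -- `∂̄f` gives `den * ∂̄f = num * ∂f`. At the origin `α = 0` and `β = 1`, so the coefficient
  -- vanishes there.
  set num : ℂ → ℂ := fun y => (α y : ℂ) + Complex.I * ((β y : ℂ) - 1) with hnum
  set den : ℂ → ℂ := fun y => -(α y : ℂ) + Complex.I * ((β y : ℂ) + 1) with hden
  have hαc : ContDiffOn ℝ ∞ (fun y => (α y : ℂ)) (Metric.ball 0 ρ) :=
    Complex.ofRealCLM.contDiff.comp_contDiffOn hαs
  have hβc : ContDiffOn ℝ ∞ (fun y => (β y : ℂ)) (Metric.ball 0 ρ) :=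
    Complex.ofRealCLM.contDiff.comp_contDiffOn hβs
  have hden0 : ∀ y ∈ Metric.ball (0 : ℂ) ρ, den y ≠ 0 := by
    intro y hy h1
    have h2 := congrArg Complex.im h1
    simp [hden] at h2
    linarith [hβpos y hy]
  have hα0 : α 0 = 0 := by
    have := ((h.conformal_iff h0).2 hn).2.1
    simp [hα, hp, hq, this]
  have hβ0 : β 0 = 1 := by
    have h1 := ((h.conformal_iff h0).2 hn).1
    have h2 : D 0 = inner ℝ (p 0) (p 0) := by
      have h3 : crossB (F 0) (p 0) = q 0 := hn.symm
      rw [hD]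
      simp only [h3, real_inner_self_eq_norm_sq]
      rw [hp, hq]
      simp only [h1]
    simp only [hβ, h2]
    rw [← h2]
    exact div_self hD0.ne'
  obtain ⟨r, f, hr, hf, hfb⟩ := exists_beltrami (μ := fun y => num y / den y) hρ
    (by
      simp only [div_eq_mul_inv]
      exact (hαc.add (contDiffOn_const.mul (hβc.sub contDiffOn_const))).mul
        ((hαc.neg.add (contDiffOn_const.mul (hβc.add contDiffOn_const))).inv hden0))
    (by simp [hnum, hα0, hβ0])
  obtain ⟨e, h0e, hes, hef, he, he'⟩ := exists_local_diffeomorphism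
    (s := Metric.ball (0 : ℂ) (min r ρ)) Metric.isOpen_ball hf.contDiffOn
    (fun z hz => injective_fderiv_of_norm_dbar_lt (hfb z (by
      rw [mem_ball_zero_iff] at hz
      exact hz.trans_le (min_le_left _ _))).2) (Metric.mem_ball_self (lt_min hr hρ))
  have hesρ : ∀ z ∈ e.source, z ∈ Metric.ball (0 : ℂ) ρ := fun z hz =>
    Metric.ball_subset_ball (min_le_right _ _) (hes hz)
  have heU : e.source ⊆ U := fun z hz => hbU (hesρ z hz)
  refine ⟨e, h0e, heU, he, he', ?_⟩
  refine (h.comp_symm heU he he').isConformalPatch_of_exists fun w hw => ?_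
  set z := e.symm w with hz
  have hzs : z ∈ e.source := e.map_target hw
  have hzr : ‖z‖ < r := by
    have := hes hzs
    rw [mem_ball_zero_iff] at this
    exact this.trans_le (min_le_left _ _)
  have hefd : fderiv ℝ e z = fderiv ℝ f z := by
    rw [show (e : ℂ → ℂ) = f from funext hef]
  have hsymm : ∀ v, fderiv ℝ e.symm w (fderiv ℝ f z v) = v := by
    intro v
    have := OpenPartialHomeomorph.fderiv_comp_symm he he' hzs v
    rwa [hefd, hz, e.right_inv hw] at this
  refine ⟨fderiv ℝ f z 1, ?_, ?_⟩
  · intro h1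
    have h2 := hsymm 1
    rw [h1, map_zero] at h2
    exact zero_ne_one h2
  · have hI : Complex.I * fderiv ℝ f z 1 = fderiv ℝ f z (α z + β z * Complex.I) := by
      have h1 := (hfb z hzr).1
      rw [div_mul_eq_mul_div, eq_div_iff (hden0 z (hesρ z hzs))] at h1
      rw [fderiv_eq_del_dbar f z, fderiv_eq_del_dbar f z]
      simp only [map_one, map_add, map_mul, Complex.conj_ofReal, Complex.conj_I]
      rw [hnum, hden] at h1
      linear_combination h1
    rw [hI, (h.hasFDerivAt_comp_symm heU he' hw).fderiv, ContinuousLinearMap.comp_apply,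
      ContinuousLinearMap.comp_apply, hsymm, hsymm, hJ z (hesρ z hzs)]

/-- An affine change of coordinates moves `a` to `0` and makes the second coordinate vector there
the rotation of the first, which is the normalization needed for a Beltrami coefficient vanishing at
`0`. -/
lemma exists_isConformalPatch (h : IsConePatch F U) {a : ℂ} (ha : a ∈ U) :
    ∃ e : OpenPartialHomeomorph ℂ ℂ, a ∈ e.source ∧ e.source ⊆ U ∧
      ContDiffOn ℝ ∞ e e.source ∧ ContDiffOn ℝ ∞ e.symm e.target ∧
      IsConformalPatch (fun y => F (e.symm y)) e.target := by
  set Δ := reOmega (F a) (fderiv ℝ F a 1) (fderiv ℝ F a Complex.I) with hΔ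
  have hΔ0 : Δ ≠ 0 := h.reOmega_ne_zero ha
  set p := fderiv ℝ F a 1 with hp
  set q := fderiv ℝ F a Complex.I with hq
  set x : ℝ := -inner ℝ p q / Δ with hx
  set y : ℝ := ‖p‖ ^ 2 / Δ with hy
  have hy0 : y ≠ 0 := div_ne_zero
    (pow_ne_zero _ (norm_ne_zero_iff.2 (h.fderiv_ne_zero ha one_ne_zero))) hΔ0
  have hJ : crossC (F a) p = fderiv ℝ F a (x + y * Complex.I) := by
    have h1 := h.reOmega_smul_crossC ha
    rw [← hΔ] at h1
    have h2 : crossC (F a) p = x • p + y • q := by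
      rw [← inv_smul_smul₀ hΔ0 (crossC (F a) p), h1, hx, hy]
      simp only [div_eq_inv_mul]
      module
    rw [h2, hp, hq, ← map_smul, ← map_smul, ← map_add]
    simp
  set M : ℂ →L[ℝ] ℂ := Complex.reCLM.smulRight (1 : ℂ) +
    Complex.imCLM.smulRight (x + y * Complex.I : ℂ) with hM
  have hMv : ∀ v, M v = v.re + v.im * (x + y * Complex.I) := fun v => by simp [hM, mul_add]
  have hMinj : Function.Injective M := by
    rw [injective_iff_map_eq_zero]
    intro v hv
    rw [hMv] at hv
    have h1 := congrArg Complex.re hv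
    have h2 := congrArg Complex.im hv
    simp at h1 h2
    have h3 : v.im = 0 := h2.resolve_right hy0
    rw [h3] at h1
    exact Complex.ext (by simpa using h1) h3
  set A : ℂ ≃L[ℝ] ℂ :=
    (LinearEquiv.ofInjectiveEndo M.toLinearMap hMinj).toContinuousLinearEquiv with hA
  have hAv : ∀ v, A v = M v := fun v => rfl
  set T : ℂ ≃ₜ ℂ := (Homeomorph.subRight a).trans A.symm.toHomeomorph with hT
  have hTv : ∀ v, T v = A.symm (v - a) := fun v => rfl
  have hTs : ∀ v, T.symm v = A v + a := fun v => rfl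
  set e₁ := T.toOpenPartialHomeomorph.restr U with he₁
  have he₁s : e₁.source = U := by
    rw [he₁, OpenPartialHomeomorph.restr_source, h.isOpen.interior_eq]
    simp
  have he₁v : ∀ v, e₁ v = A.symm (v - a) := fun v => rfl
  have he₁sv : ∀ v, e₁.symm v = A v + a := fun v => rfl
  have hsm : ContDiffOn ℝ ∞ e₁ e₁.source :=
    (A.symm.contDiff.comp (contDiff_id.sub contDiff_const)).contDiffOn
  have hsm' : ContDiffOn ℝ ∞ e₁.symm e₁.target :=
    (A.contDiff.add contDiff_const).contDiffOn
  have ht0 : (0 : ℂ) ∈ e₁.target := by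
    have := e₁.map_source (x := a) (he₁s ▸ ha)
    rwa [he₁v, sub_self, map_zero] at this
  have hsymm0 : e₁.symm 0 = a := by rw [he₁sv, map_zero, zero_add]
  have hd : ∀ v, fderiv ℝ (fun w => F (e₁.symm w)) 0 v = fderiv ℝ F a (M v) := by
    intro v
    have h1 : HasFDerivAt e₁.symm (A : ℂ →L[ℝ] ℂ) 0 := A.hasFDerivAt.add_const a
    have h2 : HasFDerivAt F (fderiv ℝ F a) (e₁.symm 0) := by
      rw [hsymm0]
      exact (h.differentiableAt ha).hasFDerivAt
    rw [show fderiv ℝ (fun w => F (e₁.symm w)) 0 = _ from (h2.comp 0 h1).fderiv]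
    rfl
  obtain ⟨e₂, h0, hsub, hs2, hs2', hc⟩ := (h.comp_symm he₁s.subset hsm hsm').exists_conformal_of_normalized
    ht0 (by
      rw [hd, hd, hMv, hMv, hsymm0]
      simp [← hJ, hp])
  refine ⟨e₁.trans e₂, ?_, ?_, ?_, ?_, ?_⟩
  · rw [OpenPartialHomeomorph.trans_source]
    refine ⟨he₁s ▸ ha, ?_⟩
    simpa [he₁v] using h0
  · rw [OpenPartialHomeomorph.trans_source, he₁s]
    exact Set.inter_subset_left
  · rw [OpenPartialHomeomorph.trans_source]
    exact hs2.comp (hsm.mono Set.inter_subset_left) fun _ hv => hv.2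
  · rw [OpenPartialHomeomorph.trans_target]
    exact hsm'.comp (hs2'.mono Set.inter_subset_left) fun _ hv => hv.2
  · have : (e₁.trans e₂).target = e₂.target := by
      rw [OpenPartialHomeomorph.trans_target, Set.inter_eq_left]
      intro w hw
      exact hsub (e₂.map_target hw)
    rw [this]
    exact hc

end IsConePatch

end

/-! ### Holomorphic coordinate changes; the local ruled 3-fold. -/

noncomputable section
open Topology ComplexConjugate

namespace IsConformalPatch

variable {F G : ℂ → C3} {U V : Set ℂ} {z : ℂ}

lemma injective (h : IsConformalPatch F U) (hz : z ∈ U) :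
    Function.Injective (fderiv ℝ F z) := by
  rw [injective_iff_map_eq_zero]
  intro v hv
  have hp : inner ℝ (fderiv ℝ F z 1) (fderiv ℝ F z 1) ≠ 0 := inner_self_ne_zero.2 (h.ne_zero z hz)
  have h1 := congrArg (inner ℝ (fderiv ℝ F z 1)) hv
  rw [h.fderiv_eq hz v] at h1
  simp only [inner_add_right, inner_smul_right, inner_crossC_right, mul_zero, add_zero,
    inner_zero_right, mul_eq_zero, hp, or_false] at h1
  have h2 := hv
  rw [h.fderiv_eq hz v, h1, zero_smul, zero_add] at h2
  have h3 := congrArg (fun v => crossB (F z) v) h2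
  simp only [map_smul, crossB_apply, h.crossC_crossC_fderiv hz, map_zero, smul_neg, neg_eq_zero,
    smul_eq_zero, h.ne_zero z hz, or_false] at h3
  exact Complex.ext h1 h3

/-- Changes of conformal coordinates are holomorphic. -/
lemma differentiableAt_complex (hF : IsConformalPatch F U) (hG : IsConformalPatch G V)
    {g : ℂ → ℂ} (hz : z ∈ U) (hgz : g z ∈ V) (hg : DifferentiableAt ℝ g z)
    (heq : F =ᶠ[𝓝 z] fun y => G (g y)) : DifferentiableAt ℂ g z := by
  rw [differentiableAt_complex_iff_differentiableAt_real]
  refine ⟨hg, hG.injective hgz ?_⟩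
  have h1 : ∀ v, fderiv ℝ F z v = fderiv ℝ G (g z) (fderiv ℝ g z v) := by
    intro v
    rw [heq.fderiv_eq, show fderiv ℝ (fun y => G (g y)) z = _ from
      ((hG.differentiableAt hgz).hasFDerivAt.comp z hg.hasFDerivAt).fderiv]
    rfl
  rw [← h1, smul_eq_mul, hG.fderiv_I_mul hgz, ← h1, hF.eq_cross z hz, heq.eq_of_nhds]

/-- A conformal patch composed with a local biholomorphism. -/
lemma comp (hG : IsConformalPatch G V) {g : ℂ → ℂ} (hU : IsOpen U) (hg : DifferentiableOn ℂ g U)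
    (hmaps : Set.MapsTo g U V) (hd : ∀ z ∈ U, deriv g z ≠ 0) :
    IsConformalPatch (fun z => G (g z)) U := by
  have hgs : ContDiffOn ℝ ∞ g U := (hg.contDiffOn hU).restrict_scalars ℝ
  have h1 : ∀ z ∈ U, ∀ v, fderiv ℝ (fun z => G (g z)) z v = fderiv ℝ G (g z) (v * deriv g z) := by
    intro z hz v
    have h2 := ((hg.differentiableAt (hU.mem_nhds hz)).hasDerivAt.hasFDerivAt.restrictScalars ℝ)
    rw [show fderiv ℝ (fun y => G (g y)) z = _ from
      ((hG.differentiableAt (hmaps hz)).hasFDerivAt.comp z h2).fderiv]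
    simp
  refine ⟨hU, hG.contDiffOn.comp hgs hmaps, fun z hz => hG.norm_eq_one _ (hmaps hz),
    fun z hz => ?_, fun z hz => ?_, fun z hz => ?_⟩
  · rw [h1 z hz]
    intro h0
    have := hG.injective (hmaps hz) (h0.trans (map_zero _).symm)
    exact hd z hz (by simpa using this)
  · rw [h1 z hz]
    exact hG.kahler_eq_zero (hmaps hz) _
  · rw [h1 z hz, h1 z hz, hG.fderiv_I_mul (hmaps hz), one_mul]

/-! ### The ruled submanifold of a holomorphic vector field -/

/-- The derivative at `(z, r)` of `r F + dF(a)`, on vectors tangent to the surface. -/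
def ruledDeriv (F : ℂ → C3) (a : ℂ → ℂ) (z : ℂ) (r : ℝ) : ℂ →L[ℝ] C3 :=
  r • fderiv ℝ F z + ((fderiv ℝ (fderiv ℝ F) z).flip (a z) +
    (fderiv ℝ F z).comp (fderiv ℝ a z))

lemma hasFDerivAt_ruled (h : IsConformalPatch F U) (hz : z ∈ U) {a : ℂ → ℂ}
    (ha : DifferentiableAt ℝ a z) (r : ℝ) :
    HasFDerivAt (fun p : ℂ × ℝ => p.2 • F p.1 + fderiv ℝ F p.1 (a p.1))
      ((ruledDeriv F a z r).coprod (ContinuousLinearMap.toSpanSingleton ℝ (F z))) (z, r) := by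
  have h1 : HasFDerivAt (fun p : ℂ × ℝ => p.1) (ContinuousLinearMap.fst ℝ ℂ ℝ) (z, r) :=
    hasFDerivAt_fst
  have h2 : HasFDerivAt (fun p : ℂ × ℝ => p.2) (ContinuousLinearMap.snd ℝ ℂ ℝ) (z, r) :=
    hasFDerivAt_snd
  have hF : HasFDerivAt (fun p : ℂ × ℝ => F p.1) _ (z, r) :=
    HasFDerivAt.comp (z, r) (g := F) (f := fun p : ℂ × ℝ => p.1)
      (h.differentiableAt hz).hasFDerivAt h1
  have hG : HasFDerivAt (fun p : ℂ × ℝ => fderiv ℝ F p.1 (a p.1)) _ (z, r) :=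
    HasFDerivAt.comp (z, r) (g := fun y => fderiv ℝ F y (a y)) (f := fun p : ℂ × ℝ => p.1)
      ((h.differentiableAt_fderiv hz).hasFDerivAt.clm_apply ha.hasFDerivAt) h1
  refine ((h2.smul hF).add hG).congr_fderiv ?_
  ext p <;> simp [ruledDeriv] <;> abel

variable {a : ℂ → ℂ}

/-- Differentiating `ω(F, dF(v)) = 0` expresses this through a second derivative, which is
symmetric, whereas `ω` is antisymmetric. -/
lemma kahler_fderiv_fderiv (h : IsConformalPatch F U) (hz : z ∈ U) (v w : ℂ) :
    kahlerForm (fderiv ℝ F z v) (fderiv ℝ F z w) = 0 := by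
  have h1 := h.kahler_snd hz v w
  have h2 := h.kahler_snd hz w v
  rw [h.snd_symm hz, h1, kahlerForm_swap] at h2
  linarith

lemma kahler_ruledDeriv (h : IsConformalPatch F U) (hz : z ∈ U) (r : ℝ) (v : ℂ) :
    kahlerForm (F z) (ruledDeriv F a z r v) = 0 := by
  simp only [ruledDeriv, add_apply, smul_apply,
    ContinuousLinearMap.flip_apply, ContinuousLinearMap.comp_apply]
  simp only [← kahlerB_apply, map_add, map_smul]
  simp only [kahlerB_apply, h.kahler_snd hz, h.kahler_fderiv_fderiv hz, h.kahler_eq_zero hz]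
  simp

/-- The `s`-derivative of `r F + dF(a)` is rotated into its `t`-derivative. Differentiating `F_t = F
× F_s` along `a` leaves only the error `dF(a) × F_s`, a multiple of `F`; holomorphy of `a` handles
the terms with `da`. -/
lemma ruledDeriv_I (h : IsConformalPatch F U) (hz : z ∈ U) (ha : DifferentiableAt ℂ a z) (r : ℝ) :
    ∃ c : ℝ, ruledDeriv F a z r Complex.I =
      crossC (F z) (ruledDeriv F a z r 1) + c • F z := by
  have haI : fderiv ℝ a z Complex.I = Complex.I * fderiv ℝ a z 1 :=
    (differentiableAt_complex_iff_differentiableAt_real.1 ha).2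
  have h1 : crossC (fderiv ℝ F z (a z)) (fderiv ℝ F z 1) =
      (-(a z).im * ‖fderiv ℝ F z 1‖ ^ 2) • F z := by
    have h2 := h.inner_eq_zero hz 1
    rw [real_inner_comm] at h2
    have h3 : crossC (crossC (F z) (fderiv ℝ F z 1)) (fderiv ℝ F z 1) =
        -(‖fderiv ℝ F z 1‖ ^ 2) • F z := by
      rw [crossC_swap (fderiv ℝ F z 1), crossC_swap (fderiv ℝ F z 1) (F z), ← crossB_apply,
        map_neg, neg_neg, crossB_apply, crossC_crossC, h2, kahlerForm_swap, h.kahler z hz]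
      simp
    rw [crossC_swap, h.fderiv_eq hz (a z), ← crossB_apply, map_add, map_smul, map_smul,
      crossB_apply, crossB_apply, crossC_self, crossC_swap _ (fderiv ℝ F z 1), h3]
    module
  refine ⟨-(a z).im * ‖fderiv ℝ F z 1‖ ^ 2, ?_⟩
  simp only [ruledDeriv, add_apply, smul_apply,
    ContinuousLinearMap.flip_apply, ContinuousLinearMap.comp_apply]
  rw [h.snd_symm hz, h.snd_I hz, h1, haI, h.fderiv_I_mul hz, h.eq_cross z hz, h.snd_symm hz (a z)]
  simp only [← crossB_apply, map_add, map_smul]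
  abel

lemma range_coprod (F₀ : C3) (L : ℂ →L[ℝ] C3) :
    (L.coprod (ContinuousLinearMap.toSpanSingleton ℝ F₀) : ℂ × ℝ →ₗ[ℝ] C3).range =
      Submodule.span ℝ {F₀, L 1, L Complex.I} := by
  apply le_antisymm
  · rintro _ ⟨⟨v, r⟩, rfl⟩
    have hv : L v = v.re • L 1 + v.im • L Complex.I := by
      conv_lhs => rw [show v = v.re • (1 : ℂ) + v.im • Complex.I by simp [Complex.re_add_im]]
      rw [map_add, map_smul, map_smul]
    have h1 : F₀ ∈ Submodule.span ℝ {F₀, L 1, L Complex.I} := Submodule.subset_span (by simp)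
    have h2 : L 1 ∈ Submodule.span ℝ {F₀, L 1, L Complex.I} := Submodule.subset_span (by simp)
    have h3 : L Complex.I ∈ Submodule.span ℝ {F₀, L 1, L Complex.I} :=
      Submodule.subset_span (by simp)
    change L v + r • F₀ ∈ _
    rw [hv]
    exact Submodule.add_mem _ (Submodule.add_mem _ (Submodule.smul_mem _ _ h2)
      (Submodule.smul_mem _ _ h3)) (Submodule.smul_mem _ _ h1)
  · rw [Submodule.span_le]
    rintro x (rfl | rfl | rfl)
    · exact ⟨(0, 1), by simp⟩
    · exact ⟨(1, 0), by simp⟩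
    · exact ⟨(Complex.I, 0), by simp⟩

lemma isSpecialLagrangianPlane_range (h : IsConformalPatch F U) (hz : z ∈ U)
    (ha : DifferentiableAt ℂ a z) (r : ℝ) (hX : ∀ c : ℝ, ruledDeriv F a z r 1 ≠ c • F z) :
    IsSpecialLagrangianPlane ((ruledDeriv F a z r).coprod
      (ContinuousLinearMap.toSpanSingleton ℝ (F z)) : ℂ × ℝ →ₗ[ℝ] C3).range := by
  obtain ⟨c, hc⟩ := h.ruledDeriv_I hz ha r
  exact isSpecialLagrangianPlane_span (h.norm_eq_one z hz) (h.kahler_ruledDeriv hz r 1) hc hX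
    (range_coprod _ _)

lemma ruled_injective_iff (h : IsConformalPatch F U) (hz : z ∈ U)
    (ha : DifferentiableAt ℂ a z) (r : ℝ) :
    Function.Injective ((ruledDeriv F a z r).coprod
      (ContinuousLinearMap.toSpanSingleton ℝ (F z))) ↔
      ∀ c : ℝ, ruledDeriv F a z r 1 ≠ c • F z := by
  constructor
  · intro hinj c hc
    have h1 : (ruledDeriv F a z r).coprod (ContinuousLinearMap.toSpanSingleton ℝ (F z)) (1, -c)
        = 0 := by
      simp [hc]
    have := hinj (h1.trans (map_zero _).symm)
    simp at this
  · intro hX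
    have h1 := (h.isSpecialLagrangianPlane_range hz ha r hX).finrank_eq
    set L := ((ruledDeriv F a z r).coprod
      (ContinuousLinearMap.toSpanSingleton ℝ (F z)) : ℂ × ℝ →ₗ[ℝ] C3) with hL
    have h2 := LinearMap.finrank_range_add_finrank_ker L
    rw [h1, Module.finrank_prod, Complex.finrank_real_complex, Module.finrank_self] at h2
    have h3 : Module.finrank ℝ L.ker = 0 := by omega
    exact LinearMap.ker_eq_bot.1 (Submodule.finrank_eq_zero.1 h3)

/-- At a singular point the `s`-derivative is a multiple of `F`. Subtracting this at two values of
`r` makes `(r - r') F_s` a multiple of `F`, but `F_s` is nonzero and orthogonal to `F`. -/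
lemma ruled_not_injective_subsingleton (h : IsConformalPatch F U) (hz : z ∈ U)
    (ha : DifferentiableAt ℂ a z) {r r' : ℝ}
    (hr : ¬ Function.Injective ((ruledDeriv F a z r).coprod
      (ContinuousLinearMap.toSpanSingleton ℝ (F z))))
    (hr' : ¬ Function.Injective ((ruledDeriv F a z r').coprod
      (ContinuousLinearMap.toSpanSingleton ℝ (F z)))) : r = r' := by
  rw [h.ruled_injective_iff hz ha] at hr hr'
  push Not at hr hr'
  obtain ⟨c, hc⟩ := hr
  obtain ⟨c', hc'⟩ := hr'
  by_contra hne
  have h1 : (r - r') • fderiv ℝ F z 1 = (c - c') • F z := by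
    rw [sub_smul, sub_smul, ← hc, ← hc']
    simp [ruledDeriv]
  have h2 := congrArg (inner ℝ (fderiv ℝ F z 1)) h1
  have h3 := h.inner_eq_zero hz 1
  rw [real_inner_comm] at h3
  rw [inner_smul_right, inner_smul_right, h3, mul_zero, mul_eq_zero, inner_self_eq_zero] at h2
  exact h2.elim (sub_ne_zero.2 hne) (h.ne_zero z hz)

end IsConformalPatch

end

/-! ### Smoothness and tangent planes of the direction map. -/

noncomputable section
open Topology ComplexConjugate

section LocalCone

variable {E : Type*} [NormedAddCommGroup E] [NormedSpace ℝ E]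

/-- Submersions have smooth local sections. -/
lemma exists_local_section {π : E → ℂ} {x : E} (hπ : ContDiffAt ℝ ∞ π x)
    (hsurj : Function.Surjective (fderiv ℝ π x)) : ∃ s : ℂ → E, s (π x) = x ∧
      ContDiffAt ℝ ∞ s (π x) ∧ ∀ᶠ y in 𝓝 (π x), π (s y) = y := by
  obtain ⟨A, hA⟩ := LinearMap.exists_rightInverse_of_surjective (fderiv ℝ π x).toLinearMap
    (LinearMap.range_eq_top.2 hsurj)
  set B : ℂ →L[ℝ] E := LinearMap.toContinuousLinearMap A with hB
  have hBA : ∀ v, fderiv ℝ π x (B v) = v := fun v => congrArg (fun L => L v) hA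
  set j : ℂ → E := fun y => x + B (y - π x) with hj
  have hj0 : j (π x) = x := by simp [hj]
  have hjs : ContDiff ℝ ∞ j := contDiff_const.add (B.contDiff.comp (contDiff_id.sub contDiff_const))
  have hjd : HasFDerivAt j B (π x) :=
    (HasFDerivAt.comp (π x) (g := B) (f := fun y => y - π x) B.hasFDerivAt
      ((hasFDerivAt_id _).sub_const _)).const_add x
  have hπ' : ContDiffAt ℝ ∞ π (j (π x)) := by rwa [hj0]
  have hg : ContDiffAt ℝ ∞ (π ∘ j) (π x) := hπ'.comp _ hjs.contDiffAt
  have hgd : HasFDerivAt (π ∘ j) ((ContinuousLinearEquiv.refl ℝ ℂ : ℂ ≃L[ℝ] ℂ) : ℂ →L[ℝ] ℂ)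
      (π x) := by
    have h1 := (hπ'.differentiableAt (by simp)).hasFDerivAt.comp (π x) hjd
    refine h1.congr_fderiv ?_
    ext v
    simpa [hj0] using hBA v
  set e := hg.toOpenPartialHomeomorph (π ∘ j) hgd (by simp) with he
  have hmem : π x ∈ e.source := hg.mem_toOpenPartialHomeomorph_source hgd (by simp)
  have hev : e (π x) = π x := congrArg π hj0
  have htgt : π x ∈ e.target := hev ▸ e.map_source hmem
  have hsymm : e.symm (π x) = π x := by
    conv_lhs => rw [← hev]
    exact e.left_inv hmem
  refine ⟨fun y => j (e.symm y), ?_, ?_, ?_⟩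
  · simp only [hsymm, hj0]
  · refine hjs.contDiffAt.comp _ (e.contDiffAt_symm (f₀' := ContinuousLinearEquiv.refl ℝ ℂ) htgt ?_ ?_)
    · rw [hsymm]
      exact hgd
    · rw [hsymm]
      exact hg
  · filter_upwards [e.open_target.mem_nhds htgt] with y hy using e.right_inv hy

/-- The direction is only assumed continuous. Along a smooth section through `x` the map `ι` is a
multiple of `G`, positive near `π x` by continuity, so `G` is `ι` normalized to length one. -/
lemma contDiffAt_direction {ι : E → C3} {π : E → ℂ} {G : ℂ → C3} {x : E}
    (hι : ContDiffAt ℝ ∞ ι x) (hπ : ContDiffAt ℝ ∞ π x)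
    (hsurj : Function.Surjective (fderiv ℝ π x)) (hG : ContinuousAt G (π x))
    (hG1 : ∀ᶠ y in 𝓝 (π x), ‖G y‖ = 1) (hx : ι x = G (π x))
    (heq : ∀ᶠ y in 𝓝 x, ι y = (inner ℝ (G (π y)) (ι y) : ℝ) • G (π y)) :
    ContDiffAt ℝ ∞ G (π x) := by
  obtain ⟨s, hs0, hs, hsec⟩ := exists_local_section hπ hsurj
  have hιs : ContDiffAt ℝ ∞ (fun y => ι (s y)) (π x) :=
    ContDiffAt.comp (g := ι) (π x) (by rwa [hs0]) hs
  have hne : ι (s (π x)) ≠ 0 := by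
    rw [hs0, hx, ← norm_ne_zero_iff, hG1.self_of_nhds]
    exact one_ne_zero
  have hpos : ∀ᶠ y in 𝓝 (π x), 0 < (inner ℝ (G y) (ι (s y)) : ℝ) := by
    have hc : ContinuousAt (fun y => (inner ℝ (G y) (ι (s y)) : ℝ)) (π x) :=
      hG.inner hιs.continuousAt
    refine hc.eventually_const_lt ?_
    beta_reduce
    rw [hs0, hx, real_inner_self_eq_norm_sq, hG1.self_of_nhds]
    norm_num
  refine ((hιs.norm ℝ hne).inv (norm_ne_zero_iff.2 hne)).smul hιs |>.congr_of_eventuallyEq ?_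
  have h2 : ∀ᶠ y in 𝓝 (π x), ι (s y) = (inner ℝ (G (π (s y))) (ι (s y)) : ℝ) • G (π (s y)) := by
    have : Filter.Tendsto s (𝓝 (π x)) (𝓝 x) := by
      have := hs.continuousAt.tendsto
      rwa [hs0] at this
    exact this.eventually heq
  filter_upwards [hpos, h2, hsec, hG1] with y h1 h2 h3 h4
  rw [h3] at h2
  change G y = ‖ι (s y)‖⁻¹ • ι (s y)
  rw [h2]
  generalize (inner ℝ (G y) (ι (s y)) : ℝ) = c at h1 ⊢
  rw [norm_smul, h4, mul_one, Real.norm_of_nonneg h1.le, inv_smul_smul₀ h1.ne']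

/-- Differentiate `ι = ρ (G ∘ π)` at a point with `ρ = 1`. A vector in the kernel of `dπ` is sent to
a multiple of `G`, nonzero since `ι` is immersed; hence `G` is tangent, and subtracting multiples of
it leaves the derivatives of `G`. -/
lemma fderiv_direction {ι : E → C3} {π : E → ℂ} {G : ℂ → C3} {x : E}
    [FiniteDimensional ℝ E] (hdim : Module.finrank ℝ E = 3)
    (hι : ContDiffAt ℝ ∞ ι x) (hπ : ContDiffAt ℝ ∞ π x)
    (hsurj : Function.Surjective (fderiv ℝ π x)) (hG : ContinuousAt G (π x))
    (hG1 : ∀ᶠ y in 𝓝 (π x), ‖G y‖ = 1) (hx : ι x = G (π x))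
    (heq : ∀ᶠ y in 𝓝 x, ι y = (inner ℝ (G (π y)) (ι y) : ℝ) • G (π y))
    (hinj : Function.Injective (fderiv ℝ ι x)) :
    Function.Injective (fderiv ℝ G (π x)) ∧ G (π x) ∈ (fderiv ℝ ι x).toLinearMap.range ∧
      ∀ v, fderiv ℝ G (π x) v ∈ (fderiv ℝ ι x).toLinearMap.range := by
  have hGs := contDiffAt_direction hι hπ hsurj hG hG1 hx heq
  have hGπ := (hGs.differentiableAt (by simp)).hasFDerivAt.comp x
    (hπ.differentiableAt (by simp)).hasFDerivAt
  obtain ⟨ρ', hρ⟩ : ∃ ρ' : E →L[ℝ] ℝ, HasFDerivAt (fun y => (inner ℝ (G (π y)) (ι y) : ℝ)) ρ' x :=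
    ⟨_, (hGπ.differentiableAt.inner ℝ (hι.differentiableAt (by simp))).hasFDerivAt⟩
  have h1 := ((hρ.smul hGπ).congr_of_eventuallyEq heq).fderiv
  have hρx : (inner ℝ (G (π x)) (ι x) : ℝ) = 1 := by
    rw [hx, real_inner_self_eq_norm_sq, hG1.self_of_nhds, one_pow]
  have h2 : ∀ v, fderiv ℝ ι x v = fderiv ℝ G (π x) (fderiv ℝ π x v) + ρ' v • G (π x) := by
    intro v
    rw [h1]
    simp [hρx]
  obtain ⟨k, hk, hk0⟩ : ∃ k, fderiv ℝ π x k = 0 ∧ k ≠ 0 := by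
    have h3 := LinearMap.finrank_range_add_finrank_ker (fderiv ℝ π x).toLinearMap
    rw [LinearMap.range_eq_top.2 hsurj, finrank_top, hdim, Complex.finrank_real_complex] at h3
    have h4 : (fderiv ℝ π x).toLinearMap.ker ≠ ⊥ := by
      intro h0
      rw [h0, finrank_bot] at h3
      omega
    obtain ⟨k, hk, hk0⟩ := Submodule.exists_mem_ne_zero_of_ne_bot h4
    exact ⟨k, hk, hk0⟩
  have hιk : fderiv ℝ ι x k = ρ' k • G (π x) := by rw [h2, hk, map_zero, zero_add]
  have hρk : ρ' k ≠ 0 := by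
    intro h0
    rw [h0, zero_smul] at hιk
    exact hk0 (hinj (hιk.trans (map_zero _).symm))
  have hk1 : fderiv ℝ ι x ((ρ' k)⁻¹ • k) = G (π x) := by
    rw [map_smul, hιk, inv_smul_smul₀ hρk]
  refine ⟨?_, ⟨_, hk1⟩, fun v => ?_⟩
  · rw [injective_iff_map_eq_zero]
    intro u hu
    obtain ⟨v, rfl⟩ := hsurj u
    have h3 : fderiv ℝ ι x v = fderiv ℝ ι x (ρ' v • (ρ' k)⁻¹ • k) := by
      rw [h2, hu, zero_add, map_smul, hk1]
    rw [hinj h3, map_smul, map_smul, hk, smul_zero, smul_zero]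
  · obtain ⟨w, rfl⟩ := hsurj v
    refine ⟨w - ρ' w • (ρ' k)⁻¹ • k, ?_⟩
    change fderiv ℝ ι x _ = _
    rw [map_sub, map_smul, hk1, h2, add_sub_cancel_right]

end LocalCone

section Charts

lemma mfderiv_eq_fderiv_extChartAt {E M E' : Type*} [NormedAddCommGroup E] [NormedSpace ℝ E]
    [TopologicalSpace M] [ChartedSpace E M]
    [NormedAddCommGroup E'] [NormedSpace ℝ E'] {f : M → E'} {p : M}
    (hf : MDifferentiableAt 𝓘(ℝ, E) 𝓘(ℝ, E') f p) :
    mfderiv 𝓘(ℝ, E) 𝓘(ℝ, E') f p =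
      fderiv ℝ (fun x => f ((chartAt E p).symm x)) (chartAt E p p) := by
  refine hf.mfderiv.trans ?_
  simp only [writtenInExtChartAt, mfld_simps]
  rw [fderivWithin_univ]
  rfl

lemma contDiffAt_comp_chartAt_symm {E M E' : Type*} [NormedAddCommGroup E] [NormedSpace ℝ E]
    [TopologicalSpace M] [ChartedSpace E M]
    [NormedAddCommGroup E'] [NormedSpace ℝ E'] {f : M → E'} {p : M} {n : WithTop ℕ∞}
    (hf : ContMDiffAt 𝓘(ℝ, E) 𝓘(ℝ, E') n f p) :
    ContDiffAt ℝ n (fun x => f ((chartAt E p).symm x)) (chartAt E p p) := by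
  have := (contMDiffAt_iff.1 hf).2
  simp only [mfld_simps] at this
  exact this

end Charts

end

/-! ### Special Lagrangian cones in charts. -/

noncomputable section
open Topology ComplexConjugate

/-- Smooth complex-valued charts of a smooth surface. -/
def IsSmoothChart {S : Type*} [TopologicalSpace S] [ChartedSpace (EuclideanSpace ℝ (Fin 2)) S]
    (e : OpenPartialHomeomorph S ℂ) : Prop :=
  ContMDiffOn (𝓡 2) 𝓘(ℝ, ℂ) ∞ e e.source ∧ ContMDiffOn 𝓘(ℝ, ℂ) (𝓡 2) ∞ e.symm e.target

namespace IsSmoothChart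

variable {S : Type*} [TopologicalSpace S] [ChartedSpace (EuclideanSpace ℝ (Fin 2)) S]
  {e e' : OpenPartialHomeomorph S ℂ}

lemma contDiffOn_trans (he : IsSmoothChart e) (he' : IsSmoothChart e') :
    ContDiffOn ℝ ∞ (e.symm.trans e') (e.symm.trans e').source := by
  rw [← contMDiffOn_iff_contDiffOn]
  exact he'.1.comp (he.2.mono fun _ hz => hz.1) fun _ hz => hz.2

lemma trans (he : IsSmoothChart e) {f : OpenPartialHomeomorph ℂ ℂ}
    (hf : ContDiffOn ℝ ∞ f f.source) (hf' : ContDiffOn ℝ ∞ f.symm f.target) :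
    IsSmoothChart (e.trans f) := by
  constructor
  · exact hf.contMDiffOn.comp (he.1.mono fun _ hz => hz.1) fun _ hz => hz.2
  · rw [OpenPartialHomeomorph.trans_target]
    exact he.2.comp (hf'.contMDiffOn.mono fun _ hz => hz.1) fun _ hz => hz.2

lemma mdifferentiable (he : IsSmoothChart e) : e.MDifferentiable (𝓡 2) 𝓘(ℝ, ℂ) :=
  ⟨he.1.mdifferentiableOn (by simp), he.2.mdifferentiableOn (by simp)⟩

lemma contMDiffAt (he : IsSmoothChart e) {σ : S} (hσ : σ ∈ e.source) :
    ContMDiffAt (𝓡 2) 𝓘(ℝ, ℂ) ∞ e σ := he.1.contMDiffAt (e.open_source.mem_nhds hσ)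

/-- Every point has a smooth complex chart around it. -/
lemma exists_mem_source [IsManifold (𝓡 2) ∞ S] (σ : S) :
    ∃ e : OpenPartialHomeomorph S ℂ, σ ∈ e.source ∧ IsSmoothChart e := by
  obtain ⟨L⟩ : Nonempty (EuclideanSpace ℝ (Fin 2) ≃L[ℝ] ℂ) :=
    FiniteDimensional.nonempty_continuousLinearEquiv_of_finrank_eq (by
      rw [finrank_euclideanSpace_fin, Complex.finrank_real_complex])
  refine ⟨(chartAt (EuclideanSpace ℝ (Fin 2)) σ).trans L.toHomeomorph.toOpenPartialHomeomorph,
    by simp, ?_, ?_⟩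
  · exact L.contDiff.contMDiff.contMDiffOn.comp (t := Set.univ)
      (contMDiffOn_chart.mono fun _ hz => hz.1) fun _ _ => Set.mem_univ _
  · rw [OpenPartialHomeomorph.trans_target]
    exact (contMDiffOn_chart_symm (I := 𝓡 2) (x := σ)).comp L.symm.contDiff.contMDiff.contMDiffOn
      fun _ hz => hz.2

end IsSmoothChart

namespace IsROrientedTwoSidedSLCone

variable {S : Type*} [TopologicalSpace S]
    [ChartedSpace (EuclideanSpace ℝ (Fin 2)) S]
    {N₀ : Type*} [TopologicalSpace N₀]
    [ChartedSpace (EuclideanSpace ℝ (Fin 3)) N₀]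
    {ι₀ : N₀ → C3} {π₀ : N₀ → S} {φ : S → C3}

lemma exists_smul_eq (h : IsROrientedTwoSidedSLCone (𝓡 3) (𝓡 2) ι₀ π₀ φ) (p : N₀) :
    ∃ r : ℝ, ι₀ p = r • φ (π₀ p) := by
  obtain ⟨q, hq, hq0⟩ := h.through_zero (π₀ p)
  obtain ⟨r, hr⟩ := h.rOrientation.parallel q p hq
  exact ⟨r, by rw [hq0, sub_zero, hq] at hr; exact hr⟩

lemma eq_inner_smul (h : IsROrientedTwoSidedSLCone (𝓡 3) (𝓡 2) ι₀ π₀ φ) (p : N₀) :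
    ι₀ p = (inner ℝ (φ (π₀ p)) (ι₀ p) : ℝ) • φ (π₀ p) := by
  obtain ⟨r, hr⟩ := h.exists_smul_eq p
  rw [hr, inner_smul_right, real_inner_self_eq_norm_sq, h.rOrientation.norm_eq_one]
  simp

lemma exists_eq_smul (h : IsROrientedTwoSidedSLCone (𝓡 3) (𝓡 2) ι₀ π₀ φ) (σ : S) (r : ℝ) :
    ∃ p : N₀, π₀ p = σ ∧ ι₀ p = r • φ σ := by
  obtain ⟨a, d, hd, hl⟩ := h.ruled.fibre_line σ
  obtain ⟨q, hq, hq0⟩ := h.through_zero σ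
  have h0 : (0 : C3) ∈ ι₀ '' (π₀ ⁻¹' {σ}) := ⟨q, hq, hq0⟩
  rw [hl] at h0
  obtain ⟨r₀, hr₀⟩ := h0
  have hmem : ∀ s : ℝ, ∃ p : N₀, π₀ p = σ ∧ ι₀ p = s • d := by
    intro s
    have hs : s • d ∈ ι₀ '' (π₀ ⁻¹' {σ}) := by
      rw [hl]
      refine ⟨s + r₀, ?_⟩
      rw [add_smul, add_comm (s • d), ← add_assoc, ← hr₀, zero_add]
    obtain ⟨p, hp, hps⟩ := hs
    exact ⟨p, hp, hps⟩
  obtain ⟨p, hp, hpd⟩ := hmem 1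
  obtain ⟨c, hc⟩ := h.exists_smul_eq p
  rw [hpd, one_smul, hp] at hc
  have hc0 : c ≠ 0 := fun h0 => hd (by rw [hc, h0, zero_smul])
  obtain ⟨p', hp', hpd'⟩ := hmem (r / c)
  exact ⟨p', hp', by rw [hpd', hc, smul_smul, div_mul_cancel₀ _ hc0]⟩

lemma range_eq (h : IsROrientedTwoSidedSLCone (𝓡 3) (𝓡 2) ι₀ π₀ φ) :
    Set.range ι₀ = {x : C3 | ∃ (r : ℝ) (σ : S), x = r • φ σ} := by
  ext x
  constructor
  · rintro ⟨p, rfl⟩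
    obtain ⟨r, hr⟩ := h.exists_smul_eq p
    exact ⟨r, _, hr⟩
  · rintro ⟨r, σ, rfl⟩
    obtain ⟨p, -, hp⟩ := h.exists_eq_smul σ r
    exact ⟨p, hp⟩

lemma isConePatch (h : IsROrientedTwoSidedSLCone (𝓡 3) (𝓡 2) ι₀ π₀ φ)
    {e : OpenPartialHomeomorph S ℂ} (he : IsSmoothChart e) :
    IsConePatch (fun z => φ (e.symm z)) e.target := by
  have key : ∀ z ∈ e.target, ContDiffAt ℝ ∞ (fun z => φ (e.symm z)) z ∧
      Function.Injective (fderiv ℝ (fun z => φ (e.symm z)) z) ∧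
      ∃ V : Submodule ℝ C3, IsSpecialLagrangianPlane V ∧ φ (e.symm z) ∈ V ∧
      ∀ v, fderiv ℝ (fun z => φ (e.symm z)) z v ∈ V := by
    intro z hz
    -- At the point mapped to the unit vector the map is nonzero, so `ι₀` is immersed there with
    -- special Lagrangian tangent plane.
    obtain ⟨p, hp, hιp⟩ := h.exists_eq_smul (e.symm z) 1
    rw [one_smul] at hιp
    have hpe : π₀ p ∈ e.source := by
      rw [hp]
      exact e.map_target hz
    have hzp : e (π₀ p) = z := by rw [hp, e.right_inv hz]
    have hι := h.ruled.smooth_map p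
    have hπ := h.ruled.smooth_proj p
    have heπ : ContMDiffAt (𝓡 3) 𝓘(ℝ, ℂ) ∞ (fun q => e (π₀ q)) p := (he.contMDiffAt hpe).comp p hπ
    set c := chartAt (EuclideanSpace ℝ (Fin 3)) p with hc
    set x := c p with hx
    have hcx : c.symm x = p := c.left_inv (mem_chart_source _ p)
    have hxt : x ∈ c.target := mem_chart_target _ p
    set ι : EuclideanSpace ℝ (Fin 3) → C3 := fun y => ι₀ (c.symm y) with hιdef
    set π : EuclideanSpace ℝ (Fin 3) → ℂ := fun y => e (π₀ (c.symm y)) with hπdef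
    have hιs : ContDiffAt ℝ ∞ ι x := contDiffAt_comp_chartAt_symm hι
    have hπs : ContDiffAt ℝ ∞ π x := contDiffAt_comp_chartAt_symm heπ
    have hπx : π x = z := by rw [hπdef]; simp only [hcx, hzp]
    have hdι : mfderiv (𝓡 3) 𝓘(ℝ, C3) ι₀ p = fderiv ℝ ι x :=
      mfderiv_eq_fderiv_extChartAt (hι.mdifferentiableAt (by simp))
    have hdπ : mfderiv (𝓡 3) 𝓘(ℝ, ℂ) (fun q => e (π₀ q)) p = fderiv ℝ π x :=
      mfderiv_eq_fderiv_extChartAt (heπ.mdifferentiableAt (by simp))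
    have hsurj : Function.Surjective (fderiv ℝ π x) := by
      rw [← hdπ, show (fun q => e (π₀ q)) = e ∘ π₀ from rfl,
        mfderiv_comp p ((he.contMDiffAt hpe).mdifferentiableAt (by simp))
          (hπ.mdifferentiableAt (by simp))]
      exact (he.mdifferentiable.mfderiv_bijective hpe).2.comp (h.ruled.submersion p)
    have hιp0 : ι₀ p ≠ 0 := by
      rw [hιp, ← norm_ne_zero_iff, h.rOrientation.norm_eq_one]
      exact one_ne_zero
    have himm := h.immersed p hιp0
    have hSL := h.specialLagrangian p himm
    have hinj : Function.Injective (fderiv ℝ ι x) := hdι ▸ himm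
    have hSL' : IsSpecialLagrangianPlane (fderiv ℝ ι x).toLinearMap.range := hdι ▸ hSL
    have hG : ContinuousAt (fun z => φ (e.symm z)) (π x) := by
      rw [hπx]
      exact h.rOrientation.continuous.continuousAt.comp (e.continuousAt_symm hz)
    have hG1 : ∀ᶠ y in 𝓝 (π x), ‖φ (e.symm y)‖ = 1 :=
      Filter.Eventually.of_forall fun y => h.rOrientation.norm_eq_one _
    have hιx : ι x = φ (e.symm (π x)) := by
      rw [hπx, ← hιp, hιdef]
      simp only [hcx]
    have heq : ∀ᶠ y in 𝓝 x, ι y = (inner ℝ (φ (e.symm (π y))) (ι y) : ℝ) • φ (e.symm (π y)) := by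
      have hcont : ContinuousAt (fun y => π₀ (c.symm y)) x :=
        ContinuousAt.comp (g := π₀) (by rw [hcx]; exact hπ.continuousAt) (c.continuousAt_symm hxt)
      have hnear : ∀ᶠ y in 𝓝 x, π₀ (c.symm y) ∈ e.source :=
        hcont.eventually_mem (e.open_source.mem_nhds (by rw [hcx]; exact hpe))
      filter_upwards [hnear] with y hy
      have h1 := h.eq_inner_smul (c.symm y)
      have h2 : e.symm (π y) = π₀ (c.symm y) := e.left_inv hy
      rw [h2]
      exact h1
    have hsm := contDiffAt_direction (G := fun z => φ (e.symm z)) hιs hπs hsurj hG hG1 hιx heq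
    have hder := fderiv_direction (G := fun z => φ (e.symm z)) finrank_euclideanSpace_fin
      hιs hπs hsurj hG hG1 hιx heq hinj
    rw [hπx] at hsm hder
    exact ⟨hsm, hder.1, _, hSL', hder.2⟩
  exact ⟨e.open_target, fun z hz => (key z hz).1.contDiffWithinAt,
    fun z hz => h.rOrientation.norm_eq_one _, fun z hz => (key z hz).2.1,
    fun z hz => (key z hz).2.2⟩

lemma isOrientedConformal_iff (h : IsROrientedTwoSidedSLCone (𝓡 3) (𝓡 2) ι₀ π₀ φ)
    {e : OpenPartialHomeomorph S ℂ} : IsOrientedConformal (𝓡 2) φ e ↔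
      IsSmoothChart e ∧ IsConformalPatch (fun z => φ (e.symm z)) e.target := by
  constructor
  · intro hc
    have he : IsSmoothChart e := ⟨hc.smooth, hc.smooth_symm⟩
    have hp := h.isConePatch he
    exact ⟨he, hp.isConformalPatch fun z hz => (hp.conformal_iff hz).1
      ⟨hc.norm_eq z hz, hc.orthogonal z hz, hc.oriented z hz⟩⟩
  · rintro ⟨he, hc⟩
    have hp := h.isConePatch he
    have h1 := fun z hz => (hp.conformal_iff hz).2 (hc.eq_cross z hz)
    exact ⟨he.1, he.2, fun z hz => (h1 z hz).1, fun z hz => (h1 z hz).2.1,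
      fun z hz => (h1 z hz).2.2⟩

/-- Oriented conformal coordinates exist around every point. -/
lemma exists_isOrientedConformal [IsManifold (𝓡 2) ∞ S]
    (h : IsROrientedTwoSidedSLCone (𝓡 3) (𝓡 2) ι₀ π₀ φ) (σ : S) :
    ∃ e : OpenPartialHomeomorph S ℂ, σ ∈ e.source ∧ IsOrientedConformal (𝓡 2) φ e := by
  obtain ⟨e, hσ, he⟩ := IsSmoothChart.exists_mem_source σ
  obtain ⟨f, hf0, hfs, hf, hf', hc⟩ :=
    (h.isConePatch he).exists_isConformalPatch (e.map_source hσ)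
  refine ⟨e.trans f, ?_, h.isOrientedConformal_iff.2 ⟨he.trans hf hf', ?_⟩⟩
  · rw [OpenPartialHomeomorph.trans_source]
    exact ⟨hσ, hf0⟩
  · have : (e.trans f).target = f.target := by
      rw [OpenPartialHomeomorph.trans_target, Set.inter_eq_left]
      exact fun w hw => hfs (f.map_target hw)
    rw [this]
    exact hc

end IsROrientedTwoSidedSLCone

end

/-! ### The Riemann surface structure. -/

noncomputable section
open Topology ComplexConjugate

lemma IsConformalPatch.of_locally {F : ℂ → C3} {U : Set ℂ} (hU : IsOpen U)
    (h : ∀ z ∈ U, ∃ (V : Set ℂ) (G : ℂ → C3), z ∈ V ∧ IsConformalPatch G V ∧ F =ᶠ[𝓝 z] G) :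
    IsConformalPatch F U := by
  refine ⟨hU, fun z hz => ?_, fun z hz => ?_, fun z hz => ?_, fun z hz => ?_, fun z hz => ?_⟩ <;>
    obtain ⟨V, G, hzV, hG, hFG⟩ := h z hz
  · exact ((hG.contDiffAt hzV).congr_of_eventuallyEq hFG).contDiffWithinAt
  · rw [hFG.eq_of_nhds]
    exact hG.norm_eq_one z hzV
  · rw [hFG.fderiv_eq]
    exact hG.ne_zero z hzV
  · rw [hFG.fderiv_eq, hFG.eq_of_nhds]
    exact hG.kahler z hzV
  · rw [hFG.fderiv_eq, hFG.eq_of_nhds]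
    exact hG.eq_cross z hzV

lemma OpenPartialHomeomorph.deriv_ne_zero {e : OpenPartialHomeomorph ℂ ℂ}
    (he : DifferentiableOn ℂ e e.source) (he' : DifferentiableOn ℂ e.symm e.target) {z : ℂ}
    (hz : z ∈ e.source) : deriv e z ≠ 0 := by
  have h1 := (he.differentiableAt (e.open_source.mem_nhds hz)).hasDerivAt
  have h2 := (he'.differentiableAt (e.open_target.mem_nhds (e.map_source hz))).hasDerivAt
  have h3 := (h2.comp z h1).congr_of_eventuallyEq (f₁ := id) (by
    filter_upwards [e.open_source.mem_nhds hz] with y hy using (e.left_inv hy).symm)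
  intro h0
  rw [h0, mul_zero] at h3
  exact zero_ne_one (h3.unique (hasDerivAt_id z))

namespace IsROrientedTwoSidedSLCone

variable {S : Type*} [TopologicalSpace S]
    [ChartedSpace (EuclideanSpace ℝ (Fin 2)) S]
    {N₀ : Type*} [TopologicalSpace N₀]
    [ChartedSpace (EuclideanSpace ℝ (Fin 3)) N₀]
    {ι₀ : N₀ → C3} {π₀ : N₀ → S} {φ : S → C3}

lemma differentiableOn_trans (h : IsROrientedTwoSidedSLCone (𝓡 3) (𝓡 2) ι₀ π₀ φ)
    {e e' : OpenPartialHomeomorph S ℂ} (he : IsOrientedConformal (𝓡 2) φ e)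
    (he' : IsOrientedConformal (𝓡 2) φ e') :
    DifferentiableOn ℂ (e.symm.trans e') (e.symm.trans e').source := by
  rw [h.isOrientedConformal_iff] at he he'
  intro z hz
  have hs := (he.1.contDiffOn_trans he'.1).contDiffAt ((e.symm.trans e').open_source.mem_nhds hz)
  refine (he.2.differentiableAt_complex he'.2 hz.1 (e'.map_source hz.2)
    (hs.differentiableAt (by simp)) ?_).differentiableWithinAt
  filter_upwards [(e.symm.trans e').open_source.mem_nhds hz] with y hy
  exact congrArg φ (e'.left_inv hy.2).symm

lemma equations (h : IsROrientedTwoSidedSLCone (𝓡 3) (𝓡 2) ι₀ π₀ φ)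
    {e : OpenPartialHomeomorph S ℂ} (he : IsOrientedConformal (𝓡 2) φ e) {z : ℂ}
    (hz : z ∈ e.target) : kahlerForm (φ (e.symm z)) (partialS φ e z) = 0 ∧
      partialT φ e z = crossC (φ (e.symm z)) (partialS φ e z) := by
  have hp := (h.isOrientedConformal_iff.1 he).2
  exact ⟨hp.kahler z hz, hp.eq_cross z hz⟩

variable [IsManifold (𝓡 2) ∞ S]

/-- The Riemann surface structure on the ruling of a special Lagrangian cone. -/
@[reducible] def chartedSpace (h : IsROrientedTwoSidedSLCone (𝓡 3) (𝓡 2) ι₀ π₀ φ) :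
    ChartedSpace ℂ S where
  atlas := {e | IsOrientedConformal (𝓡 2) φ e}
  chartAt σ := (h.exists_isOrientedConformal σ).choose
  mem_chart_source σ := (h.exists_isOrientedConformal σ).choose_spec.1
  chart_mem_atlas σ := (h.exists_isOrientedConformal σ).choose_spec.2

lemma isManifold (h : IsROrientedTwoSidedSLCone (𝓡 3) (𝓡 2) ι₀ π₀ φ) :
    letI := h.chartedSpace
    IsManifold 𝓘(ℂ) ω S := by
  let _ := h.chartedSpace
  refine isManifold_of_contDiffOn 𝓘(ℂ) ω S fun e e' he he' => ?_
  simp only [mfld_simps]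
  exact (h.differentiableOn_trans he he').contDiffOn (e.symm.trans e').open_source

/-- The atlas already contains all oriented conformal coordinates. Conversely, a compatible chart
differs from one of them locally by a biholomorphism, and both smoothness and `φ_t = φ × φ_s`
survive such a change. -/
lemma mem_maximalAtlas_iff (h : IsROrientedTwoSidedSLCone (𝓡 3) (𝓡 2) ι₀ π₀ φ)
    (e : OpenPartialHomeomorph S ℂ) :
    letI := h.chartedSpace
    e ∈ IsManifold.maximalAtlas 𝓘(ℂ) ω S ↔ IsOrientedConformal (𝓡 2) φ e := by
  let _ := h.chartedSpace
  have := h.isManifold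
  constructor
  · intro he
    have htrans : ∀ c : OpenPartialHomeomorph S ℂ, IsOrientedConformal (𝓡 2) φ c →
        DifferentiableOn ℂ (e.symm.trans c) (e.symm.trans c).source ∧
        DifferentiableOn ℂ (c.symm.trans e) (c.symm.trans e).source := by
      intro c hc
      have hc' : c ∈ IsManifold.maximalAtlas 𝓘(ℂ) ω S :=
        IsManifold.subset_maximalAtlas (I := 𝓘(ℂ)) (n := ω) (M := S) hc
      exact ⟨(contMDiffOn_of_mem_contDiffGroupoid
          (StructureGroupoid.compatible_of_mem_maximalAtlas he hc')).contDiffOn.differentiableOn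
            (by simp),
        (contMDiffOn_of_mem_contDiffGroupoid
          (StructureGroupoid.compatible_of_mem_maximalAtlas hc' he)).contDiffOn.differentiableOn
            (by simp)⟩
    have hsm : ∀ {f : OpenPartialHomeomorph ℂ ℂ}, DifferentiableOn ℂ f f.source →
        ∀ {z}, z ∈ f.source → ContMDiffAt 𝓘(ℝ, ℂ) 𝓘(ℝ, ℂ) ∞ f z := fun {f} hf {z} hz =>
      (((hf.contDiffOn f.open_source).contDiffAt
        (f.open_source.mem_nhds hz)).restrict_scalars ℝ).contMDiffAt
    have hsmooth : IsSmoothChart e := by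
      constructor
      · intro σ hσ
        obtain ⟨c, hσc, hc⟩ := h.exists_isOrientedConformal σ
        have hc2 := (h.isOrientedConformal_iff.1 hc).1
        have hz : c σ ∈ (c.symm.trans e).source := by
          rw [OpenPartialHomeomorph.trans_source]
          refine ⟨c.map_source hσc, ?_⟩
          rw [Set.mem_preimage, c.left_inv hσc]
          exact hσ
        refine ContMDiffAt.contMDiffWithinAt
          (((hsm (htrans c hc).2 hz).comp σ (hc2.contMDiffAt hσc)).congr_of_eventuallyEq ?_)
        filter_upwards [c.open_source.mem_nhds hσc] with y hy
        simp only [Function.comp, OpenPartialHomeomorph.trans_apply, c.left_inv hy]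
      · intro z hz
        obtain ⟨c, hσc, hc⟩ := h.exists_isOrientedConformal (e.symm z)
        have hc2 := (h.isOrientedConformal_iff.1 hc).1
        have hz' : z ∈ (e.symm.trans c).source := ⟨hz, hσc⟩
        have h1 : ContMDiffAt 𝓘(ℝ, ℂ) (𝓡 2) ∞ c.symm ((e.symm.trans c) z) :=
          hc2.2.contMDiffAt (c.open_target.mem_nhds (c.map_source hσc))
        refine ContMDiffAt.contMDiffWithinAt
          ((h1.comp z (hsm (htrans c hc).1 hz')).congr_of_eventuallyEq ?_)
        filter_upwards [(e.symm.trans c).open_source.mem_nhds hz'] with y hy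
        simp only [Function.comp, OpenPartialHomeomorph.trans_apply]
        exact (c.left_inv hy.2).symm
    refine h.isOrientedConformal_iff.2 ⟨hsmooth, ?_⟩
    refine IsConformalPatch.of_locally e.open_target fun z hz => ?_
    obtain ⟨c, hσc, hc⟩ := h.exists_isOrientedConformal (e.symm z)
    have hc2 := (h.isOrientedConformal_iff.1 hc).2
    have hz' : z ∈ (e.symm.trans c).source := ⟨hz, hσc⟩
    refine ⟨(e.symm.trans c).source, _, hz',
      hc2.comp (e.symm.trans c).open_source (htrans c hc).1
        (fun y hy => c.map_source hy.2)
        (fun y hy => OpenPartialHomeomorph.deriv_ne_zero (htrans c hc).1 ?_ hy), ?_⟩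
    · have := (htrans c hc).2
      rwa [← OpenPartialHomeomorph.symm_source, OpenPartialHomeomorph.trans_symm_eq_symm_trans_symm,
        OpenPartialHomeomorph.symm_symm]
    · filter_upwards [(e.symm.trans c).open_source.mem_nhds hz'] with y hy
      exact congrArg φ (c.left_inv hy.2).symm
  · intro he
    exact IsManifold.subset_maximalAtlas (I := 𝓘(ℂ)) (n := ω) (M := S) he

lemma contMDiff_analytic (h : IsROrientedTwoSidedSLCone (𝓡 3) (𝓡 2) ι₀ π₀ φ) :
    letI := h.chartedSpace
    ContMDiff 𝓘(ℝ, ℂ) 𝓘(ℝ, C3) ω φ := by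
  let _ := h.chartedSpace
  intro σ
  have hc : IsOrientedConformal (𝓡 2) φ (chartAt ℂ σ) := chart_mem_atlas ℂ σ
  have hp := (h.isOrientedConformal_iff.1 hc).2
  rw [contMDiffAt_iff]
  refine ⟨h.rOrientation.continuous.continuousAt, ?_⟩
  simp only [mfld_simps]
  exact (hp.analyticAt (mem_chart_target ℂ σ)).contDiffAt.contDiffWithinAt

end IsROrientedTwoSidedSLCone

end

/-! ### Holomorphic vector fields and product charts. -/

noncomputable section
open Topology ComplexConjugate

section HolomorphicVectorField

variable {S : Type*} [TopologicalSpace S] [ChartedSpace ℂ S] [IsManifold 𝓘(ℂ) ω S]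

/-- The components of a vector field in the preferred chart at a point. -/
def vectorFieldCoord (w : ∀ σ : S, TangentSpace 𝓘(ℂ) σ) (σ₀ : S) (z : ℂ) : ℂ :=
  (trivializationAt ℂ (TangentSpace 𝓘(ℂ)) σ₀
    (⟨(chartAt ℂ σ₀).symm z, w ((chartAt ℂ σ₀).symm z)⟩ : TangentBundle 𝓘(ℂ) S)).2

lemma IsHolomorphicVectorField.differentiableOn_coord {w : ∀ σ : S, TangentSpace 𝓘(ℂ) σ}
    (hw : IsHolomorphicVectorField w) (σ₀ : S) :
    DifferentiableOn ℂ (vectorFieldCoord w σ₀) (chartAt ℂ σ₀).target := by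
  have : IsManifold 𝓘(ℂ) (1 + 1) S := IsManifold.of_le (n := ω) le_top
  have : IsManifold 𝓘(ℂ) 1 S := IsManifold.of_le (n := ω) le_top
  have h1 : ContMDiffOn 𝓘(ℂ) 𝓘(ℂ).tangent 1
      (fun σ : S => (⟨σ, w σ⟩ : TangentBundle 𝓘(ℂ) S))
      (trivializationAt ℂ (TangentSpace 𝓘(ℂ)) σ₀).baseSet :=
    (ContMDiff.of_le hw le_top).contMDiffOn
  have h2 := (Bundle.Trivialization.contMDiffOn_section_baseSet_iff (n := 1) (IB := 𝓘(ℂ)) _).1 h1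
  have h3 := h2.comp (contMDiffOn_chart_symm (I := 𝓘(ℂ)) (x := σ₀) (n := 1))
    fun z hz => (chartAt ℂ σ₀).map_target hz
  exact (contMDiffOn_iff_contDiffOn.1 h3).differentiableOn (by simp)

/-- The tangent space at `σ` is `ℂ` through the chart preferred at `σ`, whereas a local formula
needs one fixed chart. The transition map is holomorphic, so its complex derivative, which
transforms `w`, restricts to the real one in the chain rule for `φ`. -/
lemma lieDerivative_eq {w : ∀ σ : S, TangentSpace 𝓘(ℂ) σ} {φ : S → C3}
    (hφ : MDifferentiable 𝓘(ℝ, ℂ) 𝓘(ℝ, C3) φ) (σ₀ : S) {σ : S} (hσ : σ ∈ (chartAt ℂ σ₀).source)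
    (hd : DifferentiableAt ℝ (fun z => φ ((chartAt ℂ σ₀).symm z)) (chartAt ℂ σ₀ σ)) :
    lieDerivative (toRealVectorField w) φ σ =
      fderiv ℝ (fun z => φ ((chartAt ℂ σ₀).symm z)) (chartAt ℂ σ₀ σ)
        (vectorFieldCoord w σ₀ (chartAt ℂ σ₀ σ)) := by
  set c := chartAt ℂ σ₀ with hc
  set c' := chartAt ℂ σ with hc'
  have h1 : lieDerivative (toRealVectorField w) φ σ =
      fderiv ℝ (fun z => φ (c'.symm z)) (c' σ) (w σ) := by
    rw [← mfderiv_eq_fderiv_extChartAt (hφ σ)]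
    rfl
  have hσ' : σ ∈ c'.source := mem_chart_source ℂ σ
  have hmem : c' σ ∈ (c'.symm.trans c).source := by
    rw [OpenPartialHomeomorph.trans_source]
    refine ⟨c'.map_source hσ', ?_⟩
    rw [Set.mem_preimage, c'.left_inv hσ']
    exact hσ
  have hhol : DifferentiableAt ℂ (fun z => c (c'.symm z)) (c' σ) := by
    have h2 := contMDiffOn_of_mem_contDiffGroupoid
      (StructureGroupoid.compatible (contDiffGroupoid ω 𝓘(ℂ)) (chart_mem_atlas ℂ σ)
        (chart_mem_atlas ℂ σ₀))
    exact (h2.contDiffOn.differentiableOn (by simp)).differentiableAt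
      ((c'.symm.trans c).open_source.mem_nhds hmem)
  have h3 : vectorFieldCoord w σ₀ (c σ) = fderiv ℂ (fun z => c (c'.symm z)) (c' σ) (w σ) := by
    rw [vectorFieldCoord, ← hc, c.left_inv hσ, TangentBundle.trivializationAt_apply]
    simp only [mfld_simps]
    rw [fderivWithin_univ]
    rfl
  have heq : (fun z => φ (c'.symm z)) =ᶠ[𝓝 (c' σ)] fun z => φ (c.symm (c (c'.symm z))) := by
    filter_upwards [(c'.symm.trans c).open_source.mem_nhds hmem] with y hy
    exact congrArg φ (c.left_inv hy.2).symm
  have hg := hhol.hasFDerivAt.restrictScalars ℝ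
  have hF : HasFDerivAt (fun z => φ (c.symm z)) (fderiv ℝ (fun z => φ (c.symm z)) (c σ))
      (c (c'.symm (c' σ))) := by
    rw [c'.left_inv hσ']
    exact hd.hasFDerivAt
  rw [h1, h3, heq.fderiv_eq]
  rw [show fderiv ℝ (fun z => φ (c.symm (c (c'.symm z)))) (c' σ) = _ from
    (HasFDerivAt.comp (c' σ) (f := fun z => c (c'.symm z)) hF hg).fderiv]
  rfl

end HolomorphicVectorField

section Charts

variable {E H M E' : Type*} [NormedAddCommGroup E] [NormedSpace ℝ E] [TopologicalSpace H]
    [TopologicalSpace M] [ChartedSpace H M] {I : ModelWithCorners ℝ E H}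
    [NormedAddCommGroup E'] [NormedSpace ℝ E'] {f : M → C3} {K : OpenPartialHomeomorph M E'}
    {g : E' → C3} {g' : E' →L[ℝ] C3} {p : M}

lemma differential_eq_comp (hK : K.MDifferentiable I 𝓘(ℝ, E')) (hp : p ∈ K.source)
    (hg : HasFDerivAt g g' (K p)) (heq : ∀ q ∈ K.source, f q = g (K q)) :
    differential I f p = g'.comp (mfderiv I 𝓘(ℝ, E') K p) := by
  have h1 : f =ᶠ[𝓝 p] g ∘ K := by
    filter_upwards [K.open_source.mem_nhds hp] with q hq using heq q hq
  rw [differential, h1.mfderiv_eq]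
  exact (hg.hasMFDerivAt.comp p (hK.mdifferentiableAt hp).hasMFDerivAt).mfderiv

lemma isImmersedAt_iff_injective (hK : K.MDifferentiable I 𝓘(ℝ, E')) (hp : p ∈ K.source)
    (hg : HasFDerivAt g g' (K p)) (heq : ∀ q ∈ K.source, f q = g (K q)) :
    IsImmersedAt I f p ↔ Function.Injective g' := by
  have hb := hK.mfderiv_bijective hp
  rw [IsImmersedAt, differential_eq_comp hK hp hg heq]
  exact Function.Injective.of_comp_iff' g' hb

lemma range_differential (hK : K.MDifferentiable I 𝓘(ℝ, E')) (hp : p ∈ K.source)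
    (hg : HasFDerivAt g g' (K p)) (heq : ∀ q ∈ K.source, f q = g (K q)) :
    (differential I f p : TangentSpace I p →ₗ[ℝ] C3).range = (g' : E' →ₗ[ℝ] C3).range := by
  have hb := hK.mfderiv_bijective hp
  rw [differential_eq_comp hK hp hg heq]
  exact LinearMap.range_comp_of_range_eq_top _ (LinearMap.range_eq_top.2 hb.2)

end Charts

section ProductChart

variable {S : Type*} [TopologicalSpace S] [ChartedSpace (EuclideanSpace ℝ (Fin 2)) S]

/-- The chart of `S × ℝ` induced by a chart of `S`. -/
def OpenPartialHomeomorph.prodReal (e : OpenPartialHomeomorph S ℂ) :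
    OpenPartialHomeomorph (S × ℝ) (ℂ × ℝ) :=
  e.prod (OpenPartialHomeomorph.refl ℝ)

lemma IsSmoothChart.contMDiffOn_prodReal {e : OpenPartialHomeomorph S ℂ} (he : IsSmoothChart e) :
    ContMDiffOn ((𝓡 2).prod 𝓘(ℝ, ℝ)) 𝓘(ℝ, ℂ × ℝ) ∞ e.prodReal e.prodReal.source := by
  have h1 : ContMDiffOn ((𝓡 2).prod 𝓘(ℝ, ℝ)) 𝓘(ℝ, ℝ) ∞ (Prod.snd : S × ℝ → ℝ)
      e.prodReal.source := contMDiff_snd.contMDiffOn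
  have h2 : ContMDiffOn ((𝓡 2).prod 𝓘(ℝ, ℝ)) (𝓡 2) ∞ (Prod.fst : S × ℝ → S)
      e.prodReal.source := contMDiff_fst.contMDiffOn
  have h3 : ContMDiffOn ((𝓡 2).prod 𝓘(ℝ, ℝ)) 𝓘(ℝ, ℂ) ∞ (fun p : S × ℝ => e p.1)
      e.prodReal.source := he.1.comp h2 fun _ hp => hp.1
  exact h3.prodMk_space h1

lemma IsSmoothChart.mdifferentiable_prodReal {e : OpenPartialHomeomorph S ℂ}
    (he : IsSmoothChart e) :
    e.prodReal.MDifferentiable ((𝓡 2).prod 𝓘(ℝ, ℝ)) 𝓘(ℝ, ℂ × ℝ) := by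
  refine ⟨he.contMDiffOn_prodReal.mdifferentiableOn (by simp), ?_⟩
  have h1 : ContMDiffOn 𝓘(ℝ, ℂ × ℝ) ((𝓡 2).prod 𝓘(ℝ, ℝ)) ∞ e.prodReal.symm e.prodReal.target := by
    have h2 : ContMDiffOn 𝓘(ℝ, ℂ × ℝ) 𝓘(ℝ, ℂ) ∞ (Prod.fst : ℂ × ℝ → ℂ)
      e.prodReal.target := contDiff_fst.contMDiff.contMDiffOn
    have h3 : ContMDiffOn 𝓘(ℝ, ℂ × ℝ) 𝓘(ℝ, ℝ) ∞ (Prod.snd : ℂ × ℝ → ℝ)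
      e.prodReal.target := contDiff_snd.contMDiff.contMDiffOn
    exact (he.2.comp h2 fun _ hp => hp.1).prodMk h3
  exact h1.mdifferentiableOn (by simp)

lemma IsSmoothChart.fst_mfderiv_prodReal {e : OpenPartialHomeomorph S ℂ}
    (he : IsSmoothChart e) {p : S × ℝ} (hp : p.1 ∈ e.source)
    {v : TangentSpace ((𝓡 2).prod 𝓘(ℝ, ℝ)) p}
    (hv : mfderiv ((𝓡 2).prod 𝓘(ℝ, ℝ)) (𝓡 2) Prod.fst p v = 0) :
    (mfderiv ((𝓡 2).prod 𝓘(ℝ, ℝ)) 𝓘(ℝ, ℂ × ℝ) e.prodReal p v : ℂ × ℝ).1 = 0 := by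
  have h1 := (ContinuousLinearMap.fst ℝ ℂ ℝ).hasMFDerivAt.comp p
    (he.mdifferentiable_prodReal.mdifferentiableAt (x := p) ⟨hp, Set.mem_univ _⟩).hasMFDerivAt
  have h2 := ((he.contMDiffAt hp).mdifferentiableAt (by simp)).hasMFDerivAt.comp p
    (hasMFDerivAt_fst (I := 𝓡 2) (I' := 𝓘(ℝ, ℝ)) p)
  have h3 := hasMFDerivAt_unique h1 h2
  have h4 := congrArg (fun L => L v) h3
  rw [mfderiv_fst] at hv
  refine h4.trans ?_
  exact (congrArg (mfderiv (𝓡 2) 𝓘(ℝ, ℂ) e p.1) hv).trans (map_zero _)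

end ProductChart

end

/-! ### The ruled special Lagrangian 3-fold. -/

noncomputable section
open Topology ComplexConjugate

namespace IsROrientedTwoSidedSLCone

variable {S : Type*} [TopologicalSpace S]
    [ChartedSpace (EuclideanSpace ℝ (Fin 2)) S]
    {N₀ : Type*} [TopologicalSpace N₀]
    [ChartedSpace (EuclideanSpace ℝ (Fin 3)) N₀]
    {ι₀ : N₀ → C3} {π₀ : N₀ → S} {φ : S → C3}

/-- The ruled map of a vector-valued function along a cone. -/
def ruledMap (φ ψ : S → C3) (p : S × ℝ) : C3 := p.2 • φ p.1 + ψ p.1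

/-- Local form of the ruled map of a holomorphic vector field. -/
lemma exists_local_form [IsManifold (𝓡 2) ∞ S]
    (h : IsROrientedTwoSidedSLCone (𝓡 3) (𝓡 2) ι₀ π₀ φ) :
    letI := h.chartedSpace
    ∀ (_ : IsManifold 𝓘(ℂ) ω S) (w : ∀ σ : S, TangentSpace 𝓘(ℂ) σ),
      IsHolomorphicVectorField w → ∀ σ₀ : S, ∃ (e : OpenPartialHomeomorph S ℂ) (a : ℂ → ℂ),
        σ₀ ∈ e.source ∧ IsOrientedConformal (𝓡 2) φ e ∧ DifferentiableOn ℂ a e.target ∧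
        ∀ σ ∈ e.source, lieDerivative (toRealVectorField w) φ σ =
          fderiv ℝ (fun z => φ (e.symm z)) (e σ) (a (e σ)) := by
  intro _ w hw σ₀
  let _ := h.chartedSpace
  have hc : IsOrientedConformal (𝓡 2) φ (chartAt ℂ σ₀) := chart_mem_atlas ℂ σ₀
  refine ⟨chartAt ℂ σ₀, vectorFieldCoord w σ₀, mem_chart_source ℂ σ₀, hc,
    hw.differentiableOn_coord σ₀, fun σ hσ => ?_⟩
  exact lieDerivative_eq (h.contMDiff_analytic.mdifferentiable (by simp)) σ₀ hσ
    ((h.isOrientedConformal_iff.1 hc).2.differentiableAt ((chartAt ℂ σ₀).map_source hσ))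

/-- The ruled special Lagrangian submanifolds over a special Lagrangian cone. -/
theorem isROrientedRuledSL (h : IsROrientedTwoSidedSLCone (𝓡 3) (𝓡 2) ι₀ π₀ φ) {ψ : S → C3}
    (hψ : ∀ σ₀ : S, ∃ (e : OpenPartialHomeomorph S ℂ) (a : ℂ → ℂ),
      σ₀ ∈ e.source ∧ IsOrientedConformal (𝓡 2) φ e ∧ DifferentiableOn ℂ a e.target ∧
      ∀ σ ∈ e.source, ψ σ = fderiv ℝ (fun z => φ (e.symm z)) (e σ) (a (e σ))) :
    IsROrientedRuledSL ((𝓡 2).prod 𝓘(ℝ, ℝ)) (𝓡 2) (ruledMap φ ψ) Prod.fst φ := by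
  have hφ0 : ∀ σ, φ σ ≠ 0 := fun σ => by
    rw [← norm_ne_zero_iff, h.rOrientation.norm_eq_one]
    exact one_ne_zero
  have key : ∀ σ : S, ∃ (e : OpenPartialHomeomorph S ℂ) (a : ℂ → ℂ), IsSmoothChart e ∧
      IsConformalPatch (fun z => φ (e.symm z)) e.target ∧ DifferentiableOn ℂ a e.target ∧
      σ ∈ e.source ∧
      ∀ q ∈ e.prodReal.source, ruledMap φ ψ q = (fun y : ℂ × ℝ => y.2 • φ (e.symm y.1) +
        fderiv ℝ (fun z => φ (e.symm z)) y.1 (a y.1)) (e.prodReal q) := by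
    intro σ
    obtain ⟨e, a, hσ, he, ha, hψe⟩ := hψ σ
    obtain ⟨he1, he2⟩ := h.isOrientedConformal_iff.1 he
    refine ⟨e, a, he1, he2, ha, hσ, fun q hq => ?_⟩
    change q.2 • φ q.1 + ψ q.1 = q.2 • φ (e.symm (e q.1)) + _
    rw [hψe q.1 hq.1, e.left_inv hq.1]
    rfl
  have hder : ∀ {e : OpenPartialHomeomorph S ℂ} {a : ℂ → ℂ},
      IsConformalPatch (fun z => φ (e.symm z)) e.target → DifferentiableOn ℂ a e.target →
      ∀ {p : S × ℝ}, p.1 ∈ e.source → HasFDerivAt (fun y : ℂ × ℝ => y.2 • φ (e.symm y.1) +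
        fderiv ℝ (fun z => φ (e.symm z)) y.1 (a y.1))
        ((IsConformalPatch.ruledDeriv (fun z => φ (e.symm z)) a (e p.1) p.2).coprod
          (ContinuousLinearMap.toSpanSingleton ℝ (φ (e.symm (e p.1))))) (e.prodReal p) :=
    fun {e} {a} hc ha {p} hp =>
      hc.hasFDerivAt_ruled (e.map_source hp) ((ha.differentiableAt
        (e.open_target.mem_nhds (e.map_source hp))).restrictScalars ℝ) p.2
  have hadiff : ∀ {e : OpenPartialHomeomorph S ℂ} {a : ℂ → ℂ}, DifferentiableOn ℂ a e.target →
      ∀ {σ : S}, σ ∈ e.source → DifferentiableAt ℂ a (e σ) := fun {e} {a} ha {σ} hσ =>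
    ha.differentiableAt (e.open_target.mem_nhds (e.map_source hσ))
  refine ⟨⟨?_, contMDiff_fst, ?_, ?_, ?_, ?_, ?_⟩, ⟨h.rOrientation.continuous,
    h.rOrientation.norm_eq_one, ?_⟩, ?_⟩
  · intro p
    obtain ⟨e, a, he, hc, ha, hσ, heq⟩ := key p.1
    have hp : p ∈ e.prodReal.source := ⟨hσ, Set.mem_univ _⟩
    have hz := e.map_source hσ
    have hG : ContDiffAt ℝ ∞ (fun z => φ (e.symm z)) (e p.1) := hc.contDiffAt hz
    have hG' : ContDiffAt ℝ ∞ (fun z => fderiv ℝ (fun z => φ (e.symm z)) z (a z)) (e p.1) :=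
      (hG.fderiv_right (by norm_cast)).clm_apply
        (((ha.contDiffOn e.open_target).contDiffAt (e.open_target.mem_nhds hz)).restrict_scalars ℝ)
    have hsm : ContDiffAt ℝ ∞ (fun y : ℂ × ℝ => y.2 • φ (e.symm y.1) +
        fderiv ℝ (fun z => φ (e.symm z)) y.1 (a y.1)) (e.prodReal p) :=
      (contDiffAt_snd.smul (ContDiffAt.comp (e.prodReal p) (f := Prod.fst) hG contDiffAt_fst)).add
        (ContDiffAt.comp (e.prodReal p) (f := Prod.fst) hG' contDiffAt_fst)
    refine (hsm.contMDiffAt.comp p (he.contMDiffOn_prodReal.contMDiffAt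
      (e.prodReal.open_source.mem_nhds hp))).congr_of_eventuallyEq ?_
    filter_upwards [e.prodReal.open_source.mem_nhds hp] with q hq using heq q hq
  · rw [dense_iff_inter_open]
    rintro O hO ⟨⟨σ, r⟩, hr⟩
    obtain ⟨e, a, he, hc, ha, hσ, heq⟩ := key σ
    have hiff : ∀ s : ℝ, IsImmersedAt ((𝓡 2).prod 𝓘(ℝ, ℝ)) (ruledMap φ ψ) (σ, s) ↔ _ := fun s =>
      isImmersedAt_iff_injective he.mdifferentiable_prodReal (p := (σ, s)) ⟨hσ, Set.mem_univ _⟩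
        (hder hc ha (p := (σ, s)) hσ) heq
    by_cases himm : IsImmersedAt ((𝓡 2).prod 𝓘(ℝ, ℝ)) (ruledMap φ ψ) (σ, r)
    · exact ⟨_, hr, himm⟩
    have hopen : IsOpen ((fun s : ℝ => (σ, s)) ⁻¹' O) := hO.preimage (by fun_prop)
    -- Each line has no more than one singular point, so an arbitrarily small move along the ruling
    -- reaches an immersed one.
    obtain ⟨ε, hε, hball⟩ := Metric.isOpen_iff.1 hopen r hr
    refine ⟨(σ, r + ε / 2), hball ?_, ?_⟩
    · rw [Metric.mem_ball, Real.dist_eq, add_sub_cancel_left, abs_of_pos (by positivity)]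
      linarith
    · by_contra himm'
      rw [Set.mem_ofPred_eq, hiff] at himm'
      rw [hiff] at himm
      have := hc.ruled_not_injective_subsingleton (e.map_source hσ) (hadiff ha hσ) himm himm'
      linarith
  · intro p v
    refine ⟨(v, 0), ?_⟩
    rw [mfderiv_fst]
    rfl
  · rintro σ ⟨σ₁, r⟩ h1 ⟨σ₂, r'⟩ h2 heq
    obtain rfl : σ₁ = σ := h1
    obtain rfl : σ₂ = σ₁ := h2
    have h3 : r • φ σ₂ = r' • φ σ₂ := add_right_cancel heq
    rw [smul_left_injective ℝ (hφ0 σ₂) h3]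
  · intro p v hv hdv
    obtain ⟨e, a, he, hc, ha, hσ, heq⟩ := key p.1
    have hp : p ∈ e.prodReal.source := ⟨hσ, Set.mem_univ _⟩
    rw [differential_eq_comp he.mdifferentiable_prodReal hp (hder hc ha hσ) heq] at hdv
    have h1 := he.fst_mfderiv_prodReal hσ hv
    set u : ℂ × ℝ := mfderiv ((𝓡 2).prod 𝓘(ℝ, ℝ)) 𝓘(ℝ, ℂ × ℝ) e.prodReal p v with hu
    have h2 : (IsConformalPatch.ruledDeriv (fun z => φ (e.symm z)) a (e p.1) p.2).coprod
          (ContinuousLinearMap.toSpanSingleton ℝ (φ (e.symm (e p.1)))) u = 0 := hdv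
    rw [ContinuousLinearMap.coprod_apply, h1, map_zero, zero_add,
      ContinuousLinearMap.toSpanSingleton_apply, smul_eq_zero] at h2
    have h3 : u = 0 := Prod.ext h1 (h2.resolve_right (hφ0 _))
    exact (he.mdifferentiable_prodReal.mfderiv_bijective hp).1 (h3.trans (map_zero _).symm)
  · intro σ
    refine ⟨ψ σ, φ σ, hφ0 σ, ?_⟩
    ext x
    constructor
    · rintro ⟨⟨σ', r⟩, h1, rfl⟩
      obtain rfl : σ' = σ := h1
      exact ⟨r, add_comm _ _⟩
    · rintro ⟨r, rfl⟩
      exact ⟨(σ, r), rfl, add_comm _ _⟩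
  · rintro ⟨σ, r⟩ ⟨σ', r'⟩ h1
    obtain rfl : σ = σ' := h1
    refine ⟨r' - r, ?_⟩
    simp only [ruledMap, sub_smul]
    abel
  · intro p himm
    obtain ⟨e, a, he, hc, ha, hσ, heq⟩ := key p.1
    have hp : p ∈ e.prodReal.source := ⟨hσ, Set.mem_univ _⟩
    rw [isImmersedAt_iff_injective he.mdifferentiable_prodReal hp (hder hc ha hσ) heq] at himm
    rw [range_differential he.mdifferentiable_prodReal hp (hder hc ha hσ) heq]
    exact hc.isSpecialLagrangianPlane_range (e.map_source hσ) (hadiff ha hσ) p.2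
      ((hc.ruled_injective_iff (e.map_source hσ) (hadiff ha hσ) p.2).1 himm)

end IsROrientedTwoSidedSLCone

end

theorem theorem6p1
    {S : Type*} [TopologicalSpace S] [T2Space S] [SecondCountableTopology S]
    [ChartedSpace (EuclideanSpace ℝ (Fin 2)) S] [IsManifold (𝓡 2) ∞ S]
    {N₀ : Type*} [TopologicalSpace N₀] [T2Space N₀] [SecondCountableTopology N₀]
    [ChartedSpace (EuclideanSpace ℝ (Fin 3)) N₀] [IsManifold (𝓡 3) ∞ N₀]
    (ι₀ : N₀ → C3) (π₀ : N₀ → S) (φ : S → C3)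
    (hN₀ : IsROrientedTwoSidedSLCone (𝓡 3) (𝓡 2) ι₀ π₀ φ) :
    -- `N₀ = {r φ(σ)}`
    Set.range ι₀ = {x : C3 | ∃ (r : ℝ) (σ : S), x = r • φ σ} ∧
    -- `S` is a Riemann surface, whose holomorphic coordinates are the oriented conformal ones
    ∃ (_ : ChartedSpace ℂ S) (_ : IsManifold 𝓘(ℂ) ω S),
      (∀ e : OpenPartialHomeomorph S ℂ,
        e ∈ IsManifold.maximalAtlas 𝓘(ℂ) ω S ↔ IsOrientedConformal (𝓡 2) φ e) ∧
      -- `φ` is real analytic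
      ContMDiff 𝓘(ℝ, ℂ) 𝓘(ℝ, C3) ω φ ∧
      -- the equations in oriented conformal coordinates
      (∀ e : OpenPartialHomeomorph S ℂ, IsOrientedConformal (𝓡 2) φ e →
        ∀ z ∈ e.target,
          kahlerForm (φ (e.symm z)) (partialS φ e z) = 0 ∧
          partialT φ e z = crossC (φ (e.symm z)) (partialS φ e z)) ∧
      -- the ruled special Lagrangian 3-fold of a holomorphic vector field
      ∀ w : (∀ σ : S, TangentSpace 𝓘(ℂ) σ), IsHolomorphicVectorField w →
        IsROrientedRuledSL ((𝓡 2).prod 𝓘(ℝ, ℝ)) (𝓡 2)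
          (fun p : S × ℝ => p.2 • φ p.1 + lieDerivative (toRealVectorField w) φ p.1)
          Prod.fst φ := by
  refine ⟨hN₀.range_eq, hN₀.chartedSpace, hN₀.isManifold, hN₀.mem_maximalAtlas_iff,
    hN₀.contMDiff_analytic, fun e he z hz => hN₀.equations he hz, fun w hw => ?_⟩
  exact hN₀.isROrientedRuledSL (hN₀.exists_local_form hN₀.isManifold w hw)
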